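/- **Setting.** Let $\rho_0$ be a probability density on $\mathbb R^d$ and $\rho_1$ a probability measure on $\mathbb R^d$. Let $\phi_{t,x_1}(x_0)$ be a jointly measurable conditional flow such that for every $0<t<1$ and $x_1\in\mathbb R^d$ the map $x_0\mapsto\phi_{t,x_1}(x_0)$ is a bijection of $\mathbb R^d$ with jointly measurable inverse that is differentiable in space, and $t\mapsto\phi_{t,x_1}(x_0)$ is differentiable on $(0,1)$, with derivative $\phi'_{t,x_1}(x_0)$. Put $$w(t,x_1,x)=\phi'_{t,x_1}\bigl(\phi_{t,x_1}^{-1}(x)\bigr),\qquad \rho_{x_1}(x,t)=\rho_0\bigl(\phi_{t,x_1}^{-1}(x)\bigr)\,\Bigl|\det\tfrac{\partial\phi_{t,x_1}^{-1}(x)}{\partial x}\Bigr|,\qquad v(x,t)=\frac{\int w(t,x_1,x)\,\rho_{x_1}(x,t)\,d\rho_1(x_1)}{\int \rho_{x_1}(x,t)\,d\rho_1(x_1)} .$$ **Samples.** Let $t^1,\dots,t^m$ be uniform on $[0,1]$, $x_0^1,\dots,x_0^n\sim\rho_0$, and $\bar x^1,\dots,\bar x^N\sim\rho_1$ with $N\ge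 n$, all independent. Put $x_1^i=\bar x^i$ for $i\le n$ and $x^{j,i}=\phi_{t^j,x_1^i}(x_0^i)$. **Losses.** For a model $v_\theta(x,t)\in\mathbb R^d$ with parameter $\theta\in\mathbb R^p$, measurable in $(x,t)$ for every parameter value and, for all $x,t$, differentiable in the parameter at the $\theta$ considered, let $$L^d_{\rm CFM}(\theta)=\sum_{j=1}^m\sum_{i=1}^n\bigl\|v_\theta(x^{j,i},t^j)-\phi'_{t^j,x_1^i}(x_0^i)\bigr\|^2,\qquad L^d_{\rm ExFM}(\theta)=\sum_{j=1}^m\sum_{i=1}^n\bigl\|v_\theta(x^{j,i},t^j)-v^d(x^{j,i},t^j)\bigr\|^2,$$ where $v^d$ is the self-normalized importance-sampling average $$v^d(x,t)=\frac{\sum_{k=1}^N w(t,\bar x^k,x)\,\rho_{\bar x^k}(x,t)}{\sum_{k=1}^N\rho_{\bar x^k}(x,t)} .$$ Let $G_{\rm CFM}$, $G_{\rm ExFM}$ be the gradients at $\theta$ of these two losses, and let $G_*$ be the gradient at $\theta$ of the same sum with the exact target $v(x^{j,i},t^j)$. Let $g^{j,i}_{\rm CFM}$, $g^{j,i}_{\rm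 ExFM}$, $g^{j,i}_*$ be the gradients of the $(j,i)$ summands. **Theorem.** Assume that the (continuous) CFM loss $\mathbb E\|v_\theta(\phi_{t,x_1}(x_0),t)-\phi'_{t,x_1}(x_0)\|^2$ is finite at $\theta$ and that the gradient at $\theta$ of $\|v_\theta(\phi_{t,x_1}(x_0),t)-\phi'_{t,x_1}(x_0)\|^2$ has a finite second moment, for independent $t\sim\mathcal U[0,1]$, $x_0\sim\rho_0$, $x_1\sim\rho_1$. Let $m,n\ge 0$ be integers. 1. For every $N\ge n$ and all $i,j$, the vectors $g^{j,i}_{\rm CFM}$ and $g^{j,i}_{\rm ExFM}$ are square integrable, and given the model arguments $(x^{j,i},t^j)$ both have conditional mean $g^{j,i}_*$. For every $u\in\mathbb R^p$, almost surely, $$\mathbb D\bigl(\langle u,g^{j,i}_{\rm ExFM}\rangle\,\big|\,x^{j,i},t^j\bigr)\le\mathbb D\bigl(\langle u,g^{j,i}_{\rm CFM}\rangle\,\big|\,x^{j,i},t^j\bigr),$$ and if $N\ge2$ the inequality is strict wherever the right side is positive. 2. The errors $G_{\rm CFM}-G_*$ and $G_{\rm ExFM}-G_*$ of the two gradients at the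 given model arguments are square integrable with mean zero, for every $N\ge n$. For every $u\in\mathbb R^p$ with $\mathbb D\langle u,G_{\rm CFM}-G_*\rangle>0$ there is $N_0$ such that for all $N\ge \max(N_0,n)$ $$\mathbb D\langle u,G_{\rm ExFM}-G_*\rangle<\mathbb D\langle u,G_{\rm CFM}-G_*\rangle .$$ Likewise, if $\mathbb E\|G_{\rm CFM}-G_*\|^2>0$, there is $N_0$ such that $\mathbb E\|G_{\rm ExFM}-G_*\|^2<\mathbb E\|G_{\rm CFM}-G_*\|^2$ for all $N\ge \max(N_0,n)$. 3. If $m=1$, then for every $u$ with $\mathbb D\langle u,G_{\rm CFM}-G_*\rangle>0$ there is $N_0$ such that $\mathbb D\langle u,G_{\rm ExFM}\rangle<\mathbb D\langle u,G_{\rm CFM}\rangle$ for all $N\ge \max(N_0,n)$, where the model arguments are random too. -/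

import Mathlib

open MeasureTheory ProbabilityTheory
open scoped ENNReal

noncomputable section

/-- The space `ℝᵈ` with its Euclidean structure. -/
abbrev Vec (d : ℕ) := EuclideanSpace ℝ (Fin d)

/-- A conditional flow `φ_{t,x₁}` on `ℝᵈ`: for `0 < t < 1` and every `x₁` the map
`x₀ ↦ φ_{t,x₁}(x₀)` is invertible, its inverse is differentiable in space, and the trajectories
`t ↦ φ_{t,x₁}(x₀)` are differentiable. The arguments are in the order `t`, `x₁`, point. -/
structure ConditionalFlow (d : ℕ) where
  /-- `φ_{t,x₁}(x₀)` -/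
  map : ℝ → Vec d → Vec d → Vec d
  /-- `φ_{t,x₁}⁻¹(x)` -/
  inv : ℝ → Vec d → Vec d → Vec d
  left_inv : ∀ t ∈ Set.Ioo (0 : ℝ) 1, ∀ x₁ x₀, inv t x₁ (map t x₁ x₀) = x₀
  right_inv : ∀ t ∈ Set.Ioo (0 : ℝ) 1, ∀ x₁ x, map t x₁ (inv t x₁ x) = x
  differentiable_inv : ∀ t ∈ Set.Ioo (0 : ℝ) 1, ∀ x₁, Differentiable ℝ (inv t x₁)
  differentiableAt_time : ∀ t ∈ Set.Ioo (0 : ℝ) 1, ∀ x₁ x₀,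
    DifferentiableAt ℝ (fun s => map s x₁ x₀) t
  measurable_map : Measurable fun z : ℝ × Vec d × Vec d => map z.1 z.2.1 z.2.2
  measurable_inv : Measurable fun z : ℝ × Vec d × Vec d => inv z.1 z.2.1 z.2.2

namespace ConditionalFlow

variable {d : ℕ} (φ : ConditionalFlow d)

/-- The time derivative `φ'_{t,x₁}(x₀)`. -/
def timeDeriv (t : ℝ) (x₁ x₀ : Vec d) : Vec d :=
  deriv (fun s => φ.map s x₁ x₀) t

/-- The conditional velocity `w(t,x₁,x) = φ'_{t,x₁}(φ_{t,x₁}⁻¹(x))` at the point `x`. -/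
def velocity (t : ℝ) (x₁ x : Vec d) : Vec d :=
  φ.timeDeriv t x₁ (φ.inv t x₁ x)

/-- The conditional density
`ρ_{x₁}(x,t) = ρ₀(φ_{t,x₁}⁻¹(x)) |det ∂φ_{t,x₁}⁻¹(x)/∂x|`, the push-forward of `ρ₀`. -/
def condDensity (ρ₀ : Vec d → ℝ) (t : ℝ) (x₁ x : Vec d) : ℝ :=
  ρ₀ (φ.inv t x₁ x) * |(fderiv ℝ (φ.inv t x₁) x).det|

/-- The exact vector field
`v(x,t) = ∫ w(t,x₁,x) ρ_{x₁}(x,t) dρ₁(x₁) / ∫ ρ_{x₁}(x,t) dρ₁(x₁)`. -/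
def exactVelocity (ρ₀ : Vec d → ℝ) (ρ₁ : Measure (Vec d)) (t : ℝ) (x : Vec d) : Vec d :=
  (∫ x₁, φ.condDensity ρ₀ t x₁ x ∂ρ₁)⁻¹ •
    ∫ x₁, φ.condDensity ρ₀ t x₁ x • φ.velocity t x₁ x ∂ρ₁

/-- The self-normalized importance-sampling estimate `v^d(x,t)` of the exact vector field from the
points `y k`, with `ρ₁` as the proposal. -/
def snisVelocity {ι : Type} [Fintype ι] (ρ₀ : Vec d → ℝ) (t : ℝ) (x : Vec d) (y : ι → Vec d) :
    Vec d :=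
  (∑ k, φ.condDensity ρ₀ t (y k) x)⁻¹ • ∑ k, φ.condDensity ρ₀ t (y k) x • φ.velocity t (y k) x

/-- When the Jacobian does not depend on `x₁`, it cancels from the importance weights. -/
theorem snisVelocity_eq_of_jacobian_const {ι : Type} [Fintype ι] (ρ₀ : Vec d → ℝ) (t : ℝ)
    (x : Vec d) (y : ι → Vec d) (c : ℝ) (hc : c ≠ 0)
    (h : ∀ x₁, |(fderiv ℝ (φ.inv t x₁) x).det| = c) :
    φ.snisVelocity ρ₀ t x y =
      (∑ k, ρ₀ (φ.inv t (y k) x))⁻¹ • ∑ k, ρ₀ (φ.inv t (y k) x) • φ.velocity t (y k) x := by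
  have h1 : ∀ a b : ℝ, ∀ z : Vec d, (a * b) • z = b • (a • z) := fun a b z => by
    rw [mul_comm, mul_smul]
  simp only [snisVelocity, condDensity, h, h1]
  rw [← Finset.sum_mul, ← Finset.smul_sum, smul_smul, mul_inv, mul_assoc, inv_mul_cancel₀ hc,
    mul_one]

end ConditionalFlow

/-- The law of the noise, with density `ρ₀` with respect to Lebesgue measure. -/
def noiseLaw {d : ℕ} (ρ₀ : Vec d → ℝ) : Measure (Vec d) :=
  volume.withDensity fun x => ENNReal.ofReal (ρ₀ x)

/-- The uniform law on `[0,1]`. -/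
def timeLaw : Measure ℝ := volume.restrict (Set.Icc 0 1)

/-- `m` times `t^j` and `n` pairs `(x₀^i, x₁^i)`. -/
abbrev Batch (d m n : ℕ) := (Fin m → ℝ) × (Fin n → Vec d × Vec d)

/-- A batch together with `K` further points sampled from `ρ₁`; so `N = n + K`. -/
abbrev ExtBatch (d m n K : ℕ) := Batch d m n × (Fin K → Vec d)

/-- All times are uniform on `[0,1]`, `x₀^i ∼ ρ₀`, `x₁^i ∼ ρ₁`, and everything is independent. -/
def batchLaw {d : ℕ} (ρ₀ : Vec d → ℝ) (ρ₁ : Measure (Vec d)) (m n : ℕ) :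
    Measure (Batch d m n) :=
  (Measure.pi fun _ : Fin m => timeLaw).prod
    (Measure.pi fun _ : Fin n => (noiseLaw ρ₀).prod ρ₁)

/-- The batch and, independently of it, `K` independent points with law `ρ₁`. -/
def extBatchLaw {d : ℕ} (ρ₀ : Vec d → ℝ) (ρ₁ : Measure (Vec d)) (m n K : ℕ) :
    Measure (ExtBatch d m n K) :=
  (batchLaw ρ₀ ρ₁ m n).prod (Measure.pi fun _ : Fin K => ρ₁)

section Estimators

variable {d p m n K : ℕ} (φ : ConditionalFlow d) (ρ₀ : Vec d → ℝ) (ρ₁ : Measure (Vec d))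
  (model : Vec p → Vec d → ℝ → Vec d) (θ : Vec p)

/-- The point `x^{j,i} = φ_{t^j,x₁^i}(x₀^i)`. -/
def batchPoint (b : Batch d m n) (j : Fin m) (i : Fin n) : Vec d :=
  φ.map (b.1 j) (b.2 i).2 (b.2 i).1

/-- The target `φ'_{t^j,x₁^i}(x₀^i)` of the CFM loss. -/
def cfmTarget (b : Batch d m n) (j : Fin m) (i : Fin n) : Vec d :=
  φ.timeDeriv (b.1 j) (b.2 i).2 (b.2 i).1

/-- The `N = n + K` points of the average: the `x₁^i` of the batch and the `K` further points. -/
def averagingPoints (ω : ExtBatch d m n K) : Fin n ⊕ Fin K → Vec d :=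
  Sum.elim (fun i => (ω.1.2 i).2) ω.2

/-- The target `v^d(x^{j,i},t^j)` of the ExFM loss. -/
def exfmTarget (ω : ExtBatch d m n K) (j : Fin m) (i : Fin n) : Vec d :=
  φ.snisVelocity ρ₀ (ω.1.1 j) (batchPoint φ ω.1 j i) (averagingPoints ω)

/-- The exact target `v(x^{j,i},t^j)`, where the integral over `x₁` is not approximated. -/
def exactTarget (b : Batch d m n) (j : Fin m) (i : Fin n) : Vec d :=
  φ.exactVelocity ρ₀ ρ₁ (b.1 j) (batchPoint φ b j i)

/-- The discrete loss `∑ⱼ ∑ᵢ ‖v_θ(x^{j,i},t^j) - target j i‖²`. -/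
def discreteLoss (b : Batch d m n) (target : Fin m → Fin n → Vec d) : ℝ :=
  ∑ j, ∑ i, ‖model θ (batchPoint φ b j i) (b.1 j) - target j i‖ ^ 2

/-- The gradient in `θ` of the discrete loss for given targets. -/
def lossGrad (b : Batch d m n) (target : Fin m → Fin n → Vec d) : Vec p :=
  gradient (fun θ' => discreteLoss φ model θ' b target) θ

/-- The gradient in `θ` of a single summand `‖v_θ(x,t) - z‖²`. -/
def summandGrad (x : Vec d) (t : ℝ) (z : Vec d) : Vec p :=
  gradient (fun θ' => ‖model θ' x t - z‖ ^ 2) θ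

/-- The gradient of the discrete CFM loss. -/
def cfmGrad (b : Batch d m n) : Vec p :=
  lossGrad φ model θ b (cfmTarget φ b)

/-- The gradient of the discrete ExFM loss. -/
def exfmGrad (ω : ExtBatch d m n K) : Vec p :=
  lossGrad φ model θ ω.1 (exfmTarget φ ρ₀ ω)

/-- The gradient at the same model arguments with the exact integral over `x₁`. -/
def exactGrad (b : Batch d m n) : Vec p :=
  lossGrad φ model θ b (exactTarget φ ρ₀ ρ₁ b)

/-- The error of the CFM gradient at the given model arguments. -/
def cfmError (b : Batch d m n) : Vec p :=
  cfmGrad φ model θ b - exactGrad φ ρ₀ ρ₁ model θ b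

/-- The error of the ExFM gradient at the given model arguments. -/
def exfmError (ω : ExtBatch d m n K) : Vec p :=
  exfmGrad φ ρ₀ model θ ω - exactGrad φ ρ₀ ρ₁ model θ ω.1

/-- The gradient of the `(j,i)` summand of the CFM loss. -/
def cfmSummand (j : Fin m) (i : Fin n) (ω : ExtBatch d m n K) : Vec p :=
  summandGrad model θ (batchPoint φ ω.1 j i) (ω.1.1 j) (cfmTarget φ ω.1 j i)

/-- The gradient of the `(j,i)` summand of the ExFM loss. -/
def exfmSummand (j : Fin m) (i : Fin n) (ω : ExtBatch d m n K) : Vec p :=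
  summandGrad model θ (batchPoint φ ω.1 j i) (ω.1.1 j) (exfmTarget φ ρ₀ ω j i)

/-- The gradient of the `(j,i)` summand with the exact integral over `x₁`. -/
def exactSummand (j : Fin m) (i : Fin n) (ω : ExtBatch d m n K) : Vec p :=
  summandGrad model θ (batchPoint φ ω.1 j i) (ω.1.1 j) (exactTarget φ ρ₀ ρ₁ ω.1 j i)

/-- The σ-algebra generated by the model arguments `(x^{j,i}, t^j)`. -/
@[reducible] def argSigma (j : Fin m) (i : Fin n) : MeasurableSpace (ExtBatch d m n K) :=
  MeasurableSpace.comap (fun ω => (batchPoint φ ω.1 j i, ω.1.1 j)) inferInstance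

end Estimators

/-- The total dispersion `E ‖X - E X‖²` of a random vector: the sum of the variances of its
components. -/
def totalVariance {Ω : Type} [MeasurableSpace Ω] {p : ℕ} (X : Ω → Vec p) (μ : Measure Ω) : ℝ :=
  ∫ ω, ‖X ω - ∫ ω', X ω' ∂μ‖ ^ 2 ∂μ

end

open Filter Topology Function

/-! Fix a summand and let `z = (x, t)` be its model arguments. Its gradient is a linear map
depending on `z`, applied to the residual `v_θ(x,t) - target`, hence affine in the target. Let `h z
y` be the gradient for the target `w(t,y,x)` and `r z y = ρ_y(x,t)`. Then almost surely the CFM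
summand is `h z (y i)`, the exact one is the mean of `h z` for the normalized density `r z` with
respect to `ρ₁` (`weightedMean`), and the ExFM one is the mean of `h z` over the sample with weights
`r z (y k)` (`selfNormMean`).

A change of variables (`ConditionalFlow.hasJointDensity`) shows that `z` and all averaging points
have the joint density `r z (y i)` with respect to a product measure in which the points are i.i.d.
with law `ρ₁`. Bayes' formula (`HasJointDensity.condExp_eq`) gives the conditional mean of the CFM
summand. The product measure is invariant under permutations of the points, so, given `z` and the
unordered sample, the marked point is the `k`-th one with probability proportional to `r z (y k)`.
Thus the ExFM summand is the Rao-Blackwellization of the CFM summand: the conditional mean is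
unchanged, and the conditional variance drops by the conditional second moment of their difference
(`condExp_selfNormMean`, `condVar_sub_condVar_selfNormMean`). Where this drop vanishes, `h z` agrees
at two independent points of positive density, hence is constant there, and the CFM variance
vanishes too.

The summands of a batch are dependent, so these comparisons do not add up to one for the whole
gradient. Instead the whole ExFM error tends to zero in mean square as the number of further points
grows (`tendsto_eLpNorm_selfNormMean`): the strong law and dominated convergence settle bounded `h`,
and truncation settles the rest because both means contract the `L²` norm uniformly in the sample
size. The CFM error does not depend on `N`, so a positive variance is eventually undercut.

For one time, the exact gradient and the CFM error are uncorrelated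
(`covariance_exactGrad_cfmError`), because distinct pairs `(x₀,x₁)` are independent given the time.
So the CFM variance is the exact variance plus the error variance, while the ExFM variance is at
most `1 + s` times the exact variance plus a term that vanishes in the limit, for any `s > 0`. -/

/-! ### Conditional means from a joint density -/

/-- The pair `(A, Y)` has the joint density `r` with respect to `lam ⊗ ν`. -/
structure HasJointDensity {Ω Z 𝒴 : Type*} [MeasurableSpace Ω] [MeasurableSpace Z]
    [MeasurableSpace 𝒴] (A : Ω → Z) (Y : Ω → 𝒴) (r : Z → 𝒴 → ℝ) (μ : Measure Ω)
    (lam : Measure Z) (ν : Measure 𝒴) : Prop where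
  measurable_left : Measurable A
  measurable_right : Measurable Y
  measurable_density : Measurable (uncurry r)
  nonneg : ∀ z y, 0 ≤ r z y
  map_eq : μ.map (fun ω => (A ω, Y ω)) =
    (lam.prod ν).withDensity fun q => ENNReal.ofReal (r q.1 q.2)

/-- The mean of `h z` with respect to the normalized density `r z`. -/
noncomputable def weightedMean {Z 𝒴 E : Type*} [MeasurableSpace 𝒴] [NormedAddCommGroup E]
    [NormedSpace ℝ E] (r : Z → 𝒴 → ℝ) (ν : Measure 𝒴) (h : Z → 𝒴 → E) (z : Z) : E :=
  (∫ y, r z y ∂ν)⁻¹ • ∫ y, r z y • h z y ∂ν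

namespace HasJointDensity

variable {Ω Z 𝒴 E : Type*} [MeasurableSpace Ω] [MeasurableSpace Z] [MeasurableSpace 𝒴]
  [NormedAddCommGroup E] [NormedSpace ℝ E]
  {A : Ω → Z} {Y : Ω → 𝒴} {r : Z → 𝒴 → ℝ} {μ : Measure Ω} {lam : Measure Z} {ν : Measure 𝒴}

lemma measurable_pair (H : HasJointDensity A Y r μ lam ν) :
    Measurable fun ω => (A ω, Y ω) := H.measurable_left.prodMk H.measurable_right

lemma measurable_ofReal (H : HasJointDensity A Y r μ lam ν) :
    Measurable fun q : Z × 𝒴 => ENNReal.ofReal (r q.1 q.2) := H.measurable_density.ennreal_ofReal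

lemma lintegral_eq_prod (H : HasJointDensity A Y r μ lam ν) {F : Z × 𝒴 → ℝ≥0∞}
    (hF : Measurable F) :
    ∫⁻ ω, F (A ω, Y ω) ∂μ = ∫⁻ q, ENNReal.ofReal (r q.1 q.2) * F q ∂(lam.prod ν) := by
  rw [← lintegral_map hF H.measurable_pair, H.map_eq,
    lintegral_withDensity_eq_lintegral_mul _ H.measurable_ofReal hF]
  rfl

lemma integrable_iff (H : HasJointDensity A Y r μ lam ν) {F : Z × 𝒴 → E}
    (hF : StronglyMeasurable F) :
    Integrable (fun ω => F (A ω, Y ω)) μ ↔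
      Integrable (fun q => r q.1 q.2 • F q) (lam.prod ν) := by
  rw [← Function.comp_def F, ← integrable_map_measure hF.aestronglyMeasurable
    H.measurable_pair.aemeasurable, H.map_eq, integrable_withDensity_iff_integrable_smul'
    H.measurable_ofReal (ae_of_all _ fun _ => ENNReal.ofReal_lt_top)]
  simp [ENNReal.toReal_ofReal, H.nonneg]

lemma integral_eq_prod (H : HasJointDensity A Y r μ lam ν) {F : Z × 𝒴 → E}
    (hF : StronglyMeasurable F) :
    ∫ ω, F (A ω, Y ω) ∂μ = ∫ q, r q.1 q.2 • F q ∂(lam.prod ν) := by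
  rw [← integral_map H.measurable_pair.aemeasurable hF.aestronglyMeasurable, H.map_eq,
    integral_withDensity_eq_integral_toReal_smul
    H.measurable_ofReal (ae_of_all _ fun _ => ENNReal.ofReal_lt_top)]
  simp [ENNReal.toReal_ofReal, H.nonneg]

lemma ae_iff (H : HasJointDensity A Y r μ lam ν) {p : Z × 𝒴 → Prop}
    (hp : MeasurableSet {q | p q}) :
    (∀ᵐ ω ∂μ, p (A ω, Y ω)) ↔ ∀ᵐ q ∂(lam.prod ν), 0 < r q.1 q.2 → p q := by
  rw [← ae_map_iff H.measurable_pair.aemeasurable hp, H.map_eq,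
    ae_withDensity_iff H.measurable_ofReal]
  simp

lemma ae_density_pos (H : HasJointDensity A Y r μ lam ν) :
    ∀ᵐ ω ∂μ, 0 < r (A ω) (Y ω) :=
  (H.ae_iff (p := fun q => 0 < r q.1 q.2)
    (measurableSet_lt measurable_const H.measurable_density)).2 (ae_of_all _ fun _ h => h)

lemma ae_of_ae (H : HasJointDensity A Y r μ lam ν) {p : Z → Prop} (hp : ∀ᵐ z ∂lam, p z) :
    ∀ᵐ ω ∂μ, p (A ω) := by
  have h1 : ∀ᵐ q ∂(lam.prod ν), p q.1 :=
    Measure.quasiMeasurePreserving_fst.ae hp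
  have h2 : ∀ᵐ q ∂(μ.map fun ω => (A ω, Y ω)), p q.1 := by
    rw [H.map_eq]
    exact (withDensity_absolutelyContinuous _ _).ae_le h1
  exact ae_of_ae_map H.measurable_pair.aemeasurable h2

/-- If the total mass is zero, the nonnegative integrable density vanishes almost everywhere and
both sides are zero, so the convention `0⁻¹ = 0` does no harm. -/
lemma integral_smul_weightedMean (H : HasJointDensity A Y r μ lam ν) {h : Z → 𝒴 → E} {z : Z}
    (hz : Integrable (r z) ν) :
    (∫ y, r z y ∂ν) • weightedMean r ν h z = ∫ y, r z y • h z y ∂ν := by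
  by_cases h0 : ∫ y, r z y ∂ν = 0
  · have h1 := (integral_eq_zero_iff_of_nonneg (H.nonneg z) hz).1 h0
    rw [h0, zero_smul, eq_comm]
    refine integral_eq_zero_of_ae ?_
    filter_upwards [h1] with y hy
    simp_all
  · rw [weightedMean, smul_inv_smul₀ h0]

variable [SFinite ν]

lemma ae_integrable (H : HasJointDensity A Y r μ lam ν) [SFinite lam] {h : Z → 𝒴 → E}
    (hh : StronglyMeasurable (uncurry h)) (hi : Integrable (fun ω => h (A ω) (Y ω)) μ) :
    ∀ᵐ z ∂lam, Integrable (fun y => r z y • h z y) ν :=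
  ((H.integrable_iff hh).1 hi).prod_right_ae

lemma ae_integrable_density (H : HasJointDensity A Y r μ lam ν) [SFinite lam]
    [IsFiniteMeasure μ] : ∀ᵐ z ∂lam, Integrable (r z) ν := by
  simpa using H.ae_integrable (h := fun _ _ => (1 : ℝ)) stronglyMeasurable_const
    (integrable_const 1)

lemma measurable_integral (H : HasJointDensity A Y r μ lam ν) :
    Measurable fun z => ∫ y, r z y ∂ν :=
  (H.measurable_density.stronglyMeasurable.integral_prod_right).measurable

/-- Where the mass of `r z` is zero, `r z` itself vanishes almost everywhere, so such `z` are not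
charged by the law of `A`. -/
lemma ae_integral_density_pos (H : HasJointDensity A Y r μ lam ν) [SFinite lam]
    [IsFiniteMeasure μ] : ∀ᵐ ω ∂μ, 0 < ∫ y, r (A ω) y ∂ν := by
  have hm : MeasurableSet {q : Z × 𝒴 | 0 < ∫ y, r q.1 y ∂ν} :=
    measurableSet_lt measurable_const (H.measurable_integral.comp measurable_fst)
  refine (H.ae_iff (p := fun q => 0 < ∫ y, r q.1 y ∂ν) hm).2 ?_
  have h3 : MeasurableSet {q : Z × 𝒴 | 0 < r q.1 q.2 → 0 < ∫ y, r q.1 y ∂ν} := by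
    have : {q : Z × 𝒴 | 0 < r q.1 q.2 → 0 < ∫ y, r q.1 y ∂ν}
      = {q : Z × 𝒴 | 0 < r q.1 q.2}ᶜ ∪ {q : Z × 𝒴 | 0 < ∫ y, r q.1 y ∂ν} := by
      ext q; simp [imp_iff_not_or]
    rw [this]
    exact (measurableSet_lt measurable_const H.measurable_density).compl.union hm
  rw [Measure.ae_prod_iff_ae_ae h3]
  filter_upwards [H.ae_integrable_density] with z hz
  by_cases hp : 0 < ∫ y, r z y ∂ν
  · exact ae_of_all _ fun _ _ => hp
  · have h0 : ∫ y, r z y ∂ν = 0 := le_antisymm (not_lt.1 hp) (integral_nonneg (H.nonneg z))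
    filter_upwards [(integral_eq_zero_iff_of_nonneg (H.nonneg z) hz).1 h0] with y hy hy'
    simp_all

lemma stronglyMeasurable_weightedMean (H : HasJointDensity A Y r μ lam ν) {h : Z → 𝒴 → E}
    (hh : StronglyMeasurable (uncurry h)) : StronglyMeasurable (weightedMean r ν h) :=
  (H.measurable_integral.inv.stronglyMeasurable).smul
    ((H.measurable_density.stronglyMeasurable.smul hh).integral_prod_right)

variable [SFinite lam] [IsFiniteMeasure μ]

/-- Fibrewise, the mass of `r z` times the norm of the mean is at most `∫ ‖r z y • h z y‖`; the
latter is integrable in `z` by Fubini. -/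
lemma integrable_weightedMean (H : HasJointDensity A Y r μ lam ν) {h : Z → 𝒴 → E}
    (hh : StronglyMeasurable (uncurry h)) (hi : Integrable (fun ω => h (A ω) (Y ω)) μ) :
    Integrable (fun ω => weightedMean r ν h (A ω)) μ := by
  have hq := H.stronglyMeasurable_weightedMean hh
  have hr := H.measurable_density.stronglyMeasurable
  refine (H.integrable_iff (F := fun q => weightedMean r ν h q.1)
    (hq.comp_measurable measurable_fst)).2 ?_
  have hrh := (H.integrable_iff hh).1 hi
  have hm : StronglyMeasurable fun q : Z × 𝒴 => r q.1 q.2 • weightedMean r ν h q.1 :=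
    hr.smul (hq.comp_measurable measurable_fst)
  rw [integrable_prod_iff hm.aestronglyMeasurable]
  constructor
  · filter_upwards [H.ae_integrable_density] with z hz using hz.smul_const _
  · refine Integrable.mono hrh.norm.integral_prod_left
      hm.norm.integral_prod_right.aestronglyMeasurable ?_
    filter_upwards [H.ae_integrable_density] with z hz
    simp only [norm_smul, Real.norm_eq_abs, abs_of_nonneg (H.nonneg _ _)]
    rw [integral_mul_const, abs_of_nonneg (mul_nonneg (integral_nonneg (H.nonneg z))
      (norm_nonneg _)), abs_of_nonneg (integral_nonneg fun y => mul_nonneg (H.nonneg z y)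
      (norm_nonneg _))]
    calc _ = ‖(∫ y, r z y ∂ν) • weightedMean r ν h z‖ := by
          rw [norm_smul, Real.norm_of_nonneg (integral_nonneg (H.nonneg z))]
      _ = ‖∫ y, r z y • h z y ∂ν‖ := by rw [H.integral_smul_weightedMean hz]
      _ ≤ ∫ y, ‖r z y • h z y‖ ∂ν := norm_integral_le_integral_norm _
      _ = _ := by simp only [norm_smul, Real.norm_eq_abs, abs_of_nonneg (H.nonneg _ _),
        Function.uncurry_apply_pair]

variable [CompleteSpace E]

lemma setIntegral_weightedMean (H : HasJointDensity A Y r μ lam ν) {h : Z → 𝒴 → E}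
    (hh : StronglyMeasurable (uncurry h)) (hi : Integrable (fun ω => h (A ω) (Y ω)) μ)
    {s : Set Z} (hs : MeasurableSet s) :
    ∫ ω in A ⁻¹' s, weightedMean r ν h (A ω) ∂μ = ∫ ω in A ⁻¹' s, h (A ω) (Y ω) ∂μ := by
  have hq := H.stronglyMeasurable_weightedMean hh
  have hs' : MeasurableSet (Prod.fst ⁻¹' s : Set (Z × 𝒴)) := measurable_fst hs
  have m1 : StronglyMeasurable ((Prod.fst ⁻¹' s : Set (Z × 𝒴)).indicator
    fun q => weightedMean r ν h q.1) := (hq.comp_measurable measurable_fst).indicator hs'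
  have m2 : StronglyMeasurable ((Prod.fst ⁻¹' s : Set (Z × 𝒴)).indicator (uncurry h)) :=
    hh.indicator hs'
  have i1 := (H.integrable_weightedMean hh hi).indicator (H.measurable_left hs)
  have i2 := hi.indicator (H.measurable_left hs)
  have e1 := H.integral_eq_prod m1
  have e2 := H.integral_eq_prod m2
  have j1 := (H.integrable_iff m1).1 i1
  have j2 := (H.integrable_iff m2).1 i2
  rw [← integral_indicator (H.measurable_left hs), ← integral_indicator (H.measurable_left hs)]
  refine e1.trans (Eq.trans ?_ e2.symm)
  rw [integral_prod _ j1, integral_prod _ j2]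
  refine integral_congr_ae ?_
  filter_upwards [H.ae_integrable_density] with z hz
  by_cases hzs : z ∈ s
  · simp only [Set.indicator, Set.mem_preimage, hzs, if_true, uncurry]
    rw [integral_smul_const, H.integral_smul_weightedMean hz]
  · simp [Set.indicator, hzs]

/-- Bayes' formula: on each fibre the density may be integrated first, and the weighted mean has the
same integral over the fibre as `h`. -/
theorem condExp_eq (H : HasJointDensity A Y r μ lam ν) {h : Z → 𝒴 → E}
    (hh : StronglyMeasurable (uncurry h)) (hi : Integrable (fun ω => h (A ω) (Y ω)) μ) :
    μ[fun ω => h (A ω) (Y ω) | MeasurableSpace.comap A inferInstance]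
      =ᵐ[μ] fun ω => weightedMean r ν h (A ω) := by
  symm
  refine ae_eq_condExp_of_forall_setIntegral_eq H.measurable_left.comap_le hi
    (fun _ _ _ => (H.integrable_weightedMean hh hi).integrableOn) ?_ ?_
  · rintro _ ⟨s, hs, rfl⟩ _
    exact H.setIntegral_weightedMean hh hi hs
  · exact ((H.stronglyMeasurable_weightedMean hh).comp_measurable
      (comap_measurable A)).aestronglyMeasurable

theorem memLp_weightedMean (H : HasJointDensity A Y r μ lam ν) {h : Z → 𝒴 → E}
    (hh : StronglyMeasurable (uncurry h)) {p : ℝ≥0∞} (hp : 1 ≤ p)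
    (hi : MemLp (fun ω => h (A ω) (Y ω)) p μ) :
    MemLp (fun ω => weightedMean r ν h (A ω)) p μ :=
  (hi.condExp hp).ae_eq (H.condExp_eq hh (hi.integrable hp))

theorem eLpNorm_weightedMean_le (H : HasJointDensity A Y r μ lam ν) {h : Z → 𝒴 → E}
    (hh : StronglyMeasurable (uncurry h)) {p : ℝ≥0∞} (hp : 1 ≤ p)
    (hi : MemLp (fun ω => h (A ω) (Y ω)) p μ) :
    eLpNorm (fun ω => weightedMean r ν h (A ω)) p μ ≤ eLpNorm (fun ω => h (A ω) (Y ω)) p μ := by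
  rw [← eLpNorm_congr_ae (H.condExp_eq hh (hi.integrable hp))]
  exact eLpNorm_condExp_le_eLpNorm _ hp

/-- The deviation from the conditional mean is orthogonal to every function of `A`. -/
theorem integral_comp_mul_sub_weightedMean (H : HasJointDensity A Y r μ lam ν) {h : Z → 𝒴 → ℝ}
    (hh : StronglyMeasurable (uncurry h)) (hi : Integrable (fun ω => h (A ω) (Y ω)) μ)
    {f : Z → ℝ} (hf : Measurable f)
    (hfi : Integrable (fun ω => f (A ω) * (h (A ω) (Y ω) - weightedMean r ν h (A ω))) μ) :
    ∫ ω, f (A ω) * (h (A ω) (Y ω) - weightedMean r ν h (A ω)) ∂μ = 0 := by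
  have hw := H.integrable_weightedMean hh hi
  have hm := H.measurable_left.comap_le
  have hf' : StronglyMeasurable[MeasurableSpace.comap A inferInstance] fun ω => f (A ω) :=
    (hf.comp (comap_measurable A)).stronglyMeasurable
  have hwm : StronglyMeasurable[MeasurableSpace.comap A inferInstance]
      fun ω => weightedMean r ν h (A ω) :=
    (H.stronglyMeasurable_weightedMean hh).comp_measurable (comap_measurable A)
  rw [← integral_condExp hm]
  refine integral_eq_zero_of_ae ?_
  -- The factor `f (A ω)` comes out of the conditional expectation, and what remains has conditional
  -- mean zero.
  have e1 := condExp_mul_of_stronglyMeasurable_left hf' hfi (hi.sub hw)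
  have e2 := condExp_sub hi hw (MeasurableSpace.comap A inferInstance)
  filter_upwards [e1, e2, H.condExp_eq hh hi] with ω h1 h2 h3
  refine h1.trans ?_
  have h4 : (μ[fun ω => weightedMean r ν h (A ω) | MeasurableSpace.comap A inferInstance]) ω
    = weightedMean r ν h (A ω) := by rw [condExp_of_stronglyMeasurable hm hwm hw]
  have h5 : (μ[(fun ω => h (A ω) (Y ω)) - (fun ω => weightedMean r ν h (A ω)) |
      MeasurableSpace.comap A inferInstance]) ω = 0 := by
    rw [h2, Pi.sub_apply, h3, h4, sub_self]
  exact mul_eq_zero_of_right _ h5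

end HasJointDensity

/-! ### Self-normalized means -/

/-- The mean of `h z` at the points `y k` with the normalized weights `r z (y k)`. -/
noncomputable def selfNormMean {Z 𝒴 E ι : Type*} [Fintype ι] [NormedAddCommGroup E]
    [NormedSpace ℝ E] (r : Z → 𝒴 → ℝ) (h : Z → 𝒴 → E) (z : Z) (y : ι → 𝒴) : E :=
  (∑ k, r z (y k))⁻¹ • ∑ k, r z (y k) • h z (y k)

section SelfNormMean

variable {Z 𝒴 E ι : Type*} [Fintype ι] [NormedAddCommGroup E] [NormedSpace ℝ E]
  {r : Z → 𝒴 → ℝ} {h : Z → 𝒴 → E}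

lemma selfNormMean_comp_perm (σ : Equiv.Perm ι) (z : Z) (y : ι → 𝒴) :
    selfNormMean r h z (y ∘ σ) = selfNormMean r h z y := by
  simp only [selfNormMean, comp_apply]
  rw [Equiv.sum_comp σ fun k => r z (y k), Equiv.sum_comp σ fun k => r z (y k) • h z (y k)]

lemma sum_smul_selfNormMean (h0 : ∀ z y, 0 ≤ r z y) (z : Z) (y : ι → 𝒴) :
    (∑ k, r z (y k)) • selfNormMean r h z y = ∑ k, r z (y k) • h z (y k) := by
  by_cases hs : ∑ k, r z (y k) = 0
  · have h1 := (Finset.sum_eq_zero_iff_of_nonneg fun k _ => h0 z (y k)).1 hs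
    rw [hs, zero_smul, Finset.sum_eq_zero]
    intro k hk
    rw [h1 k hk, zero_smul]
  · rw [selfNormMean, smul_inv_smul₀ hs]

/-- Jensen's inequality for the normalized weights, multiplied by the total weight so that it also
covers total weight zero; it follows from the triangle inequality and Cauchy-Schwarz. -/
lemma sum_mul_norm_selfNormMean_sq_le (h0 : ∀ z y, 0 ≤ r z y) (z : Z) (y : ι → 𝒴) :
    (∑ k, r z (y k)) * ‖selfNormMean r h z y‖ ^ 2 ≤ ∑ k, r z (y k) * ‖h z (y k)‖ ^ 2 := by
  set W := ∑ k, r z (y k) with hW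
  have hW0 : 0 ≤ W := Finset.sum_nonneg fun k _ => h0 z (y k)
  rcases hW0.eq_or_lt with hW1 | hW1
  · rw [← hW1, zero_mul]
    exact Finset.sum_nonneg fun k _ => mul_nonneg (h0 _ _) (sq_nonneg _)
  have h1 : W * ‖selfNormMean r h z y‖ ≤ ∑ k, r z (y k) * ‖h z (y k)‖ := by
    calc W * ‖selfNormMean r h z y‖ = ‖W • selfNormMean r h z y‖ := by
          rw [norm_smul, Real.norm_of_nonneg hW0]
      _ = ‖∑ k, r z (y k) • h z (y k)‖ := by rw [sum_smul_selfNormMean h0]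
      _ ≤ ∑ k, ‖r z (y k) • h z (y k)‖ := norm_sum_le _ _
      _ = _ := by simp only [norm_smul, Real.norm_of_nonneg (h0 _ _)]
  have h2 : (∑ k, r z (y k) * ‖h z (y k)‖) ^ 2 ≤ W * ∑ k, r z (y k) * ‖h z (y k)‖ ^ 2 :=
    Finset.sum_sq_le_sum_mul_sum_of_sq_le_mul _ (fun k _ => h0 z (y k))
      (fun k _ => mul_nonneg (h0 _ _) (sq_nonneg _)) (fun k _ => le_of_eq (by ring))
  have h3 : (W * ‖selfNormMean r h z y‖) ^ 2 ≤ W * ∑ k, r z (y k) * ‖h z (y k)‖ ^ 2 :=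
    (pow_le_pow_left₀ (by positivity) h1 2).trans h2
  refine le_of_mul_le_mul_left ?_ hW1
  calc _ = (W * ‖selfNormMean r h z y‖) ^ 2 := by ring
    _ ≤ _ := h3

lemma stronglyMeasurable_selfNormMean [MeasurableSpace Z] [MeasurableSpace 𝒴]
    (hr : Measurable (uncurry r)) (hh : StronglyMeasurable (uncurry h)) :
    StronglyMeasurable fun q : Z × (ι → 𝒴) => selfNormMean r h q.1 q.2 := by
  have hk : ∀ k, Measurable fun q : Z × (ι → 𝒴) => (q.1, q.2 k) := fun k =>
    measurable_fst.prodMk ((measurable_pi_apply k).comp measurable_snd)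
  have hr' : ∀ k, StronglyMeasurable fun q : Z × (ι → 𝒴) => r q.1 (q.2 k) := fun k =>
    hr.stronglyMeasurable.comp_measurable (hk k)
  have hh' : ∀ k, StronglyMeasurable fun q : Z × (ι → 𝒴) => h q.1 (q.2 k) := fun k =>
    hh.comp_measurable (hk k)
  have h1 : StronglyMeasurable fun q : Z × (ι → 𝒴) => (∑ k, r q.1 (q.2 k))⁻¹ :=
    (Finset.stronglyMeasurable_fun_sum _ fun k _ => hr' k).measurable.inv.stronglyMeasurable
  exact h1.smul (Finset.stronglyMeasurable_fun_sum _ fun k _ => (hr' k).smul (hh' k))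

end SelfNormMean

lemma measurePreserving_comp_perm {𝒴 ι : Type*} [Fintype ι] [MeasurableSpace 𝒴]
    (ν : Measure 𝒴) [SigmaFinite ν] (σ : Equiv.Perm ι) :
    MeasurePreserving (fun y : ι → 𝒴 => y ∘ σ) (Measure.pi fun _ => ν)
      (Measure.pi fun _ => ν) := by
  have h := measurePreserving_piCongrLeft (fun _ : ι => ν) σ.symm
  convert h using 1
  ext y k
  have := Equiv.piCongrLeft_apply_apply (fun _ : ι => 𝒴) σ.symm y (σ k)
  rw [MeasurableEquiv.coe_piCongrLeft]
  simpa using this.symm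

lemma eLpNorm_two_le_of_lintegral_le {Ω E F : Type*} [MeasurableSpace Ω] {μ : Measure Ω}
    [NormedAddCommGroup E] [NormedAddCommGroup F] {f : Ω → E} {g : Ω → F}
    (h : ∫⁻ ω, ENNReal.ofReal (‖f ω‖ ^ 2) ∂μ ≤ ∫⁻ ω, ENNReal.ofReal (‖g ω‖ ^ 2) ∂μ) :
    eLpNorm f 2 μ ≤ eLpNorm g 2 μ := by
  rw [eLpNorm_eq_lintegral_rpow_enorm_toReal (by norm_num) (by norm_num),
    eLpNorm_eq_lintegral_rpow_enorm_toReal (by norm_num) (by norm_num)]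
  refine ENNReal.rpow_le_rpow ?_ (by norm_num)
  simpa [ENNReal.ofReal_pow] using h

lemma condExp_congr_of_setIntegral_eq {Ω E : Type*} {m m0 : MeasurableSpace Ω} {μ : Measure Ω}
    [IsFiniteMeasure μ] [NormedAddCommGroup E] [NormedSpace ℝ E] [CompleteSpace E]
    (hm : m ≤ m0) {f g : Ω → E} (hf : Integrable f μ) (hg : Integrable g μ)
    (h : ∀ s, MeasurableSet[m] s → ∫ ω in s, f ω ∂μ = ∫ ω in s, g ω ∂μ) :
    μ[f | m] =ᵐ[μ] μ[g | m] := by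
  refine ae_eq_condExp_of_forall_setIntegral_eq hm hg
    (fun _ _ _ => integrable_condExp.integrableOn) (fun s hs _ => ?_)
    stronglyMeasurable_condExp.aestronglyMeasurable
  rw [setIntegral_condExp hm hf hs, h s hs]

/-! ### Exchangeability of the sample around its marked point -/

namespace HasJointDensity

variable {Ω Z 𝒴 E ι : Type*} [Fintype ι] [MeasurableSpace Ω] [MeasurableSpace Z]
  [MeasurableSpace 𝒴] [NormedAddCommGroup E] [NormedSpace ℝ E]
  {A : Ω → Z} {Y : Ω → ι → 𝒴} {r : Z → 𝒴 → ℝ} {μ : Measure Ω} {lam : Measure Z}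
  {ν : Measure 𝒴} [IsProbabilityMeasure ν] [SFinite lam] {i : ι}

/-- The unmarked coordinates do not enter the density and carry total mass one, so they integrate
out. -/
lemma eval (H : HasJointDensity A Y (fun z y => r z (y i)) μ lam (Measure.pi fun _ => ν))
    (hr : Measurable (uncurry r)) (h0 : ∀ z y, 0 ≤ r z y) :
    HasJointDensity A (fun ω => Y ω i) r μ lam ν where
  measurable_left := H.measurable_left
  measurable_right := (measurable_pi_apply i).comp H.measurable_right
  measurable_density := hr
  nonneg := h0
  map_eq := by
    have hm : Measurable fun ω => (A ω, Y ω i) :=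
      H.measurable_left.prodMk ((measurable_pi_apply i).comp H.measurable_right)
    have hr' : Measurable fun q : Z × 𝒴 => ENNReal.ofReal (r q.1 q.2) := hr.ennreal_ofReal
    refine Measure.ext_of_lintegral _ fun F hF => ?_
    have hp : MeasurePreserving (Prod.map (id : Z → Z) (Function.eval i : (ι → 𝒴) → 𝒴))
        (lam.prod (Measure.pi fun _ => ν)) (lam.prod ν) :=
      (MeasurePreserving.id lam).prod (measurePreserving_eval (fun _ : ι => ν) i)
    rw [lintegral_map hF hm, lintegral_withDensity_eq_lintegral_mul _ hr' hF,
      ← hp.lintegral_comp (hr'.mul hF)]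
    exact H.lintegral_eq_prod (F := fun q => F (q.1, q.2 i)) (hF.comp hp.measurable)

omit [IsProbabilityMeasure ν] [SFinite lam] in
lemma measurePreserving_swap [SigmaFinite ν] [SFinite lam] (σ : Equiv.Perm ι) :
    MeasurePreserving (Prod.map (id : Z → Z) (fun y : ι → 𝒴 => y ∘ σ))
      (lam.prod (Measure.pi fun _ => ν)) (lam.prod (Measure.pi fun _ => ν)) :=
  (MeasurePreserving.id lam).prod (measurePreserving_comp_perm ν σ)

omit [Fintype ι] in
lemma measurable_mark (k : ι) : Measurable fun q : Z × (ι → 𝒴) => (q.1, q.2, q.2 k) := by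
  fun_prop

variable [DecidableEq ι]

/-- Swapping the coordinates `i` and `k` preserves the product measure and fixes `F` in its sample
argument. So all terms of the sum have the same integral, which for `k = i` is the expectation on
the left. -/
lemma card_mul_lintegral
    (H : HasJointDensity A Y (fun z y => r z (y i)) μ lam (Measure.pi fun _ => ν))
    (hr : Measurable (uncurry r)) {F : Z → (ι → 𝒴) → 𝒴 → ℝ≥0∞}
    (hF : Measurable fun q : Z × (ι → 𝒴) × 𝒴 => F q.1 q.2.1 q.2.2)
    (hs : ∀ (σ : Equiv.Perm ι) z y a, F z (y ∘ σ) a = F z y a) :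
    Fintype.card ι * ∫⁻ ω, F (A ω) (Y ω) (Y ω i) ∂μ =
      ∫⁻ q, ∑ k, ENNReal.ofReal (r q.1 (q.2 k)) * F q.1 q.2 (q.2 k)
        ∂(lam.prod (Measure.pi fun _ => ν)) := by
  have hm : ∀ k, Measurable fun q : Z × (ι → 𝒴) =>
      ENNReal.ofReal (r q.1 (q.2 k)) * F q.1 q.2 (q.2 k) := fun k =>
    (hr.comp (g := uncurry r) (f := fun q : Z × (ι → 𝒴) => (q.1, q.2 k))
      (by fun_prop)).ennreal_ofReal.mul (hF.comp (measurable_mark k))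
  rw [lintegral_finsetSum _ fun k _ => hm k]
  have h1 : ∀ k, ∫⁻ q, ENNReal.ofReal (r q.1 (q.2 k)) * F q.1 q.2 (q.2 k)
        ∂(lam.prod (Measure.pi fun _ => ν)) = ∫⁻ ω, F (A ω) (Y ω) (Y ω i) ∂μ := by
    intro k
    refine Eq.trans ?_ (H.lintegral_eq_prod (F := fun q => F q.1 q.2 (q.2 i))
      (hF.comp (measurable_mark i))).symm
    rw [← (measurePreserving_swap (lam := lam) (ν := ν)
      (Equiv.swap i k)).lintegral_comp (hm i)]
    simp [hs]
  simp [h1]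

lemma integrable_mark
    (H : HasJointDensity A Y (fun z y => r z (y i)) μ lam (Measure.pi fun _ => ν))
    {F : Z → (ι → 𝒴) → 𝒴 → E}
    (hF : StronglyMeasurable fun q : Z × (ι → 𝒴) × 𝒴 => F q.1 q.2.1 q.2.2)
    (hs : ∀ (σ : Equiv.Perm ι) z y a, F z (y ∘ σ) a = F z y a)
    (hi : Integrable (fun ω => F (A ω) (Y ω) (Y ω i)) μ) (k : ι) :
    Integrable (fun q : Z × (ι → 𝒴) => r q.1 (q.2 k) • F q.1 q.2 (q.2 k))
      (lam.prod (Measure.pi fun _ => ν)) := by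
  have h1 := (H.integrable_iff (F := fun q => F q.1 q.2 (q.2 i))
    (hF.comp_measurable (measurable_mark _))).1 hi
  have h2 := (measurePreserving_swap (lam := lam) (ν := ν)
      (Equiv.swap i k)).integrable_comp_of_integrable h1
  refine h2.congr (ae_of_all _ fun q => ?_)
  rw [comp_apply]
  simp [hs]

lemma card_smul_integral
    (H : HasJointDensity A Y (fun z y => r z (y i)) μ lam (Measure.pi fun _ => ν))
    (hr : Measurable (uncurry r)) {F : Z → (ι → 𝒴) → 𝒴 → E}
    (hF : StronglyMeasurable fun q : Z × (ι → 𝒴) × 𝒴 => F q.1 q.2.1 q.2.2)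
    (hs : ∀ (σ : Equiv.Perm ι) z y a, F z (y ∘ σ) a = F z y a)
    (hi : Integrable (fun ω => F (A ω) (Y ω) (Y ω i)) μ) :
    (Fintype.card ι : ℝ) • ∫ ω, F (A ω) (Y ω) (Y ω i) ∂μ =
      ∫ q, ∑ k, r q.1 (q.2 k) • F q.1 q.2 (q.2 k) ∂(lam.prod (Measure.pi fun _ => ν)) := by
  have hm : ∀ k, StronglyMeasurable fun q : Z × (ι → 𝒴) =>
      r q.1 (q.2 k) • F q.1 q.2 (q.2 k) := fun k =>
    (hr.comp (g := uncurry r) (f := fun q : Z × (ι → 𝒴) => (q.1, q.2 k))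
      (by fun_prop)).stronglyMeasurable.smul (hF.comp_measurable (measurable_mark _))
  rw [integral_finsetSum _ fun k _ => H.integrable_mark hF hs hi k]
  have h1 : ∀ k, ∫ q, r q.1 (q.2 k) • F q.1 q.2 (q.2 k)
        ∂(lam.prod (Measure.pi fun _ => ν)) = ∫ ω, F (A ω) (Y ω) (Y ω i) ∂μ := by
    intro k
    refine Eq.trans ?_ (H.integral_eq_prod (F := fun q => F q.1 q.2 (q.2 i))
      (hF.comp_measurable (measurable_mark _))).symm
    have hp := measurePreserving_swap (lam := lam) (ν := ν) (Equiv.swap i k)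
    rw [← hp.map_eq, integral_map hp.measurable.aemeasurable (hm i).aestronglyMeasurable, hp.map_eq]
    simp [hs]
  simp [h1, ← Nat.cast_smul_eq_nsmul ℝ]

variable [IsFiniteMeasure μ] [CompleteSpace E]

/-- Two functions of the unordered sample and its marked point with the same weighted sums over the
sample have the same conditional expectation given `A`. -/
theorem condExp_congr_of_sum_eq
    (H : HasJointDensity A Y (fun z y => r z (y i)) μ lam (Measure.pi fun _ => ν))
    (hr : Measurable (uncurry r)) {F G : Z → (ι → 𝒴) → 𝒴 → E}
    (hF : StronglyMeasurable fun q : Z × (ι → 𝒴) × 𝒴 => F q.1 q.2.1 q.2.2)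
    (hG : StronglyMeasurable fun q : Z × (ι → 𝒴) × 𝒴 => G q.1 q.2.1 q.2.2)
    (hsF : ∀ (σ : Equiv.Perm ι) z y a, F z (y ∘ σ) a = F z y a)
    (hsG : ∀ (σ : Equiv.Perm ι) z y a, G z (y ∘ σ) a = G z y a)
    (hiF : Integrable (fun ω => F (A ω) (Y ω) (Y ω i)) μ)
    (hiG : Integrable (fun ω => G (A ω) (Y ω) (Y ω i)) μ)
    (hFG : ∀ z y, ∑ k, r z (y k) • F z y (y k) = ∑ k, r z (y k) • G z y (y k)) :
    μ[fun ω => F (A ω) (Y ω) (Y ω i) | MeasurableSpace.comap A inferInstance] =ᵐ[μ]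
      μ[fun ω => G (A ω) (Y ω) (Y ω i) | MeasurableSpace.comap A inferInstance] := by
  classical
  refine condExp_congr_of_setIntegral_eq H.measurable_left.comap_le hiF hiG ?_
  rintro _ ⟨s, hs, rfl⟩
  rw [← integral_indicator (H.measurable_left hs), ← integral_indicator (H.measurable_left hs)]
  have hS : MeasurableSet (Prod.fst ⁻¹' s : Set (Z × (ι → 𝒴) × 𝒴)) := measurable_fst hs
  -- Cutting off to `z ∈ s` keeps the symmetry in the sample, so the sum formula applies to
  -- integrals over sets generated by `A`.
  have hFs := H.card_smul_integral hr (F := fun z y a => if z ∈ s then F z y a else 0)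
    (hF.indicator hS) (by simp [hsF]) (hiF.indicator (H.measurable_left hs))
  have hGs := H.card_smul_integral hr (F := fun z y a => if z ∈ s then G z y a else 0)
    (hG.indicator hS) (by simp [hsG]) (hiG.indicator (H.measurable_left hs))
  have hn : (Fintype.card ι : ℝ) ≠ 0 := by
    have : Nonempty ι := ⟨i⟩
    exact_mod_cast Fintype.card_ne_zero
  have e : (Fintype.card ι : ℝ) • ∫ ω, (if A ω ∈ s then F (A ω) (Y ω) (Y ω i) else 0) ∂μ
      = (Fintype.card ι : ℝ) • ∫ ω, (if A ω ∈ s then G (A ω) (Y ω) (Y ω i) else 0) ∂μ := by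
    rw [hFs, hGs]
    refine integral_congr_ae (ae_of_all _ fun q => ?_)
    by_cases hq : q.1 ∈ s <;> simp [hq, hFG]
  exact smul_right_injective _ hn e

end HasJointDensity

/-! ### Rao-Blackwell: conditional mean and variance of the self-normalized mean -/

namespace HasJointDensity

variable {Ω Z 𝒴 E ι : Type*} [Fintype ι] [MeasurableSpace Ω] [MeasurableSpace Z]
  [MeasurableSpace 𝒴] [NormedAddCommGroup E] [NormedSpace ℝ E] [CompleteSpace E]
  {A : Ω → Z} {Y : Ω → ι → 𝒴} {r : Z → 𝒴 → ℝ} {μ : Measure Ω} {lam : Measure Z}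
  {ν : Measure 𝒴} [IsProbabilityMeasure ν] [SFinite lam] {i : ι} [DecidableEq ι]

-- Both second moments become integrals of weighted sums over the sample, and there the comparison
-- is Jensen's inequality pointwise.
omit [CompleteSpace E] in
theorem eLpNorm_selfNormMean_le
    (H : HasJointDensity A Y (fun z y => r z (y i)) μ lam (Measure.pi fun _ => ν))
    (hr : Measurable (uncurry r)) (h0 : ∀ z y, 0 ≤ r z y) {h : Z → 𝒴 → E}
    (hh : StronglyMeasurable (uncurry h)) :
    eLpNorm (fun ω => selfNormMean r h (A ω) (Y ω)) 2 μ ≤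
      eLpNorm (fun ω => h (A ω) (Y ω i)) 2 μ := by
  refine eLpNorm_two_le_of_lintegral_le ?_
  have hS := stronglyMeasurable_selfNormMean (ι := ι) hr hh
  have e1 := H.card_mul_lintegral hr
    (F := fun z y _ => ENNReal.ofReal (‖selfNormMean r h z y‖ ^ 2))
    (((hS.comp_measurable (g := fun q : Z × (ι → 𝒴) × 𝒴 => (q.1, q.2.1))
      (by fun_prop)).norm.measurable.pow_const 2).ennreal_ofReal)
    (by simp [selfNormMean_comp_perm])
  have e2 := H.card_mul_lintegral hr
    (F := fun z _ a => ENNReal.ofReal (‖h z a‖ ^ 2))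
    (((hh.comp_measurable (g := fun q : Z × (ι → 𝒴) × 𝒴 => (q.1, q.2.2))
      (by fun_prop)).norm.measurable.pow_const 2).ennreal_ofReal)
    (by simp)
  have hn : (Fintype.card ι : ℝ≥0∞) ≠ 0 := by
    have : Nonempty ι := ⟨i⟩
    exact_mod_cast Fintype.card_ne_zero
  refine (ENNReal.mul_le_mul_iff_right hn (ENNReal.natCast_ne_top _)).1 ?_
  rw [e1, e2]
  refine lintegral_mono fun q => ?_
  simp only [← ENNReal.ofReal_mul (h0 _ _)]
  rw [← ENNReal.ofReal_sum_of_nonneg fun k _ => mul_nonneg (h0 _ _) (sq_nonneg _),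
    ← ENNReal.ofReal_sum_of_nonneg fun k _ => mul_nonneg (h0 _ _) (sq_nonneg _), ← Finset.sum_mul]
  exact ENNReal.ofReal_le_ofReal (sum_mul_norm_selfNormMean_sq_le h0 _ _)

omit [CompleteSpace E] in
theorem memLp_selfNormMean
    (H : HasJointDensity A Y (fun z y => r z (y i)) μ lam (Measure.pi fun _ => ν))
    (hr : Measurable (uncurry r)) (h0 : ∀ z y, 0 ≤ r z y) {h : Z → 𝒴 → E}
    (hh : StronglyMeasurable (uncurry h)) (hi : MemLp (fun ω => h (A ω) (Y ω i)) 2 μ) :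
    MemLp (fun ω => selfNormMean r h (A ω) (Y ω)) 2 μ :=
  ⟨((stronglyMeasurable_selfNormMean hr hh).comp_measurable H.measurable_pair).aestronglyMeasurable,
    (H.eLpNorm_selfNormMean_le hr h0 hh).trans_lt hi.2⟩

variable [IsFiniteMeasure μ]

/-- The self-normalized mean does not depend on the marked point, so its weighted sum is the total
weight times itself, which is the weighted sum of `h`. -/
theorem condExp_selfNormMean
    (H : HasJointDensity A Y (fun z y => r z (y i)) μ lam (Measure.pi fun _ => ν))
    (hr : Measurable (uncurry r)) (h0 : ∀ z y, 0 ≤ r z y) {h : Z → 𝒴 → E}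
    (hh : StronglyMeasurable (uncurry h)) (hi : MemLp (fun ω => h (A ω) (Y ω i)) 2 μ) :
    μ[fun ω => selfNormMean r h (A ω) (Y ω) | MeasurableSpace.comap A inferInstance] =ᵐ[μ]
      fun ω => weightedMean r ν h (A ω) := by
  refine EventuallyEq.trans ?_ ((H.eval hr h0).condExp_eq hh (hi.integrable one_le_two))
  refine H.condExp_congr_of_sum_eq hr (F := fun z y _ => selfNormMean r h z y)
    (G := fun z _ a => h z a)
    ((stronglyMeasurable_selfNormMean hr hh).comp_measurable
      (g := fun q : Z × (ι → 𝒴) × 𝒴 => (q.1, q.2.1)) (by fun_prop))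
    (hh.comp_measurable (g := fun q : Z × (ι → 𝒴) × 𝒴 => (q.1, q.2.2)) (by fun_prop))
    (by simp [selfNormMean_comp_perm]) (by simp)
    ((H.memLp_selfNormMean hr h0 hh hi).integrable one_le_two) (hi.integrable one_le_two) ?_
  intro z y
  rw [← Finset.sum_smul, sum_smul_selfNormMean h0]

/-- The decrease of the conditional variance is the conditional second moment of the difference. -/
theorem condVar_sub_condVar_selfNormMean
    (H : HasJointDensity A Y (fun z y => r z (y i)) μ lam (Measure.pi fun _ => ν))
    (hr : Measurable (uncurry r)) (h0 : ∀ z y, 0 ≤ r z y) {h : Z → 𝒴 → ℝ}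
    (hh : StronglyMeasurable (uncurry h)) (hi : MemLp (fun ω => h (A ω) (Y ω i)) 2 μ) :
    condVar (MeasurableSpace.comap A inferInstance) (fun ω => h (A ω) (Y ω i)) μ -
      condVar (MeasurableSpace.comap A inferInstance)
        (fun ω => selfNormMean r h (A ω) (Y ω)) μ =ᵐ[μ]
      μ[fun ω => (h (A ω) (Y ω i) - selfNormMean r h (A ω) (Y ω)) ^ 2 |
        MeasurableSpace.comap A inferInstance] := by
  have hm := H.measurable_left.comap_le
  have hS := H.memLp_selfNormMean hr h0 hh hi
  have e1 := condVar_ae_eq_condExp_sq_sub_sq_condExp hm hi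
  have e2 := condVar_ae_eq_condExp_sq_sub_sq_condExp hm hS
  have e3 := condExp_sub hi.integrable_sq hS.integrable_sq (MeasurableSpace.comap A inferInstance)
  have mS := (stronglyMeasurable_selfNormMean (ι := ι) hr hh).comp_measurable
      (g := fun q : Z × (ι → 𝒴) × 𝒴 => (q.1, q.2.1)) (by fun_prop)
  have mh := hh.comp_measurable (g := fun q : Z × (ι → 𝒴) × 𝒴 => (q.1, q.2.2)) (by fun_prop)
  -- With `S` the self-normalized mean, `∑ r h = S ∑ r` gives `∑ r (h² - S²) = ∑ r (h - S)²`.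
  have e4 := H.condExp_congr_of_sum_eq hr
    (F := fun z y a => h z a ^ 2 - selfNormMean r h z y ^ 2)
    (G := fun z y a => (h z a - selfNormMean r h z y) ^ 2)
    ((mh.pow 2).sub (mS.pow 2)) ((mh.sub mS).pow 2)
    (by simp [selfNormMean_comp_perm]) (by simp [selfNormMean_comp_perm])
    (hi.integrable_sq.sub hS.integrable_sq) (hi.sub hS).integrable_sq (by
      intro z y
      have := sum_smul_selfNormMean (ι := ι) (h := h) h0 z y
      simp only [smul_eq_mul] at this ⊢
      rw [← sub_eq_zero, ← Finset.sum_sub_distrib]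
      have h2 : ∀ k, r z (y k) * (h z (y k) ^ 2 - selfNormMean r h z y ^ 2) -
        r z (y k) * (h z (y k) - selfNormMean r h z y) ^ 2 =
        2 * selfNormMean r h z y * (r z (y k) * h z (y k))
          - 2 * selfNormMean r h z y ^ 2 * r z (y k) := fun k => by ring
      simp only [h2]
      rw [Finset.sum_sub_distrib, ← Finset.mul_sum, ← Finset.mul_sum, ← this]
      ring)
  filter_upwards [e1, e2, e3, e4, H.condExp_selfNormMean hr h0 hh hi,
    (H.eval hr h0).condExp_eq hh (hi.integrable one_le_two)] with ω h1 h2 h3 h4 h5 h6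
  rw [Pi.sub_apply, h1, h2]
  refine Eq.trans ?_ h4
  refine Eq.trans ?_ h3.symm
  -- The two conditional means coincide, so their squares cancel in the difference of the variances.
  simp only [Pi.sub_apply, Pi.pow_apply, h5, h6]
  simp only [Pi.pow_def]
  ring

end HasJointDensity

/-! ### Strict decrease of the conditional variance -/

lemma measurePreserving_eval_pair {ι 𝒴 : Type*} [Fintype ι] [MeasurableSpace 𝒴] (ν : Measure 𝒴)
    [IsProbabilityMeasure ν] {i k : ι} (hik : i ≠ k) :
    MeasurePreserving (fun y : ι → 𝒴 => (y i, y k)) (Measure.pi fun _ => ν) (ν.prod ν) where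
  measurable := by fun_prop
  map_eq := by
    have h := (iIndepFun_pi (μ := fun _ : ι => ν) (X := fun _ => id)
      (fun _ => aemeasurable_id)).indepFun hik
    have h2 := (indepFun_iff_map_prod_eq_prod_map_map
      (measurable_pi_apply i).aemeasurable (measurable_pi_apply k).aemeasurable).1 h
    refine h2.trans ?_
    congr 1
    · exact (measurePreserving_eval (fun _ : ι => ν) i).map_eq
    · exact (measurePreserving_eval (fun _ : ι => ν) k).map_eq

namespace HasJointDensity

variable {Ω Z 𝒴 ι : Type*} [Fintype ι] [MeasurableSpace Ω] [MeasurableSpace Z]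
  [MeasurableSpace 𝒴]
  {A : Ω → Z} {Y : Ω → ι → 𝒴} {r : Z → 𝒴 → ℝ} {μ : Measure Ω} {lam : Measure Z}
  {ν : Measure 𝒴} [IsProbabilityMeasure ν] [SFinite lam] {i : ι} [DecidableEq ι]
  [IsFiniteMeasure μ]

/-- Where the marked value agrees with the self-normalized mean of at least two values, it agrees
with the conditional mean. -/
lemma ae_eq_weightedMean_of_ae_eq_selfNormMean
    (H : HasJointDensity A Y (fun z y => r z (y i)) μ lam (Measure.pi fun _ => ν))
    (hr : Measurable (uncurry r)) (h0 : ∀ z y, 0 ≤ r z y) {h : Z → 𝒴 → ℝ}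
    (hh : Measurable (uncurry h)) (hc : 2 ≤ Fintype.card ι) {s : Set Z} (hs : MeasurableSet s)
    (heq : ∀ᵐ ω ∂μ, A ω ∈ s → h (A ω) (Y ω i) = selfNormMean r h (A ω) (Y ω)) :
    ∀ᵐ ω ∂μ, A ω ∈ s → h (A ω) (Y ω i) = weightedMean r ν h (A ω) := by
  have hrk : ∀ k, Measurable fun q : Z × (ι → 𝒴) => r q.1 (q.2 k) := fun k =>
    hr.comp (g := uncurry r) (f := fun q : Z × (ι → 𝒴) => (q.1, q.2 k)) (by fun_prop)
  have hhk : ∀ k, Measurable fun q : Z × (ι → 𝒴) => h q.1 (q.2 k) := fun k =>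
    hh.comp (g := uncurry h) (f := fun q : Z × (ι → 𝒴) => (q.1, q.2 k)) (by fun_prop)
  have hS := (stronglyMeasurable_selfNormMean (ι := ι) hr hh.stronglyMeasurable).measurable
  -- A second sample point to compare with the marked one; this is where at least two points are
  -- needed.
  obtain ⟨k, hk⟩ : ∃ k, k ≠ i := by
    have : Nontrivial ι := Fintype.one_lt_card_iff_nontrivial.1 hc
    exact exists_ne i
  have h1 : ∀ᵐ q ∂(lam.prod (Measure.pi fun _ : ι => ν)), 0 < r q.1 (q.2 i) →
      q.1 ∈ s → h q.1 (q.2 i) = selfNormMean r h q.1 q.2 := by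
    refine (H.ae_iff (p := fun q : Z × (ι → 𝒴) =>
      q.1 ∈ s → h q.1 (q.2 i) = selfNormMean r h q.1 q.2) ?_).1 heq
    have : {q : Z × (ι → 𝒴) | q.1 ∈ s → h q.1 (q.2 i) = selfNormMean r h q.1 q.2} =
        (Prod.fst ⁻¹' s)ᶜ ∪ {q : Z × (ι → 𝒴) | h q.1 (q.2 i) = selfNormMean r h q.1 q.2} := by
      ext q; simp [imp_iff_not_or]
    rw [this]
    exact (measurable_fst hs).compl.union (measurableSet_eq_fun (hhk i) hS)
  -- The swap of `i` and `k` carries the statement for the marked point to the point `k`, since the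
  -- self-normalized mean is symmetric.
  have h2 : ∀ᵐ q ∂(lam.prod (Measure.pi fun _ : ι => ν)), 0 < r q.1 (q.2 k) →
      q.1 ∈ s → h q.1 (q.2 k) = selfNormMean r h q.1 q.2 := by
    have h3 := (measurePreserving_swap (lam := lam) (ν := ν)
      (Equiv.swap i k)).quasiMeasurePreserving.ae h1
    simpa [selfNormMean_comp_perm] using h3
  let B : Set (Z × 𝒴 × 𝒴) := {q | q.1 ∈ s → 0 < r q.1 q.2.1 → 0 < r q.1 q.2.2 →
    h q.1 q.2.1 = h q.1 q.2.2}
  have hB : MeasurableSet B := by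
    have r1 : Measurable fun q : Z × 𝒴 × 𝒴 => r q.1 q.2.1 :=
      hr.comp (g := uncurry r) (f := fun q : Z × 𝒴 × 𝒴 => (q.1, q.2.1)) (by fun_prop)
    have r2 : Measurable fun q : Z × 𝒴 × 𝒴 => r q.1 q.2.2 :=
      hr.comp (g := uncurry r) (f := fun q : Z × 𝒴 × 𝒴 => (q.1, q.2.2)) (by fun_prop)
    have k1 : Measurable fun q : Z × 𝒴 × 𝒴 => h q.1 q.2.1 :=
      hh.comp (g := uncurry h) (f := fun q : Z × 𝒴 × 𝒴 => (q.1, q.2.1)) (by fun_prop)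
    have k2 : Measurable fun q : Z × 𝒴 × 𝒴 => h q.1 q.2.2 :=
      hh.comp (g := uncurry h) (f := fun q : Z × 𝒴 × 𝒴 => (q.1, q.2.2)) (by fun_prop)
    have : B = (Prod.fst ⁻¹' s)ᶜ ∪ ({q | 0 < r q.1 q.2.1}ᶜ ∪ ({q | 0 < r q.1 q.2.2}ᶜ ∪
        {q | h q.1 q.2.1 = h q.1 q.2.2})) := by
      ext q; simp [B, imp_iff_not_or]
    rw [this]
    exact (measurable_fst hs).compl.union ((measurableSet_lt measurable_const r1).compl.union
      ((measurableSet_lt measurable_const r2).compl.union (measurableSet_eq_fun k1 k2)))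
  -- Both values equal the same self-normalized mean, hence each other; the remaining coordinates
  -- are then forgotten.
  have h4 : ∀ᵐ q ∂(lam.prod (ν.prod ν)), q ∈ B := by
    have hp := (MeasurePreserving.id lam).prod (measurePreserving_eval_pair ν hk.symm)
    rw [← hp.map_eq]
    refine (ae_map_iff hp.measurable.aemeasurable hB).2 ?_
    filter_upwards [h1, h2] with q e1 e2 hq r1 r2
    exact (e1 r1 hq).trans (e2 r2 hq).symm
  have h5 : ∀ᵐ z ∂lam, ∀ᵐ a ∂ν, ∀ᵐ b ∂ν, (z, a, b) ∈ B := by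
    filter_upwards [Measure.ae_ae_of_ae_prod h4] with z hz using Measure.ae_ae_of_ae_prod hz
  have h6 : ∀ᵐ z ∂lam, z ∈ s → 0 < ∫ y, r z y ∂ν → ∀ᵐ b ∂ν, 0 < r z b →
      h z b = weightedMean r ν h z := by
    filter_upwards [h5] with z hz hzs hpos
    -- A reference point `a` of positive density exists because the mass of `r z` is positive; `h z`
    -- then equals `h z a` almost everywhere on positive density, and so does its mean.
    obtain ⟨a, ha, hra⟩ : ∃ a, (∀ᵐ b ∂ν, (z, a, b) ∈ B) ∧ 0 < r z a := by
      by_contra! hcon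
      have : ∫ y, r z y ∂ν = 0 := by
        refine integral_eq_zero_of_ae ?_
        filter_upwards [hz] with a ha using le_antisymm (hcon a ha) (h0 z a)
      exact hpos.ne' this
    have hcst : weightedMean r ν h z = h z a := by
      have : ∫ y, r z y • h z y ∂ν = ∫ y, r z y • h z a ∂ν := by
        refine integral_congr_ae ?_
        filter_upwards [ha] with b hb
        rcases (h0 z b).eq_or_lt with hb0 | hb0
        · simp [← hb0]
        · rw [hb hzs hra hb0]
      rw [weightedMean, this, integral_smul_const, inv_smul_smul₀ hpos.ne']
    filter_upwards [ha] with b hb hrb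
    rw [hcst, hb hzs hra hrb]
  have H' := H.eval hr h0
  have hp := H'.ae_integral_density_pos
  let p : Z × 𝒴 → Prop := fun q => q.1 ∈ s → 0 < ∫ y, r q.1 y ∂ν →
    h q.1 q.2 = weightedMean r ν h q.1
  have hpos : MeasurableSet {q : Z × 𝒴 | 0 < ∫ y, r q.1 y ∂ν} :=
    measurableSet_lt measurable_const (H'.measurable_integral.comp measurable_fst)
  have hw : Measurable fun q : Z × 𝒴 => weightedMean r ν h q.1 :=
    (H'.stronglyMeasurable_weightedMean hh.stronglyMeasurable).measurable.comp measurable_fst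
  have hpm : MeasurableSet {q | p q} := by
    have : {q | p q} = (Prod.fst ⁻¹' s)ᶜ ∪ ({q | 0 < ∫ y, r q.1 y ∂ν}ᶜ ∪
        {q | h q.1 q.2 = weightedMean r ν h q.1}) := by
      ext q; simp [p, imp_iff_not_or]
    rw [this]
    exact (measurable_fst hs).compl.union (hpos.compl.union (measurableSet_eq_fun hh hw))
  have h7 : ∀ᵐ ω ∂μ, p (A ω, Y ω i) := by
    refine (H'.ae_iff hpm).2 ?_
    have hm : MeasurableSet {q : Z × 𝒴 | 0 < r q.1 q.2 → p q} := by
      have : {q : Z × 𝒴 | 0 < r q.1 q.2 → p q} = {q | 0 < r q.1 q.2}ᶜ ∪ {q | p q} := by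
        ext q; simp [imp_iff_not_or]
      rw [this]
      exact (measurableSet_lt measurable_const hr).compl.union hpm
    rw [Measure.ae_prod_iff_ae_ae hm]
    filter_upwards [h6] with z hz
    by_cases hzs : z ∈ s ∧ 0 < ∫ y, r z y ∂ν
    · filter_upwards [hz hzs.1 hzs.2] with b hb hrb _ _ using hb hrb
    · exact ae_of_all _ fun b _ h1 h2 => absurd ⟨h1, h2⟩ hzs
  filter_upwards [h7, hp] with ω e1 e2 e3 using e1 e3 e2

theorem condVar_selfNormMean_le
    (H : HasJointDensity A Y (fun z y => r z (y i)) μ lam (Measure.pi fun _ => ν))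
    (hr : Measurable (uncurry r)) (h0 : ∀ z y, 0 ≤ r z y) {h : Z → 𝒴 → ℝ}
    (hh : Measurable (uncurry h)) (hi : MemLp (fun ω => h (A ω) (Y ω i)) 2 μ) :
    ∀ᵐ ω ∂μ,
      condVar (MeasurableSpace.comap A inferInstance)
        (fun ω => selfNormMean r h (A ω) (Y ω)) μ ω ≤
      condVar (MeasurableSpace.comap A inferInstance) (fun ω => h (A ω) (Y ω i)) μ ω := by
  have e := H.condVar_sub_condVar_selfNormMean hr h0 hh.stronglyMeasurable hi
  have hn : 0 ≤ᵐ[μ] μ[fun ω => (h (A ω) (Y ω i) - selfNormMean r h (A ω) (Y ω)) ^ 2 |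
      MeasurableSpace.comap A inferInstance] :=
    condExp_nonneg (ae_of_all _ fun _ => sq_nonneg _)
  filter_upwards [e, hn] with ω h1 h2
  rw [← h1, Pi.zero_apply, Pi.sub_apply] at h2
  linarith

/-- On the set where the drop `V` vanishes, the marked value equals the self-normalized mean and
hence the conditional mean, so its conditional variance is zero there. Elsewhere `V > 0`. -/
theorem condVar_selfNormMean_lt
    (H : HasJointDensity A Y (fun z y => r z (y i)) μ lam (Measure.pi fun _ => ν))
    (hr : Measurable (uncurry r)) (h0 : ∀ z y, 0 ≤ r z y) {h : Z → 𝒴 → ℝ}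
    (hh : Measurable (uncurry h)) (hi : MemLp (fun ω => h (A ω) (Y ω i)) 2 μ)
    (hc : 2 ≤ Fintype.card ι) :
    ∀ᵐ ω ∂μ,
      0 < condVar (MeasurableSpace.comap A inferInstance) (fun ω => h (A ω) (Y ω i)) μ ω →
      condVar (MeasurableSpace.comap A inferInstance)
        (fun ω => selfNormMean r h (A ω) (Y ω)) μ ω <
      condVar (MeasurableSpace.comap A inferInstance) (fun ω => h (A ω) (Y ω i)) μ ω := by
  have hm := H.measurable_left.comap_le
  have e := H.condVar_sub_condVar_selfNormMean hr h0 hh.stronglyMeasurable hi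
  have hS := H.memLp_selfNormMean hr h0 hh.stronglyMeasurable hi
  have hDi : Integrable (fun ω => (h (A ω) (Y ω i) - selfNormMean r h (A ω) (Y ω)) ^ 2) μ :=
    (hi.sub hS).integrable_sq
  set V := μ[fun ω => (h (A ω) (Y ω i) - selfNormMean r h (A ω) (Y ω)) ^ 2 |
      MeasurableSpace.comap A inferInstance] with hV
  have hn : 0 ≤ᵐ[μ] V := condExp_nonneg (ae_of_all _ fun _ => sq_nonneg _)
  have hVm : StronglyMeasurable[MeasurableSpace.comap A inferInstance] V :=
    stronglyMeasurable_condExp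
  -- `V` is measurable with respect to `A`, so its zero set is the preimage of a set of values `z`.
  obtain ⟨s, hs, hsV⟩ : MeasurableSet[MeasurableSpace.comap A inferInstance] {ω | V ω = 0} :=
    hVm.measurable (measurableSet_singleton 0)
  have hD : ∀ᵐ ω ∂μ, A ω ∈ s → h (A ω) (Y ω i) = selfNormMean r h (A ω) (Y ω) := by
    have h1 : ∫ ω in A ⁻¹' s, (h (A ω) (Y ω i) - selfNormMean r h (A ω) (Y ω)) ^ 2 ∂μ = 0 := by
      rw [← setIntegral_condExp hm hDi ⟨s, hs, rfl⟩, hsV]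
      refine (setIntegral_congr_fun (hm _ (hsV ▸ ⟨s, hs, rfl⟩)) (g := fun _ => (0 : ℝ))
        fun ω hω => ?_).trans (by simp)
      exact hω
    have h2 := (setIntegral_eq_zero_iff_of_nonneg_ae (ae_of_all _ fun _ => sq_nonneg _)
      hDi.integrableOn).1 h1
    have h3 := (ae_restrict_iff' (H.measurable_left hs)).1 h2
    filter_upwards [h3] with ω hω hωs
    exact sub_eq_zero.1 ((pow_eq_zero_iff two_ne_zero).1 (hω hωs))
  have hE := H.ae_eq_weightedMean_of_ae_eq_selfNormMean hr h0 hh hc hs hD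
  have hq := (H.eval hr h0).condExp_eq hh.stronglyMeasurable (hi.integrable one_le_two)
  have hi2 : MemLp ((fun ω => h (A ω) (Y ω i)) -
      μ[fun ω => h (A ω) (Y ω i) | MeasurableSpace.comap A inferInstance]) 2 μ :=
    hi.sub (hi.condExp one_le_two)
  have hzero : ∀ᵐ ω ∂μ, A ω ∈ s →
      condVar (MeasurableSpace.comap A inferInstance) (fun ω => h (A ω) (Y ω i)) μ ω = 0 := by
    have h1 : ∫ ω in A ⁻¹' s, condVar (MeasurableSpace.comap A inferInstance)
        (fun ω => h (A ω) (Y ω i)) μ ω ∂μ = 0 := by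
      rw [setIntegral_condVar (hm := hm) hi2.integrable_sq ⟨s, hs, rfl⟩]
      refine integral_eq_zero_of_ae ?_
      rw [EventuallyEq, ae_restrict_iff' (H.measurable_left hs)]
      filter_upwards [hE, hq] with ω h2 h3 h4
      rw [h3, h2 h4, sub_self, Pi.zero_apply, zero_pow two_ne_zero]
    have hnn : 0 ≤ᵐ[μ] condVar (MeasurableSpace.comap A inferInstance)
        (fun ω => h (A ω) (Y ω i)) μ := condExp_nonneg (ae_of_all _ fun _ => sq_nonneg _)
    have h2 := (setIntegral_eq_zero_iff_of_nonneg_ae (ae_restrict_of_ae hnn)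
      integrable_condVar.integrableOn).1 h1
    exact (ae_restrict_iff' (H.measurable_left hs)).1 h2
  filter_upwards [e, hn, hzero] with ω h1 h2 h3 h4
  have h5 : V ω ≠ 0 := fun h6 => h4.ne' (h3 (by
    have : ω ∈ A ⁻¹' s := by rw [hsV]; exact h6
    exact this))
  have h7 : 0 < V ω := lt_of_le_of_ne h2 (Ne.symm h5)
  rw [← h1, Pi.sub_apply] at h7
  linarith

end HasJointDensity

/-! ### Mean-square convergence of self-normalized means -/

lemma tendsto_eLpNorm_two_zero_of_dominated {Ω E : Type*} [MeasurableSpace Ω] {μ : Measure Ω}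
    [NormedAddCommGroup E] {F : ℕ → Ω → E} {g : Ω → ℝ}
    (hF : ∀ K, AEStronglyMeasurable (F K) μ) (hg : MemLp g 2 μ) (hFg : ∀ K ω, ‖F K ω‖ ≤ g ω)
    (hlim : ∀ᵐ ω ∂μ, Tendsto (fun K => F K ω) atTop (𝓝 0)) :
    Tendsto (fun K => eLpNorm (F K) 2 μ) atTop (𝓝 0) := by
  have h1 : Tendsto (fun K => ∫⁻ ω, ‖F K ω‖ₑ ^ (2 : ℝ) ∂μ) atTop (𝓝 (∫⁻ _, 0 ∂μ)) := by
    refine tendsto_lintegral_of_dominated_convergence' (fun ω => ‖g ω‖ₑ ^ (2 : ℝ))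
      (fun K => (hF K).enorm.pow_const _) (fun K => ae_of_all _ fun ω => ?_) ?_ ?_
    · refine ENNReal.rpow_le_rpow ?_ (by norm_num)
      exact enorm_le_iff_norm_le.2 ((hFg K ω).trans (Real.le_norm_self _))
    · have := hg.2
      rw [eLpNorm_lt_top_iff_lintegral_rpow_enorm_lt_top (by norm_num) (by norm_num)] at this
      simpa using this.ne
    · filter_upwards [hlim] with ω hω
      have h2 := ((ENNReal.continuous_rpow_const (y := 2)).tendsto _).comp hω.enorm
      simpa [comp_def] using h2
  have h3 := ((ENNReal.continuous_rpow_const (y := 1 / 2)).tendsto _).comp h1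
  simp only [lintegral_zero] at h3
  rw [ENNReal.zero_rpow_of_pos (by norm_num)] at h3
  refine h3.congr fun K => ?_
  rw [eLpNorm_eq_lintegral_rpow_enorm_toReal (by norm_num) (by norm_num)]
  simp

/-- The first `K` terms of a sequence. -/
def initialSegment {𝒴 : Type*} (K : ℕ) (y : ℕ → 𝒴) : Fin K → 𝒴 := fun k => y k

/-- Samples of all sizes are realized as initial segments of one infinite sequence, so that almost
sure convergence makes sense. -/
lemma measurePreserving_initialSegment {𝒴 : Type*} [MeasurableSpace 𝒴] (ν : Measure 𝒴)
    [IsProbabilityMeasure ν] (K : ℕ) :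
    MeasurePreserving (initialSegment K) (Measure.infinitePi fun _ : ℕ => ν)
      (Measure.pi fun _ : Fin K => ν) where
  measurable := by unfold initialSegment; fun_prop
  map_eq := by
    rw [← Measure.infinitePi_eq_pi]
    exact Measure.map_infinitePi_infinitePi_of_inj (P := fun _ : ℕ => ν)
      (f := fun k : Fin K => (k : ℕ)) Fin.val_injective

/-- The law of large numbers for functions of independent points with law `ν`. -/
lemma ae_tendsto_average_infinitePi {𝒴 E : Type*} [MeasurableSpace 𝒴] {ν : Measure 𝒴}
    [IsProbabilityMeasure ν] [NormedAddCommGroup E] [NormedSpace ℝ E] [CompleteSpace E]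
    [MeasurableSpace E] [BorelSpace E] {f : 𝒴 → E} (hf : StronglyMeasurable f)
    (hi : Integrable f ν) :
    ∀ᵐ y ∂(Measure.infinitePi fun _ : ℕ => ν),
      Tendsto (fun K : ℕ => (K : ℝ)⁻¹ • ∑ k : Fin K, f (initialSegment K y k)) atTop
        (𝓝 (∫ a, f a ∂ν)) := by
  have hp : ∀ k, MeasurePreserving (Function.eval k : (ℕ → 𝒴) → 𝒴)
      (Measure.infinitePi fun _ : ℕ => ν) ν := fun k => measurePreserving_eval_infinitePi _ k
  have h := strong_law_ae (μ := Measure.infinitePi fun _ : ℕ => ν) (fun k y => f (y k))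
    ((hp 0).integrable_comp_of_integrable hi) (fun i j hij =>
      (iIndepFun_infinitePi (P := fun _ : ℕ => ν) (X := fun _ => f)
        fun _ => hf.measurable).indepFun hij)
    (fun k => by
      refine ⟨(hf.measurable.comp (hp k).measurable).aemeasurable,
        (hf.measurable.comp (hp 0).measurable).aemeasurable, ?_⟩
      have e : ∀ j, Measure.map (fun y : ℕ → 𝒴 => f (y j)) (Measure.infinitePi fun _ : ℕ => ν)
          = ν.map f := fun j => by
        rw [← (hp j).map_eq, Measure.map_map hf.measurable (hp j).measurable]
        rw [(hp j).map_eq]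
        rfl
      rw [e, e])
  have e : ∫ y, f (y 0) ∂(Measure.infinitePi fun _ : ℕ => ν) = ∫ a, f a ∂ν := by
    conv_rhs => rw [← (hp 0).map_eq]
    rw [integral_map (hp 0).measurable.aemeasurable hf.aestronglyMeasurable]
  filter_upwards [h] with y hy
  rw [← e]
  refine hy.congr fun K => ?_
  rw [← Fin.sum_univ_eq_sum_range (fun k => f (y k)) K]
  rfl

section SelfNormMean

variable {Z 𝒴 E ι : Type*} [Fintype ι] [NormedAddCommGroup E] [NormedSpace ℝ E]
  {r : Z → 𝒴 → ℝ} {h : Z → 𝒴 → E}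

/-- A convex combination stays in the ball of radius `M`; if all weights vanish, the value is zero.
-/
lemma norm_selfNormMean_le (h0 : ∀ z y, 0 ≤ r z y) {M : ℝ} (hM : 0 ≤ M)
    (hh : ∀ z y, ‖h z y‖ ≤ M) (z : Z) (y : ι → 𝒴) : ‖selfNormMean r h z y‖ ≤ M := by
  have hW : 0 ≤ ∑ k, r z (y k) := Finset.sum_nonneg fun k _ => h0 z (y k)
  rw [selfNormMean, norm_smul, norm_inv, Real.norm_of_nonneg hW]
  refine inv_mul_le_of_le_mul₀ hW hM ?_
  calc ‖∑ k, r z (y k) • h z (y k)‖ ≤ ∑ k, ‖r z (y k) • h z (y k)‖ := norm_sum_le _ _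
    _ ≤ ∑ k, r z (y k) * M := by
        refine Finset.sum_le_sum fun k _ => ?_
        rw [norm_smul, Real.norm_of_nonneg (h0 _ _)]
        exact mul_le_mul_of_nonneg_left (hh _ _) (h0 _ _)
    _ = _ := by rw [← Finset.sum_mul]

lemma selfNormMean_add (h' : Z → 𝒴 → E) (z : Z) (y : ι → 𝒴) :
    selfNormMean r (fun z y => h z y + h' z y) z y =
      selfNormMean r h z y + selfNormMean r h' z y := by
  simp only [selfNormMean, smul_add, Finset.sum_add_distrib]

/-- Numerator and denominator are divided by `K`. The `n` points of `a` contribute fixed sums, which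
disappear in the limit whatever their law. -/
lemma tendsto_selfNormMean {n : ℕ} {z : Z} {a : Fin n → 𝒴} {y : ℕ → 𝒴} {p : ℝ} {c : E}
    (hp : p ≠ 0)
    (h1 : Tendsto (fun K : ℕ => (K : ℝ)⁻¹ • ∑ k : Fin K, r z (initialSegment K y k)) atTop (𝓝 p))
    (h2 : Tendsto (fun K : ℕ => (K : ℝ)⁻¹ • ∑ k : Fin K,
      r z (initialSegment K y k) • h z (initialSegment K y k)) atTop (𝓝 c)) :
    Tendsto (fun K : ℕ => selfNormMean r h z (Sum.elim a (initialSegment K y))) atTop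
      (𝓝 (p⁻¹ • c)) := by
  have hK : Tendsto (fun K : ℕ => (K : ℝ)⁻¹) atTop (𝓝 0) := tendsto_inv_atTop_nhds_zero_nat
  have h3 := (hK.smul_const (∑ k, r z (a k))).add h1
  have h4 := (hK.smul_const (∑ k, r z (a k) • h z (a k))).add h2
  simp only [zero_smul, zero_add] at h3 h4
  refine ((h3.inv₀ hp).smul h4).congr' ?_
  filter_upwards [eventually_gt_atTop 0] with K hK0
  have hK1 : (K : ℝ) ≠ 0 := by exact_mod_cast hK0.ne'
  rw [← smul_add, ← smul_add, selfNormMean, Fintype.sum_sum_type, Fintype.sum_sum_type,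
    smul_eq_mul, mul_inv, inv_inv, smul_smul]
  congr 1
  simp only [Sum.elim_inl, Sum.elim_inr]
  field_simp

end SelfNormMean

namespace HasJointDensity

variable {Ω Z 𝒴 E : Type*} [MeasurableSpace Ω] [MeasurableSpace Z]
  [MeasurableSpace 𝒴] {A : Ω → Z} {r : Z → 𝒴 → ℝ} {μ : Measure Ω} {lam : Measure Z}
  {ν : Measure 𝒴} [IsProbabilityMeasure ν] [SFinite lam]

/-- Independent further points keep the density of the sample. -/
lemma sumElim {ι κ : Type*} [Fintype ι] [Fintype κ] {Y : Ω → ι → 𝒴} {i : ι}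
    (H : HasJointDensity A Y (fun z y => r z (y i)) μ lam (Measure.pi fun _ => ν))
    (hr : Measurable (uncurry r)) (h0 : ∀ z y, 0 ≤ r z y) :
    HasJointDensity (fun ω : Ω × (κ → 𝒴) => A ω.1) (fun ω => Sum.elim (Y ω.1) ω.2)
      (fun z y => r z (y (Sum.inl i))) (μ.prod (Measure.pi fun _ => ν)) lam
      (Measure.pi fun _ => ν) where
  measurable_left := H.measurable_left.comp measurable_fst
  measurable_right := by
    refine measurable_pi_iff.2 fun k => ?_
    rcases k with k | k
    · exact (measurable_pi_apply k).comp (H.measurable_right.comp measurable_fst)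
    · exact (measurable_pi_apply k).comp measurable_snd
  measurable_density := hr.comp (f := fun q : Z × (ι ⊕ κ → 𝒴) => (q.1, q.2 (Sum.inl i)))
    (by fun_prop)
  nonneg z y := h0 z _
  map_eq := by
    have he : Measurable fun q : (ι → 𝒴) × (κ → 𝒴) => (Sum.elim q.1 q.2 : ι ⊕ κ → 𝒴) := by
      refine measurable_pi_iff.2 fun k => ?_
      rcases k with k | k
      · exact (measurable_pi_apply k).comp measurable_fst
      · exact (measurable_pi_apply k).comp measurable_snd
    have hm : Measurable fun ω : Ω × (κ → 𝒴) => (A ω.1, (Sum.elim (Y ω.1) ω.2 : ι ⊕ κ → 𝒴)) :=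
      (H.measurable_left.comp measurable_fst).prodMk
        (he.comp ((H.measurable_right.comp measurable_fst).prodMk measurable_snd))
    have hp : MeasurePreserving (fun q : (ι → 𝒴) × (κ → 𝒴) => (Sum.elim q.1 q.2 : ι ⊕ κ → 𝒴))
        ((Measure.pi fun _ => ν).prod (Measure.pi fun _ => ν)) (Measure.pi fun _ => ν) := by
      convert measurePreserving_sumPiEquivProdPi_symm (fun _ : ι ⊕ κ => ν) using 1
      ext q k
      rcases k with k | k <;> rfl
    have hp' := (MeasurePreserving.id lam).prod hp
    have hrd : Measurable fun q : Z × (ι ⊕ κ → 𝒴) => ENNReal.ofReal (r q.1 (q.2 (Sum.inl i))) :=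
      (hr.comp (f := fun q : Z × (ι ⊕ κ → 𝒴) => (q.1, q.2 (Sum.inl i)))
        (by fun_prop)).ennreal_ofReal
    refine Measure.ext_of_lintegral _ fun F hF => ?_
    have hG : Measurable fun q : (Z × (ι → 𝒴)) × (κ → 𝒴) =>
        F (q.1.1, (Sum.elim q.1.2 q.2 : ι ⊕ κ → 𝒴)) :=
      hF.comp ((measurable_fst.comp measurable_fst).prodMk
        (he.comp ((measurable_snd.comp measurable_fst).prodMk measurable_snd)))
    have hri : Measurable fun q : Z × (ι → 𝒴) => ENNReal.ofReal (r q.1 (q.2 i)) :=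
      (hr.comp (f := fun q : Z × (ι → 𝒴) => (q.1, q.2 i)) (by fun_prop)).ennreal_ofReal
    rw [lintegral_map hF hm, lintegral_withDensity_eq_lintegral_mul _ hrd hF]
    refine (lintegral_prod _ (hF.comp hm).aemeasurable).trans ?_
    refine (H.lintegral_eq_prod (F := fun q => ∫⁻ y, F (q.1, (Sum.elim q.2 y : ι ⊕ κ → 𝒴))
      ∂(Measure.pi fun _ => ν)) hG.lintegral_prod_right').trans ?_
    rw [← hp'.lintegral_comp (hrd.mul hF)]
    have hm2 : Measurable fun q : Z × (ι → 𝒴) × (κ → 𝒴) =>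
        ENNReal.ofReal (r q.1 (q.2.1 i)) * F (q.1, (Sum.elim q.2.1 q.2.2 : ι ⊕ κ → 𝒴)) :=
      (hri.comp (g := fun q : Z × (ι → 𝒴) => ENNReal.ofReal (r q.1 (q.2 i)))
        (f := fun q : Z × (ι → 𝒴) × (κ → 𝒴) => (q.1, q.2.1)) (by fun_prop)).mul
        (hF.comp (measurable_fst.prodMk (he.comp measurable_snd)))
    have e : ∫⁻ q, ENNReal.ofReal (r q.1 (q.2.1 i)) * F (q.1, (Sum.elim q.2.1 q.2.2 : ι ⊕ κ → 𝒴))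
        ∂(lam.prod ((Measure.pi fun _ : ι => ν).prod (Measure.pi fun _ : κ => ν))) =
        ∫⁻ q, ENNReal.ofReal (r q.1 (q.2 i)) *
          ∫⁻ y, F (q.1, (Sum.elim q.2 y : ι ⊕ κ → 𝒴)) ∂(Measure.pi fun _ => ν)
        ∂(lam.prod (Measure.pi fun _ : ι => ν)) := by
      rw [lintegral_prod _ hm2.aemeasurable]
      refine Eq.trans ?_ (lintegral_prod _ (hri.mul hG.lintegral_prod_right').aemeasurable).symm
      refine lintegral_congr fun z => ?_
      refine (lintegral_prod _ (hm2.comp measurable_prodMk_left).aemeasurable).trans ?_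
      refine lintegral_congr fun y => ?_
      exact lintegral_const_mul (ENNReal.ofReal (r z (y i)))
        (f := fun y' => F (z, (Sum.elim y y' : ι ⊕ κ → 𝒴)))
        (hG.comp (measurable_prodMk_left (x := (z, y))))
    exact e.symm

end HasJointDensity

namespace HasJointDensity

variable {Ω Z 𝒴 E : Type*} [MeasurableSpace Ω] [MeasurableSpace Z]
  [MeasurableSpace 𝒴] [NormedAddCommGroup E] [NormedSpace ℝ E] [CompleteSpace E]
  [MeasurableSpace E] [BorelSpace E]
  {A : Ω → Z} {r : Z → 𝒴 → ℝ} {μ : Measure Ω} {lam : Measure Z}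
  {ν : Measure 𝒴} [IsProbabilityMeasure ν] [SFinite lam] [IsFiniteMeasure μ]
  {n : ℕ} {Y : Ω → Fin n → 𝒴} {i : Fin n}

/-- For fixed `ω` the further points are i.i.d. with law `ν`, so the strong law applies to numerator
and denominator; the limit of the denominator is almost surely positive. -/
lemma ae_tendsto_selfNormMean
    (H : HasJointDensity A Y (fun z y => r z (y i)) μ lam (Measure.pi fun _ => ν))
    (hr : Measurable (uncurry r)) (h0 : ∀ z y, 0 ≤ r z y) {h : Z → 𝒴 → E}
    (hh : StronglyMeasurable (uncurry h)) (hi : Integrable (fun ω => h (A ω) (Y ω i)) μ) :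
    ∀ᵐ ω ∂μ, ∀ᵐ y ∂(Measure.infinitePi fun _ : ℕ => ν),
      Tendsto (fun K : ℕ => selfNormMean r h (A ω) (Sum.elim (Y ω) (initialSegment K y))) atTop
        (𝓝 (weightedMean r ν h (A ω))) := by
  have H' := H.eval hr h0
  filter_upwards [H'.ae_integral_density_pos, H'.ae_of_ae H'.ae_integrable_density,
    H'.ae_of_ae (H'.ae_integrable hh hi)] with ω h1 h2 h3
  have m1 : StronglyMeasurable (r (A ω)) :=
    (hr.comp (g := uncurry r) measurable_prodMk_left).stronglyMeasurable
  have m2 : StronglyMeasurable fun y => r (A ω) y • h (A ω) y :=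
    m1.smul (hh.comp_measurable measurable_prodMk_left)
  filter_upwards [ae_tendsto_average_infinitePi m1 h2, ae_tendsto_average_infinitePi m2 h3]
    with y h4 h5
  exact tendsto_selfNormMean h1.ne' h4 h5

omit [CompleteSpace E] [MeasurableSpace E] [BorelSpace E]
  [IsFiniteMeasure μ] in
lemma stronglyMeasurable_selfNormMean_sumElim
    (H : HasJointDensity A Y (fun z y => r z (y i)) μ lam (Measure.pi fun _ => ν))
    (hr : Measurable (uncurry r)) (h0 : ∀ z y, 0 ≤ r z y) {h : Z → 𝒴 → E}
    (hh : StronglyMeasurable (uncurry h)) (κ : Type*) [Fintype κ] :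
    StronglyMeasurable fun ω : Ω × (κ → 𝒴) =>
      selfNormMean r h (A ω.1) (Sum.elim (Y ω.1) ω.2) := by
  have h1 := (H.sumElim (κ := κ) hr h0).measurable_pair
  have h2 := stronglyMeasurable_selfNormMean (ι := Fin n ⊕ κ) hr hh
  exact h2.comp_measurable h1

-- The bound is the same for every number of further points, which makes the truncation argument
-- uniform.
omit [CompleteSpace E] [MeasurableSpace E] [BorelSpace E]
  [IsFiniteMeasure μ] in
lemma eLpNorm_selfNormMean_sumElim_le
    (H : HasJointDensity A Y (fun z y => r z (y i)) μ lam (Measure.pi fun _ => ν))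
    (hr : Measurable (uncurry r)) (h0 : ∀ z y, 0 ≤ r z y) {h : Z → 𝒴 → E}
    (hh : StronglyMeasurable (uncurry h)) (κ : Type*) [Fintype κ] [DecidableEq κ] :
    eLpNorm (fun ω : Ω × (κ → 𝒴) => selfNormMean r h (A ω.1) (Sum.elim (Y ω.1) ω.2)) 2
      (μ.prod (Measure.pi fun _ => ν)) ≤ eLpNorm (fun ω => h (A ω) (Y ω i)) 2 μ := by
  have HK := H.sumElim (κ := κ) hr h0
  have h1 := HK.eLpNorm_selfNormMean_le (r := r) hr h0 hh
  simp only [Sum.elim_inl] at h1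
  refine h1.trans (le_of_eq ?_)
  have hm : StronglyMeasurable fun ω => h (A ω) (Y ω i) :=
    hh.comp_measurable (H.eval hr h0).measurable_pair
  exact eLpNorm_comp_measurePreserving (g := fun ω => h (A ω) (Y ω i)) hm.aestronglyMeasurable
    (measurePreserving_fst (μ := μ) (ν := Measure.pi fun _ : κ => ν))

lemma tendsto_eLpNorm_selfNormMean_of_bounded
    (H : HasJointDensity A Y (fun z y => r z (y i)) μ lam (Measure.pi fun _ => ν))
    (hr : Measurable (uncurry r)) (h0 : ∀ z y, 0 ≤ r z y) {h : Z → 𝒴 → E}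
    (hh : StronglyMeasurable (uncurry h)) {M : ℝ} (hM : 0 ≤ M) (hhM : ∀ z y, ‖h z y‖ ≤ M) :
    Tendsto (fun K : ℕ => eLpNorm (fun ω : Ω × (Fin K → 𝒴) =>
      selfNormMean r h (A ω.1) (Sum.elim (Y ω.1) ω.2) - weightedMean r ν h (A ω.1)) 2
        (μ.prod (Measure.pi fun _ => ν))) atTop (𝓝 0) := by
  have hi : MemLp (fun ω => h (A ω) (Y ω i)) 2 μ :=
    MemLp.of_bound (hh.comp_measurable (H.eval hr h0).measurable_pair).aestronglyMeasurable M
      (ae_of_all _ fun ω => hhM _ _)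
  have H' := H.eval hr h0
  have hq := H'.memLp_weightedMean hh one_le_two hi
  have hqm := (H'.stronglyMeasurable_weightedMean hh).comp_measurable H.measurable_left
  have hm : ∀ K : ℕ, StronglyMeasurable fun ω : Ω × (Fin K → 𝒴) =>
      selfNormMean r h (A ω.1) (Sum.elim (Y ω.1) ω.2) - weightedMean r ν h (A ω.1) := fun K =>
    (H.stronglyMeasurable_selfNormMean_sumElim hr h0 hh (Fin K)).sub
      (hqm.comp_measurable measurable_fst)
  have hp : ∀ K : ℕ, MeasurePreserving
      (fun ω : Ω × (ℕ → 𝒴) => (ω.1, initialSegment K ω.2))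
      (μ.prod (Measure.infinitePi fun _ : ℕ => ν)) (μ.prod (Measure.pi fun _ : Fin K => ν)) :=
    fun K => (MeasurePreserving.id μ).prod (measurePreserving_initialSegment ν K)
  have hmK : ∀ K : ℕ, StronglyMeasurable fun ω : Ω × (ℕ → 𝒴) =>
      selfNormMean r h (A ω.1) (Sum.elim (Y ω.1) (initialSegment K ω.2)) -
        weightedMean r ν h (A ω.1) := fun K => by
    have := (hm K).comp_measurable (hp K).measurable
    exact this
  have e : ∀ K : ℕ, eLpNorm (fun ω : Ω × (ℕ → 𝒴) =>
      selfNormMean r h (A ω.1) (Sum.elim (Y ω.1) (initialSegment K ω.2)) -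
        weightedMean r ν h (A ω.1)) 2 (μ.prod (Measure.infinitePi fun _ : ℕ => ν)) =
      eLpNorm (fun ω : Ω × (Fin K → 𝒴) =>
      selfNormMean r h (A ω.1) (Sum.elim (Y ω.1) ω.2) - weightedMean r ν h (A ω.1)) 2
        (μ.prod (Measure.pi fun _ => ν)) := fun K => by
    have := eLpNorm_comp_measurePreserving (p := 2) (hm K).aestronglyMeasurable (hp K)
    exact this
  refine Tendsto.congr e (tendsto_eLpNorm_two_zero_of_dominated
    (g := fun ω => M + ‖weightedMean r ν h (A ω.1)‖)
    (fun K => (hmK K).aestronglyMeasurable) ?_ (fun K ω => ?_) ?_)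
  · have hg : MemLp (fun ω => M + ‖weightedMean r ν h (A ω)‖) 2 μ := (memLp_const M).add hq.norm
    have hf : MeasurePreserving (Prod.fst : Ω × (ℕ → 𝒴) → Ω)
      (μ.prod (Measure.infinitePi fun _ : ℕ => ν)) μ := measurePreserving_fst
    exact hg.comp_measurePreserving hf
  · exact (norm_sub_le _ _).trans (by gcongr; exact norm_selfNormMean_le h0 hM hhM _ _)
  · have hms : MeasurableSet {ω : Ω × (ℕ → 𝒴) | Tendsto (fun K : ℕ =>
        selfNormMean r h (A ω.1) (Sum.elim (Y ω.1) (initialSegment K ω.2)) -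
          weightedMean r ν h (A ω.1)) atTop (𝓝 0)} :=
      measurableSet_tendsto _ fun K => (hmK K).measurable
    rw [Measure.ae_prod_iff_ae_ae hms]
    filter_upwards [H.ae_tendsto_selfNormMean hr h0 hh (hi.integrable one_le_two)] with ω hω
    filter_upwards [hω] with y hy
    simpa using hy.sub_const (weightedMean r ν h (A ω))

/-- Self-normalized importance sampling converges in mean square when the marked value is square
integrable. -/
theorem tendsto_eLpNorm_selfNormMean
    (H : HasJointDensity A Y (fun z y => r z (y i)) μ lam (Measure.pi fun _ => ν))
    (hr : Measurable (uncurry r)) (h0 : ∀ z y, 0 ≤ r z y) {h : Z → 𝒴 → E}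
    (hh : StronglyMeasurable (uncurry h)) (hi : MemLp (fun ω => h (A ω) (Y ω i)) 2 μ) :
    Tendsto (fun K : ℕ => eLpNorm (fun ω : Ω × (Fin K → 𝒴) =>
      selfNormMean r h (A ω.1) (Sum.elim (Y ω.1) ω.2) - weightedMean r ν h (A ω.1)) 2
        (μ.prod (Measure.pi fun _ => ν))) atTop (𝓝 0) := by
  have H' := H.eval hr h0
  rw [ENNReal.tendsto_nhds_zero]
  intro ε hε
  -- Three errors of size `δ` arise: the bounded part, and the two means of the tail.
  obtain ⟨δ, hδ0, hδ⟩ : ∃ δ : ℝ, 0 < δ ∧ 3 * ENNReal.ofReal δ ≤ ε := by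
    rcases eq_or_ne ε ∞ with rfl | hε'
    · exact ⟨1, one_pos, le_top⟩
    · refine ⟨ε.toReal / 3, div_pos (ENNReal.toReal_pos hε.ne' hε') (by norm_num), ?_⟩
      rw [show (3 : ℝ≥0∞) = ENNReal.ofReal 3 by simp, ← ENNReal.ofReal_mul (by norm_num),
        mul_div_cancel₀ _ (by norm_num), ENNReal.ofReal_toReal hε']
  have hmap : MemLp (uncurry h) 2 (μ.map fun ω => (A ω, Y ω i)) :=
    (memLp_map_measure_iff hh.aestronglyMeasurable H'.measurable_pair.aemeasurable).2 hi
  -- Truncation level: the part of `h` with norm at least `M` has `L²` norm at most `δ` under the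
  -- law of the marked pair.
  obtain ⟨M, hMδ⟩ := hmap.eLpNorm_indicator_norm_ge_le hh hδ0
  set T : Set (Z × 𝒴) := {x | M ≤ ‖uncurry h x‖₊} with hT
  have hTm : MeasurableSet T := measurableSet_le measurable_const hh.norm.measurable
  set h1 : Z → 𝒴 → E := fun z y => Tᶜ.indicator (uncurry h) (z, y) with hh1
  set h2 : Z → 𝒴 → E := fun z y => T.indicator (uncurry h) (z, y) with hh2
  have hm1 : StronglyMeasurable (uncurry h1) := hh.indicator hTm.compl
  have hm2 : StronglyMeasurable (uncurry h2) := hh.indicator hTm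
  have hadd : h = fun z y => h1 z y + h2 z y := by
    ext z y
    have := congrFun (Set.indicator_compl_add_self T (uncurry h)) (z, y)
    exact this.symm
  have hb1 : ∀ z y, ‖h1 z y‖ ≤ max M 0 := by
    intro z y
    by_cases hzy : (z, y) ∈ T
    · simp [hh1, hzy]
    · have : ‖h z y‖ < M := by simpa [hT] using hzy
      simp only [hh1, Set.indicator, Set.mem_compl_iff, hzy, not_false_eq_true, if_true]
      exact this.le.trans (le_max_left _ _)
  have hn2 : eLpNorm (fun ω => h2 (A ω) (Y ω i)) 2 μ ≤ ENNReal.ofReal δ := by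
    refine le_trans (le_of_eq ?_) hMδ
    exact (eLpNorm_map_measure (g := uncurry h2) hm2.aestronglyMeasurable
      H'.measurable_pair.aemeasurable).symm
  have hi2 : MemLp (fun ω => h2 (A ω) (Y ω i)) 2 μ :=
    ⟨(hm2.comp_measurable H'.measurable_pair).aestronglyMeasurable,
      hn2.trans_lt ENNReal.ofReal_lt_top⟩
  have hi1 : MemLp (fun ω => h1 (A ω) (Y ω i)) 2 μ :=
    MemLp.of_bound (hm1.comp_measurable H'.measurable_pair).aestronglyMeasurable (max M 0)
      (ae_of_all _ fun ω => hb1 _ _)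
  have hqadd : ∀ᵐ ω ∂μ, weightedMean r ν h (A ω) =
      weightedMean r ν h1 (A ω) + weightedMean r ν h2 (A ω) := by
    filter_upwards [H'.ae_of_ae (H'.ae_integrable hm1 (hi1.integrable one_le_two)),
      H'.ae_of_ae (H'.ae_integrable hm2 (hi2.integrable one_le_two))] with ω e1 e2
    rw [weightedMean, hadd]
    simp only [smul_add]
    rw [integral_add e1 e2, smul_add]
    rfl
  have hbd := H.tendsto_eLpNorm_selfNormMean_of_bounded hr h0 hm1 (le_max_right M 0) hb1
  rw [ENNReal.tendsto_nhds_zero] at hbd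
  filter_upwards [hbd _ (ENNReal.ofReal_pos.2 hδ0)] with K hK
  have hfst := measurePreserving_fst (μ := μ) (ν := Measure.pi fun _ : Fin K => ν)
  -- The tail stays small under both means, by their `L²` contraction, whatever `K` is.
  have b1 : eLpNorm (fun ω : Ω × (Fin K → 𝒴) =>
      selfNormMean r h2 (A ω.1) (Sum.elim (Y ω.1) ω.2)) 2 (μ.prod (Measure.pi fun _ => ν)) ≤
      ENNReal.ofReal δ :=
    (H.eLpNorm_selfNormMean_sumElim_le hr h0 hm2 (Fin K)).trans hn2
  have b2 : eLpNorm (fun ω : Ω × (Fin K → 𝒴) => weightedMean r ν h2 (A ω.1)) 2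
      (μ.prod (Measure.pi fun _ => ν)) ≤ ENNReal.ofReal δ := by
    refine le_trans (le_of_eq ?_) ((H'.eLpNorm_weightedMean_le hm2 one_le_two hi2).trans hn2)
    exact eLpNorm_comp_measurePreserving (g := fun ω => weightedMean r ν h2 (A ω))
      (H'.memLp_weightedMean hm2 one_le_two hi2).1 hfst
  have hSm : ∀ {g : Z → 𝒴 → E}, StronglyMeasurable (uncurry g) →
      AEStronglyMeasurable (fun ω : Ω × (Fin K → 𝒴) =>
        selfNormMean r g (A ω.1) (Sum.elim (Y ω.1) ω.2)) (μ.prod (Measure.pi fun _ => ν)) :=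
    fun hg => (H.stronglyMeasurable_selfNormMean_sumElim hr h0 hg (Fin K)).aestronglyMeasurable
  have hqm : ∀ {g : Z → 𝒴 → E}, StronglyMeasurable (uncurry g) →
      AEStronglyMeasurable (fun ω : Ω × (Fin K → 𝒴) => weightedMean r ν g (A ω.1))
        (μ.prod (Measure.pi fun _ => ν)) := fun hg =>
    ((H'.stronglyMeasurable_weightedMean hg).comp_measurable
      (H.measurable_left.comp measurable_fst)).aestronglyMeasurable
  have hcongr : (fun ω : Ω × (Fin K → 𝒴) =>
      selfNormMean r h (A ω.1) (Sum.elim (Y ω.1) ω.2) - weightedMean r ν h (A ω.1))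
      =ᵐ[μ.prod (Measure.pi fun _ => ν)]
      ((fun ω : Ω × (Fin K → 𝒴) =>
        selfNormMean r h1 (A ω.1) (Sum.elim (Y ω.1) ω.2) - weightedMean r ν h1 (A ω.1)) +
      ((fun ω => selfNormMean r h2 (A ω.1) (Sum.elim (Y ω.1) ω.2)) -
        fun ω => weightedMean r ν h2 (A ω.1))) := by
    filter_upwards [hfst.quasiMeasurePreserving.ae hqadd] with ω hω
    simp only [Pi.add_apply, Pi.sub_apply]
    rw [hω, hadd, selfNormMean_add]
    abel
  rw [eLpNorm_congr_ae hcongr]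
  refine (eLpNorm_add_le ((hSm hm1).sub (hqm hm1)) ((hSm hm2).sub (hqm hm2)) one_le_two).trans ?_
  refine (add_le_add hK ((eLpNorm_sub_le (hSm hm2) (hqm hm2) one_le_two).trans
    (add_le_add b1 b2))).trans (le_trans (le_of_eq ?_) hδ)
  ring

end HasJointDensity

/-! ### Measurability of derivatives and the density of the flow -/

/-- The directional derivative is the limit of the quotients `n (f(x + v/n) - f(x))`. The indicator
is there because convergence is known only where `f` is differentiable. -/
lemma measurable_indicator_fderiv_apply {α E F : Type*} [MeasurableSpace α]
    [NormedAddCommGroup E] [NormedSpace ℝ E] [NormedAddCommGroup F] [NormedSpace ℝ F]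
    [MeasurableSpace F] [BorelSpace F] [SecondCountableTopology F] {f : α → E → F} {x : α → E}
    {v : E} {S : Set α} (hS : MeasurableSet S)
    (hm : ∀ c : ℝ, Measurable fun a => f a (x a + c • v))
    (hd : ∀ a ∈ S, DifferentiableAt ℝ (f a) (x a)) :
    Measurable (S.indicator fun a => fderiv ℝ (f a) (x a) v) := by
  have h0 : Measurable fun a => f a (x a) := by simpa using hm 0
  refine measurable_of_tendsto_metrizable (f := fun n : ℕ => S.indicator fun a =>
    (n : ℝ) • (f a (x a + (n : ℝ)⁻¹ • v) - f a (x a))) (fun n => ?_) ?_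
  · exact (((hm _).sub h0).const_smul (n : ℝ)).indicator hS
  · rw [tendsto_pi_nhds]
    intro a
    by_cases ha : a ∈ S
    · simp only [Set.indicator_of_mem ha]
      refine (hd a ha).hasFDerivAt.lim v ?_
      simpa using tendsto_natCast_atTop_atTop (R := ℝ)
    · simp [Set.indicator_of_notMem ha]

lemma measurable_matrix_det {α ι : Type*} [MeasurableSpace α] [Fintype ι] [DecidableEq ι]
    {M : α → Matrix ι ι ℝ} (h : ∀ k l, Measurable fun a => M a k l) :
    Measurable fun a => (M a).det := by
  simp only [Matrix.det_apply]
  exact Finset.measurable_fun_sum _ fun σ _ =>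
    (Finset.measurable_fun_prod _ fun k _ => h (σ k) k).const_smul _

namespace ConditionalFlow

variable {d : ℕ} (φ : ConditionalFlow d) (ρ₀ : Vec d → ℝ)

/-- The conditional density as a function of the point and the time, cut off outside `(0, 1)`. -/
noncomputable def cutDensity (z : Vec d × ℝ) (y : Vec d) : ℝ :=
  (Set.Ioo (0 : ℝ) 1).indicator (fun t => φ.condDensity ρ₀ t y z.1) z.2

/-- The conditional velocity as a function of the point and the time, cut off outside `(0, 1)`. -/
noncomputable def cutVelocity (z : Vec d × ℝ) (y : Vec d) : Vec d :=
  (Set.Ioo (0 : ℝ) 1).indicator (fun t => φ.velocity t y z.1) z.2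

lemma measurable_indicator_timeDeriv :
    Measurable fun z : ℝ × Vec d × Vec d =>
      (Set.Ioo (0 : ℝ) 1).indicator (fun t => φ.timeDeriv t z.2.1 z.2.2) z.1 := by
  have h := measurable_indicator_fderiv_apply
    (f := fun (z : ℝ × Vec d × Vec d) s => φ.map s z.2.1 z.2.2) (x := fun z => z.1) (v := (1 : ℝ))
    (S := Prod.fst ⁻¹' Set.Ioo (0 : ℝ) 1) (measurable_fst measurableSet_Ioo)
    (fun c => φ.measurable_map.comp (f := fun z : ℝ × Vec d × Vec d =>
      (z.1 + c • (1 : ℝ), z.2.1, z.2.2)) (by fun_prop))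
    (fun z hz => φ.differentiableAt_time _ hz _ _)
  exact h

lemma measurable_indicator_det :
    Measurable fun z : ℝ × Vec d × Vec d =>
      (Set.Ioo (0 : ℝ) 1).indicator (fun t => (fderiv ℝ (φ.inv t z.2.1) z.2.2).det) z.1 := by
  let b := (EuclideanSpace.basisFun (Fin d) ℝ).toBasis
  have h : ∀ k l, Measurable fun z : ℝ × Vec d × Vec d =>
      (Set.Ioo (0 : ℝ) 1).indicator (fun t => (fderiv ℝ (φ.inv t z.2.1) z.2.2 (b l)) k) z.1 := by
    intro k l
    have h1 := measurable_indicator_fderiv_apply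
      (f := fun (z : ℝ × Vec d × Vec d) x => φ.inv z.1 z.2.1 x) (x := fun z => z.2.2) (v := b l)
      (S := Prod.fst ⁻¹' Set.Ioo (0 : ℝ) 1) (measurable_fst measurableSet_Ioo)
      (fun c => φ.measurable_inv.comp (f := fun z : ℝ × Vec d × Vec d =>
        (z.1, z.2.1, z.2.2 + c • b l)) (by fun_prop))
      (fun z hz => φ.differentiable_inv _ hz _ _)
    have h2 : Measurable fun v : Vec d => v k := by fun_prop
    convert h2.comp h1 using 1
    ext z
    by_cases hz : z.1 ∈ Set.Ioo (0 : ℝ) 1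
    · simp [Set.indicator, Set.mem_preimage, hz, -Set.mem_Ioo]
    · simp [Set.indicator, Set.mem_preimage, hz, -Set.mem_Ioo]
  have h3 : Measurable fun z : ℝ × Vec d × Vec d =>
      (Prod.fst ⁻¹' Set.Ioo (0 : ℝ) 1).indicator (fun z => (Matrix.of fun k l =>
        (Set.Ioo (0 : ℝ) 1).indicator
          (fun t => (fderiv ℝ (φ.inv t z.2.1) z.2.2 (b l)) k) z.1).det) z :=
    (measurable_matrix_det h).indicator (measurable_fst measurableSet_Ioo)
  convert h3 using 1
  ext z
  by_cases hz : z.1 ∈ Set.Ioo (0 : ℝ) 1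
  · simp only [Set.indicator, Set.mem_preimage, hz, if_true]
    rw [ContinuousLinearMap.det, ← LinearMap.det_toMatrix b]
    congr 1
    ext k l
    simp [LinearMap.toMatrix_apply, b]
  · simp [Set.indicator, Set.mem_preimage, hz, -Set.mem_Ioo]

lemma measurable_cutDensity (hρ : Measurable ρ₀) : Measurable (uncurry (φ.cutDensity ρ₀)) := by
  have h1 := φ.measurable_indicator_det.comp (f := fun q : (Vec d × ℝ) × Vec d =>
    (q.1.2, q.2, q.1.1)) (by fun_prop)
  have h2 := hρ.comp (φ.measurable_inv.comp (f := fun q : (Vec d × ℝ) × Vec d =>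
    (q.1.2, q.2, q.1.1)) (by fun_prop))
  convert h2.mul h1.abs using 1
  ext q
  by_cases hz : q.1.2 ∈ Set.Ioo (0 : ℝ) 1
  · simp [uncurry, cutDensity, condDensity, Set.indicator, hz, -Set.mem_Ioo]
  · simp [uncurry, cutDensity, Set.indicator, hz, -Set.mem_Ioo]

lemma measurable_cutVelocity : Measurable (uncurry φ.cutVelocity) := by
  have h2 := φ.measurable_inv.comp (f := fun q : (Vec d × ℝ) × Vec d =>
    (q.1.2, q.2, q.1.1)) (by fun_prop)
  exact φ.measurable_indicator_timeDeriv.comp (f := fun q : (Vec d × ℝ) × Vec d =>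
    (q.1.2, q.2, φ.inv q.1.2 q.2 q.1.1)) (by fun_prop)

variable {ρ₀}

lemma cutDensity_nonneg (h0 : ∀ x, 0 ≤ ρ₀ x) (z : Vec d × ℝ) (y : Vec d) :
    0 ≤ φ.cutDensity ρ₀ z y :=
  Set.indicator_nonneg (fun _ _ => mul_nonneg (h0 _) (abs_nonneg _)) _

/-- The change of variables for the law of `φ_{t,x₁}(x₀)`. -/
lemma lintegral_map_noiseLaw (hρ : Measurable ρ₀) {t : ℝ}
    (ht : t ∈ Set.Ioo (0 : ℝ) 1) (x₁ : Vec d) {G : Vec d → ℝ≥0∞} (hG : Measurable G) :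
    ∫⁻ x₀, G (φ.map t x₁ x₀) ∂(noiseLaw ρ₀) =
      ∫⁻ x, ENNReal.ofReal (φ.condDensity ρ₀ t x₁ x) * G x := by
  have hm : Measurable (φ.map t x₁) :=
    φ.measurable_map.comp (f := fun x : Vec d => (t, x₁, x)) (by fun_prop)
  have hsurj : φ.inv t x₁ '' Set.univ = Set.univ := by
    rw [Set.image_univ]
    exact Set.range_eq_univ.2 fun x => ⟨_, φ.left_inv t ht x₁ x⟩
  have hinj : Set.InjOn (φ.inv t x₁) Set.univ := by
    intro a _ b _ hab
    rw [← φ.right_inv t ht x₁ a, hab, φ.right_inv t ht x₁ b]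
  -- The area formula is applied to the inverse flow, whose image is the whole space, so only the
  -- inverse has to be differentiable in space.
  have h1 := lintegral_image_eq_lintegral_abs_det_fderiv_mul volume MeasurableSet.univ
    (fun x _ => ((φ.differentiable_inv t ht x₁) x).hasFDerivAt.hasFDerivWithinAt) hinj
    (fun x₀ => ENNReal.ofReal (ρ₀ x₀) * G (φ.map t x₁ x₀))
  rw [hsurj, Measure.restrict_univ] at h1
  rw [noiseLaw]
  refine (lintegral_withDensity_eq_lintegral_mul _ hρ.ennreal_ofReal (hG.comp hm)).trans ?_
  refine h1.trans (lintegral_congr fun x => ?_)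
  rw [φ.right_inv t ht, ← mul_assoc, ← ENNReal.ofReal_mul (abs_nonneg _), condDensity, mul_comm]
  rw [mul_comm (|_|), mul_comm]

end ConditionalFlow

instance : IsProbabilityMeasure timeLaw := ⟨by simp [timeLaw]⟩

lemma ae_timeLaw : ∀ᵐ t ∂timeLaw, t ∈ Set.Ioo (0 : ℝ) 1 := by
  rw [timeLaw, ← restrict_Ioo_eq_restrict_Icc]
  exact ae_restrict_mem measurableSet_Ioo

instance {d : ℕ} (ρ₀ : Vec d → ℝ) : SFinite (noiseLaw ρ₀) := by
  unfold noiseLaw; infer_instance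

lemma isProbabilityMeasure_noiseLaw {d : ℕ} {ρ₀ : Vec d → ℝ}
    (h : ∫⁻ x, ENNReal.ofReal (ρ₀ x) = 1) : IsProbabilityMeasure (noiseLaw ρ₀) :=
  ⟨by rw [noiseLaw, withDensity_apply _ MeasurableSet.univ, Measure.restrict_univ, h]⟩

lemma HasJointDensity.comp_measurePreserving {Ω Ω' Z 𝒴 : Type*} [MeasurableSpace Ω]
    [MeasurableSpace Ω'] [MeasurableSpace Z] [MeasurableSpace 𝒴] {A : Ω → Z} {Y : Ω → 𝒴}
    {r : Z → 𝒴 → ℝ} {μ : Measure Ω} {μ' : Measure Ω'} {lam : Measure Z} {ν : Measure 𝒴}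
    (H : HasJointDensity A Y r μ lam ν) {f : Ω' → Ω} (hf : MeasurePreserving f μ' μ) :
    HasJointDensity (fun ω => A (f ω)) (fun ω => Y (f ω)) r μ' lam ν where
  measurable_left := H.measurable_left.comp hf.measurable
  measurable_right := H.measurable_right.comp hf.measurable
  measurable_density := H.measurable_density
  nonneg := H.nonneg
  map_eq := by
    rw [← H.map_eq, ← hf.map_eq, Measure.map_map H.measurable_pair hf.measurable]
    rfl

/-- The joint density of the model arguments and of a variable `w` that determines `x₁`. -/
theorem ConditionalFlow.hasJointDensity {d : ℕ} (φ : ConditionalFlow d) {ρ₀ : Vec d → ℝ}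
    (hρ : Measurable ρ₀) (h0 : ∀ x, 0 ≤ ρ₀ x) {𝒲 : Type*} [MeasurableSpace 𝒲] (ν : Measure 𝒲)
    [SFinite ν] {e : 𝒲 → Vec d} (he : Measurable e) :
    HasJointDensity (fun s : ℝ × Vec d × 𝒲 => (φ.map s.1 (e s.2.2) s.2.1, s.1))
      (fun s => s.2.2) (fun z w => φ.cutDensity ρ₀ z (e w))
      (timeLaw.prod ((noiseLaw ρ₀).prod ν)) (volume.prod timeLaw) ν where
  measurable_left := (φ.measurable_map.comp (f := fun s : ℝ × Vec d × 𝒲 =>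
    (s.1, e s.2.2, s.2.1)) (by fun_prop)).prodMk measurable_fst
  measurable_right := by fun_prop
  measurable_density := (φ.measurable_cutDensity ρ₀ hρ).comp
    (f := fun q : (Vec d × ℝ) × 𝒲 => (q.1, e q.2)) (by fun_prop)
  nonneg z w := φ.cutDensity_nonneg h0 z (e w)
  map_eq := by
    have hA : Measurable fun s : ℝ × Vec d × 𝒲 => φ.map s.1 (e s.2.2) s.2.1 :=
      φ.measurable_map.comp (f := fun s : ℝ × Vec d × 𝒲 => (s.1, e s.2.2, s.2.1)) (by fun_prop)
    have hm : Measurable fun s : ℝ × Vec d × 𝒲 =>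
        ((φ.map s.1 (e s.2.2) s.2.1, s.1), s.2.2) := by fun_prop
    have hr : Measurable fun q : (Vec d × ℝ) × 𝒲 =>
        ENNReal.ofReal (φ.cutDensity ρ₀ q.1 (e q.2)) :=
      ((φ.measurable_cutDensity ρ₀ hρ).comp
        (f := fun q : (Vec d × ℝ) × 𝒲 => (q.1, e q.2)) (by fun_prop)).ennreal_ofReal
    refine Measure.ext_of_lintegral _ fun F hF => ?_
    rw [lintegral_map hF hm, lintegral_withDensity_eq_lintegral_mul _ hr hF]
    have hFm := hF.comp hm
    refine (lintegral_prod _ hFm.aemeasurable).trans ?_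
    have hrF : Measurable fun q : (Vec d × ℝ) × 𝒲 =>
        ENNReal.ofReal (φ.cutDensity ρ₀ q.1 (e q.2)) * F q := hr.mul hF
    refine Eq.trans ?_ (lintegral_prod _ hrF.aemeasurable).symm
    -- Time goes outermost on both sides; for almost every `t` the noise is then integrated with `w`
    -- fixed, where the change of variables applies.
    refine Eq.trans ?_ (lintegral_prod_symm _ hrF.lintegral_prod_right'.aemeasurable).symm
    refine lintegral_congr_ae ?_
    filter_upwards [ae_timeLaw] with t ht
    refine (lintegral_prod_symm _ (hFm.comp measurable_prodMk_left).aemeasurable).trans ?_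
    have h2 : Measurable fun q : Vec d × 𝒲 =>
        ENNReal.ofReal (φ.cutDensity ρ₀ (q.1, t) (e q.2)) * F ((q.1, t), q.2) :=
      hrF.comp (f := fun q : Vec d × 𝒲 => ((q.1, t), q.2)) (by fun_prop)
    refine Eq.trans ?_ (lintegral_lintegral_swap (μ := ν) (ν := volume)
      (f := fun w x => ENNReal.ofReal (φ.cutDensity ρ₀ (x, t) (e w)) * F ((x, t), w))
      (h2.comp measurable_swap).aemeasurable)
    refine lintegral_congr fun w => ?_
    refine (φ.lintegral_map_noiseLaw hρ ht (e w) (G := fun x => F ((x, t), w))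
      (hF.comp (by fun_prop))).trans (lintegral_congr fun x => ?_)
    simp only [ConditionalFlow.cutDensity, Set.indicator_of_mem ht]

/-! ### Summand gradients as weighted means -/

section Linear

variable {Z 𝒴 E F ι : Type*} [Fintype ι] [MeasurableSpace 𝒴] [NormedAddCommGroup E]
  [NormedSpace ℝ E] [CompleteSpace E] [NormedAddCommGroup F] [NormedSpace ℝ F] [CompleteSpace F]
  {r : Z → 𝒴 → ℝ} {h : Z → 𝒴 → E} {ν : Measure 𝒴} {z : Z}

omit [MeasurableSpace 𝒴] [CompleteSpace E] [CompleteSpace F] in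
lemma selfNormMean_clm_comp (L : Z → E →L[ℝ] F) (y : ι → 𝒴) :
    selfNormMean r (fun z y => L z (h z y)) z y = L z (selfNormMean r h z y) := by
  simp only [selfNormMean, map_smul, map_sum]

lemma weightedMean_clm_comp (L : Z → E →L[ℝ] F) (hi : Integrable (fun y => r z y • h z y) ν) :
    weightedMean r ν (fun z y => L z (h z y)) z = L z (weightedMean r ν h z) := by
  simp only [weightedMean, map_smul]
  rw [← (L z).integral_comp_comm hi]
  simp only [map_smul]

-- The normalized weights sum to one only if their sum is nonzero; otherwise the mean of the
-- constant would be zero.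
omit [MeasurableSpace 𝒴] [CompleteSpace E] in
lemma selfNormMean_const_sub (c : Z → E) {y : ι → 𝒴} (hs : ∑ k, r z (y k) ≠ 0) :
    selfNormMean r (fun z y => c z - h z y) z y = c z - selfNormMean r h z y := by
  simp only [selfNormMean, smul_sub, Finset.sum_sub_distrib]
  rw [← Finset.sum_smul, inv_smul_smul₀ hs]

lemma weightedMean_const_sub (c : Z → E) (hp : ∫ y, r z y ∂ν ≠ 0) (hr : Integrable (r z) ν)
    (hi : Integrable (fun y => r z y • (c z - h z y)) ν) :
    weightedMean r ν (fun z y => c z - h z y) z = c z - weightedMean r ν h z := by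
  have h1 : Integrable (fun y => r z y • c z) ν := hr.smul_const _
  -- Integrability is assumed for the residual `c - h`, so `h` is recovered from it.
  have h2 : ∫ y, r z y • h z y ∂ν = ∫ y, (r z y • c z - r z y • (c z - h z y)) ∂ν := by
    congr 1 with y
    rw [smul_sub]
    abel
  rw [weightedMean, weightedMean, h2, integral_sub h1 hi, integral_smul_const, smul_sub,
    inv_smul_smul₀ hp, sub_sub_cancel]

end Linear

section Model

variable {d p m n : ℕ} (φ : ConditionalFlow d) (model : Vec p → Vec d → ℝ → Vec d) (θ : Vec p)

/-- The linear map that sends a residual `v_θ(x,t) - z` to the gradient of `‖v_θ(x,t) - z‖²`. -/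
noncomputable def residualGrad (z : Vec d × ℝ) : Vec d →L[ℝ] Vec p :=
  (2 : ℝ) • ContinuousLinearMap.adjoint (fderiv ℝ (fun θ' => model θ' z.1 z.2) θ)

/-- The residual `v_θ(x,t) - w(t,x₁,x)`. -/
noncomputable def cutResidual (z : Vec d × ℝ) (y : Vec d) : Vec d :=
  model θ z.1 z.2 - φ.cutVelocity z y

/-- The gradient of the summand with target `w(t,x₁,x)`. -/
noncomputable def cutGrad (z : Vec d × ℝ) (y : Vec d) : Vec p :=
  residualGrad model θ z (cutResidual φ model θ z y)

variable {model θ}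

lemma hasGradientAt_summand (hd : ∀ x t, DifferentiableAt ℝ (fun θ' => model θ' x t) θ)
    (x : Vec d) (t : ℝ) (z : Vec d) :
    HasGradientAt (fun θ' => ‖model θ' x t - z‖ ^ 2)
      (residualGrad model θ (x, t) (model θ x t - z)) θ := by
  have h1 := ((hd x t).hasFDerivAt.sub_const z).norm_sq
  rw [hasGradientAt_iff_hasFDerivAt]
  refine h1.congr_fderiv ?_
  ext v
  simp [residualGrad, ContinuousLinearMap.adjoint_inner_left]

lemma summandGrad_eq (hd : ∀ x t, DifferentiableAt ℝ (fun θ' => model θ' x t) θ)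
    (x : Vec d) (t : ℝ) (z : Vec d) :
    summandGrad model θ x t z = residualGrad model θ (x, t) (model θ x t - z) :=
  (hasGradientAt_summand hd x t z).gradient

lemma lossGrad_eq_sum (hd : ∀ x t, DifferentiableAt ℝ (fun θ' => model θ' x t) θ)
    (b : Batch d m n) (target : Fin m → Fin n → Vec d) :
    lossGrad φ model θ b target =
      ∑ j, ∑ i, summandGrad model θ (batchPoint φ b j i) (b.1 j) (target j i) := by
  refine HasGradientAt.gradient ?_
  rw [hasGradientAt_iff_hasFDerivAt]
  simp only [map_sum]
  refine HasFDerivAt.fun_sum fun j _ => HasFDerivAt.fun_sum fun i _ => ?_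
  rw [← hasGradientAt_iff_hasFDerivAt, summandGrad_eq hd]
  exact hasGradientAt_summand hd _ _ _

/-- In coordinates, the adjoint turns into inner products of the argument with directional
derivatives of the model, which are limits of measurable quotients. -/
lemma measurable_residualGrad (hm : ∀ θ, Measurable fun z : Vec d × ℝ => model θ z.1 z.2)
    (hd : ∀ x t, DifferentiableAt ℝ (fun θ' => model θ' x t) θ) :
    Measurable fun q : (Vec d × ℝ) × Vec d => residualGrad model θ q.1 q.2 := by
  have h1 : ∀ u : Vec p, Measurable fun z : Vec d × ℝ =>
      fderiv ℝ (fun θ' => model θ' z.1 z.2) θ u := by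
    intro u
    have := measurable_indicator_fderiv_apply (f := fun (z : Vec d × ℝ) θ' => model θ' z.1 z.2)
      (x := fun _ => θ) (v := u) (S := Set.univ) MeasurableSet.univ (fun c => hm _)
      (fun z _ => hd _ _)
    simpa using this
  have h2 : ∀ q : (Vec d × ℝ) × Vec d, residualGrad model θ q.1 q.2 =
      ∑ k, (2 * inner ℝ (fderiv ℝ (fun θ' => model θ' q.1.1 q.1.2) θ
        (EuclideanSpace.basisFun (Fin p) ℝ k)) q.2) • EuclideanSpace.basisFun (Fin p) ℝ k := by
    intro q
    rw [← (EuclideanSpace.basisFun (Fin p) ℝ).sum_repr (residualGrad model θ q.1 q.2)]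
    refine Finset.sum_congr rfl fun k _ => ?_
    rw [OrthonormalBasis.repr_apply_apply]
    simp only [residualGrad, smul_apply, inner_smul_right,
      ContinuousLinearMap.adjoint_inner_right]
  simp only [h2]
  refine Finset.measurable_fun_sum _ fun k _ => Measurable.smul_const ?_ _
  exact (((h1 _).comp measurable_fst).inner measurable_snd).const_mul 2

lemma measurable_cutResidual (hm : ∀ θ, Measurable fun z : Vec d × ℝ => model θ z.1 z.2) :
    Measurable (uncurry (cutResidual φ model θ)) :=
  ((hm θ).comp measurable_fst).sub φ.measurable_cutVelocity

lemma measurable_cutGrad (hm : ∀ θ, Measurable fun z : Vec d × ℝ => model θ z.1 z.2)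
    (hd : ∀ x t, DifferentiableAt ℝ (fun θ' => model θ' x t) θ) :
    Measurable (uncurry (cutGrad φ model θ)) := by
  have h1 : Measurable fun q : (Vec d × ℝ) × Vec d => (q.1, cutResidual φ model θ q.1 q.2) :=
    measurable_fst.prodMk (measurable_cutResidual φ hm)
  have h2 := (measurable_residualGrad hm hd).comp h1
  exact h2

lemma cutVelocity_map {t : ℝ} (ht : t ∈ Set.Ioo (0 : ℝ) 1) (x₁ x₀ : Vec d) :
    φ.cutVelocity (φ.map t x₁ x₀, t) x₁ = φ.timeDeriv t x₁ x₀ := by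
  simp only [ConditionalFlow.cutVelocity, Set.indicator_of_mem ht, ConditionalFlow.velocity,
    φ.left_inv t ht]

lemma summandGrad_timeDeriv (hd : ∀ x t, DifferentiableAt ℝ (fun θ' => model θ' x t) θ)
    {t : ℝ} (ht : t ∈ Set.Ioo (0 : ℝ) 1) (x₁ x₀ : Vec d) :
    summandGrad model θ (φ.map t x₁ x₀) t (φ.timeDeriv t x₁ x₀) =
      cutGrad φ model θ (φ.map t x₁ x₀, t) x₁ := by
  rw [summandGrad_eq hd, ← cutVelocity_map φ ht]
  rfl

/-- The gradient is affine in the target, so averaging the targets is the same as averaging the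
gradients. -/
lemma summandGrad_snisVelocity (hd : ∀ x t, DifferentiableAt ℝ (fun θ' => model θ' x t) θ)
    (ρ₀ : Vec d → ℝ) {z : Vec d × ℝ} (ht : z.2 ∈ Set.Ioo (0 : ℝ) 1) {ι : Type} [Fintype ι]
    {y : ι → Vec d} (hs : ∑ k, φ.cutDensity ρ₀ z (y k) ≠ 0) :
    summandGrad model θ z.1 z.2 (φ.snisVelocity ρ₀ z.2 z.1 y) =
      selfNormMean (φ.cutDensity ρ₀) (cutGrad φ model θ) z y := by
  have h1 : φ.snisVelocity ρ₀ z.2 z.1 y =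
      selfNormMean (φ.cutDensity ρ₀) φ.cutVelocity z y := by
    simp only [ConditionalFlow.snisVelocity, selfNormMean, ConditionalFlow.cutDensity,
      ConditionalFlow.cutVelocity, Set.indicator_of_mem ht]
  rw [summandGrad_eq hd, h1, ← selfNormMean_const_sub (fun z : Vec d × ℝ => model θ z.1 z.2) hs]
  exact (selfNormMean_clm_comp (residualGrad model θ) y).symm

lemma summandGrad_exactVelocity (hd : ∀ x t, DifferentiableAt ℝ (fun θ' => model θ' x t) θ)
    (ρ₀ : Vec d → ℝ) (ρ₁ : Measure (Vec d)) {z : Vec d × ℝ} (ht : z.2 ∈ Set.Ioo (0 : ℝ) 1)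
    (hp : ∫ y, φ.cutDensity ρ₀ z y ∂ρ₁ ≠ 0) (hr : Integrable (φ.cutDensity ρ₀ z) ρ₁)
    (hi : Integrable (fun y => φ.cutDensity ρ₀ z y • cutResidual φ model θ z y) ρ₁) :
    summandGrad model θ z.1 z.2 (φ.exactVelocity ρ₀ ρ₁ z.2 z.1) =
      weightedMean (φ.cutDensity ρ₀) ρ₁ (cutGrad φ model θ) z := by
  have h1 : φ.exactVelocity ρ₀ ρ₁ z.2 z.1 =
      weightedMean (φ.cutDensity ρ₀) ρ₁ φ.cutVelocity z := by
    simp only [ConditionalFlow.exactVelocity, weightedMean, ConditionalFlow.cutDensity,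
      ConditionalFlow.cutVelocity, Set.indicator_of_mem ht]
  rw [summandGrad_eq hd, h1,
    ← weightedMean_const_sub (fun z : Vec d × ℝ => model θ z.1 z.2) hp hr hi]
  exact (weightedMean_clm_comp (residualGrad model θ) hi).symm

end Model

/-! ### The batch as a sample with a marked point -/

/-- The law of `(t, x₀, x₁)`. -/
noncomputable abbrev sampleLaw {d : ℕ} (ρ₀ : Vec d → ℝ) (ρ₁ : Measure (Vec d)) :
    Measure (ℝ × Vec d × Vec d) :=
  timeLaw.prod ((noiseLaw ρ₀).prod ρ₁)

/-- The CFM loss and the second moment of its gradient are finite at `θ`. -/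
structure FiniteCFM {d p : ℕ} (φ : ConditionalFlow d) (ρ₀ : Vec d → ℝ) (ρ₁ : Measure (Vec d))
    (model : Vec p → Vec d → ℝ → Vec d) (θ : Vec p) : Prop where
  density_measurable : Measurable ρ₀
  density_nonneg : ∀ x, 0 ≤ ρ₀ x
  density_mass : ∫⁻ x, ENNReal.ofReal (ρ₀ x) = 1
  model_measurable : ∀ θ, Measurable fun z : Vec d × ℝ => model θ z.1 z.2
  model_differentiable : ∀ x t, DifferentiableAt ℝ (fun θ' => model θ' x t) θ
  integrable_loss : Integrable
    (fun s : ℝ × Vec d × Vec d =>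
      ‖model θ (φ.map s.1 s.2.2 s.2.1) s.1 - φ.timeDeriv s.1 s.2.2 s.2.1‖ ^ 2)
    (sampleLaw ρ₀ ρ₁)
  memLp_grad : MemLp
    (fun s : ℝ × Vec d × Vec d =>
      summandGrad model θ (φ.map s.1 s.2.2 s.2.1) s.1 (φ.timeDeriv s.1 s.2.2 s.2.1))
    2 (sampleLaw ρ₀ ρ₁)

/-- The model arguments `(x^{j,i}, t^j)`. -/
noncomputable def batchArg {d m n : ℕ} (φ : ConditionalFlow d) (j : Fin m) (i : Fin n)
    (b : Batch d m n) : Vec d × ℝ :=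
  (batchPoint φ b j i, b.1 j)

/-- The points `x₁^k` of a batch. -/
def batchEnds {d m n : ℕ} (b : Batch d m n) (k : Fin n) : Vec d := (b.2 k).2

namespace FiniteCFM

variable {d p : ℕ} {φ : ConditionalFlow d} {ρ₀ : Vec d → ℝ} {ρ₁ : Measure (Vec d)}
  [IsProbabilityMeasure ρ₁] {model : Vec p → Vec d → ℝ → Vec d} {θ : Vec p} {m n : ℕ}

omit [IsProbabilityMeasure ρ₁] in
lemma isProbabilityMeasure_noise (R : FiniteCFM φ ρ₀ ρ₁ model θ) :
    IsProbabilityMeasure (noiseLaw ρ₀) := isProbabilityMeasure_noiseLaw R.density_mass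

lemma isProbabilityMeasure_batch (R : FiniteCFM φ ρ₀ ρ₁ model θ) (m n : ℕ) :
    IsProbabilityMeasure (batchLaw ρ₀ ρ₁ m n) := by
  have := R.isProbabilityMeasure_noise
  unfold batchLaw
  infer_instance

lemma measurePreserving_sample (R : FiniteCFM φ ρ₀ ρ₁ model θ) (j : Fin m) (i : Fin n) :
    MeasurePreserving (fun b : Batch d m n => (b.1 j, b.2 i)) (batchLaw ρ₀ ρ₁ m n)
      (sampleLaw ρ₀ ρ₁) := by
  have := R.isProbabilityMeasure_noise
  exact (measurePreserving_eval (fun _ : Fin m => timeLaw) j).prod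
    (measurePreserving_eval (fun _ : Fin n => (noiseLaw ρ₀).prod ρ₁) i)

/-- The noise points other than `x₀^i` do not affect the model arguments and are dropped, while all
ends `x₁^k` are kept as averaging points. -/
lemma measurePreserving_ends (R : FiniteCFM φ ρ₀ ρ₁ model θ) (j : Fin m) (i : Fin n) :
    MeasurePreserving (fun b : Batch d m n => (b.1 j, (b.2 i).1, batchEnds b))
      (batchLaw ρ₀ ρ₁ m n)
      (timeLaw.prod ((noiseLaw ρ₀).prod (Measure.pi fun _ : Fin n => ρ₁))) := by
  have := R.isProbabilityMeasure_noise
  have h1 := measurePreserving_arrowProdEquivProdArrow (Vec d) (Vec d) (Fin n)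
    (fun _ => noiseLaw ρ₀) (fun _ => ρ₁)
  have h2 := ((measurePreserving_eval (fun _ : Fin n => noiseLaw ρ₀) i).prod
    (MeasurePreserving.id (Measure.pi fun _ : Fin n => ρ₁))).comp h1
  exact (measurePreserving_eval (fun _ : Fin m => timeLaw) j).prod h2

lemma hasJointDensity_sample (R : FiniteCFM φ ρ₀ ρ₁ model θ) :
    HasJointDensity (fun s : ℝ × Vec d × Vec d => (φ.map s.1 s.2.2 s.2.1, s.1))
      (fun s => s.2.2) (φ.cutDensity ρ₀) (sampleLaw ρ₀ ρ₁) (volume.prod timeLaw) ρ₁ :=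
  φ.hasJointDensity R.density_measurable R.density_nonneg ρ₁ (e := fun y => y) measurable_id

lemma hasJointDensity_batch (R : FiniteCFM φ ρ₀ ρ₁ model θ) (j : Fin m) (i : Fin n) :
    HasJointDensity (batchArg φ j i) batchEnds (fun z y => φ.cutDensity ρ₀ z (y i))
      (batchLaw ρ₀ ρ₁ m n) (volume.prod timeLaw) (Measure.pi fun _ : Fin n => ρ₁) :=
  (φ.hasJointDensity R.density_measurable R.density_nonneg (Measure.pi fun _ : Fin n => ρ₁)
    (e := fun y => y i) (measurable_pi_apply i)).comp_measurePreserving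
    (R.measurePreserving_ends j i)

omit [IsProbabilityMeasure ρ₁] in
lemma measurable_density (R : FiniteCFM φ ρ₀ ρ₁ model θ) :
    Measurable (uncurry (φ.cutDensity ρ₀)) := φ.measurable_cutDensity ρ₀ R.density_measurable

omit [IsProbabilityMeasure ρ₁] in
lemma nonneg (R : FiniteCFM φ ρ₀ ρ₁ model θ) (z : Vec d × ℝ) (y : Vec d) :
    0 ≤ φ.cutDensity ρ₀ z y := φ.cutDensity_nonneg R.density_nonneg z y

omit [IsProbabilityMeasure ρ₁] in
lemma measurable_grad (R : FiniteCFM φ ρ₀ ρ₁ model θ) :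
    Measurable (uncurry (cutGrad φ model θ)) :=
  measurable_cutGrad φ R.model_measurable R.model_differentiable

omit [IsProbabilityMeasure ρ₁] in
lemma stronglyMeasurable_grad (R : FiniteCFM φ ρ₀ ρ₁ model θ) :
    StronglyMeasurable (uncurry (cutGrad φ model θ)) := R.measurable_grad.stronglyMeasurable

omit [IsProbabilityMeasure ρ₁] in
lemma ae_sampleTime (R : FiniteCFM φ ρ₀ ρ₁ model θ) :
    ∀ᵐ s ∂(sampleLaw ρ₀ ρ₁), s.1 ∈ Set.Ioo (0 : ℝ) 1 := by
  have := R.isProbabilityMeasure_noise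
  exact Measure.quasiMeasurePreserving_fst.ae ae_timeLaw

lemma ae_batchTime (R : FiniteCFM φ ρ₀ ρ₁ model θ) (j : Fin m) (i : Fin n) :
    ∀ᵐ b ∂(batchLaw ρ₀ ρ₁ m n), b.1 j ∈ Set.Ioo (0 : ℝ) 1 :=
  (R.measurePreserving_sample j i).quasiMeasurePreserving.ae R.ae_sampleTime

/-- Finiteness of the loss makes the integral in the exact velocity converge. The moment of the
gradient does not give this, as the derivative of the model may be degenerate. -/
lemma memLp_sampleResidual (R : FiniteCFM φ ρ₀ ρ₁ model θ) :
    MemLp (fun s : ℝ × Vec d × Vec d =>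
      cutResidual φ model θ (φ.map s.1 s.2.2 s.2.1, s.1) s.2.2) 2 (sampleLaw ρ₀ ρ₁) := by
  have hm : StronglyMeasurable (uncurry (cutResidual φ model θ)) :=
    (measurable_cutResidual φ R.model_measurable).stronglyMeasurable
  have hm2 := hm.comp_measurable R.hasJointDensity_sample.measurable_pair
  refine (memLp_two_iff_integrable_sq_norm hm2.aestronglyMeasurable).2 ?_
  refine R.integrable_loss.congr ?_
  filter_upwards [R.ae_sampleTime] with s hs
  rw [comp_apply, uncurry_apply_pair, cutResidual, cutVelocity_map φ hs]

omit [IsProbabilityMeasure ρ₁] in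
lemma memLp_sampleGrad (R : FiniteCFM φ ρ₀ ρ₁ model θ) :
    MemLp (fun s : ℝ × Vec d × Vec d =>
      cutGrad φ model θ (φ.map s.1 s.2.2 s.2.1, s.1) s.2.2) 2 (sampleLaw ρ₀ ρ₁) := by
  refine R.memLp_grad.ae_eq ?_
  filter_upwards [R.ae_sampleTime] with s hs
  exact summandGrad_timeDeriv φ R.model_differentiable hs _ _

lemma memLp_batchGrad (R : FiniteCFM φ ρ₀ ρ₁ model θ) (j : Fin m) (i : Fin n) :
    MemLp (fun b => cutGrad φ model θ (batchArg φ j i b) (batchEnds b i)) 2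
      (batchLaw ρ₀ ρ₁ m n) := by
  have h := R.memLp_sampleGrad.comp_measurePreserving (R.measurePreserving_sample j i)
  exact h

lemma memLp_batchResidual (R : FiniteCFM φ ρ₀ ρ₁ model θ) (j : Fin m) (i : Fin n) :
    MemLp (fun b => cutResidual φ model θ (batchArg φ j i b) (batchEnds b i)) 2
      (batchLaw ρ₀ ρ₁ m n) := by
  have h := R.memLp_sampleResidual.comp_measurePreserving (R.measurePreserving_sample j i)
  exact h

lemma ae_cfmSummand (R : FiniteCFM φ ρ₀ ρ₁ model θ) (j : Fin m) (i : Fin n) :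
    ∀ᵐ b ∂(batchLaw ρ₀ ρ₁ m n),
      summandGrad model θ (batchPoint φ b j i) (b.1 j) (cfmTarget φ b j i) =
        cutGrad φ model θ (batchArg φ j i b) (batchEnds b i) := by
  filter_upwards [R.ae_batchTime j i] with b hb
  exact summandGrad_timeDeriv φ R.model_differentiable hb _ _

lemma ae_exactSummand (R : FiniteCFM φ ρ₀ ρ₁ model θ) (j : Fin m) (i : Fin n) :
    ∀ᵐ b ∂(batchLaw ρ₀ ρ₁ m n),
      summandGrad model θ (batchPoint φ b j i) (b.1 j) (exactTarget φ ρ₀ ρ₁ b j i) =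
        weightedMean (φ.cutDensity ρ₀) ρ₁ (cutGrad φ model θ) (batchArg φ j i b) := by
  have := R.isProbabilityMeasure_batch m n
  have H := (R.hasJointDensity_batch j i).eval R.measurable_density R.nonneg
  have hm : StronglyMeasurable (uncurry (cutResidual φ model θ)) :=
    (measurable_cutResidual φ R.model_measurable).stronglyMeasurable
  have hi := H.ae_integrable hm ((R.memLp_batchResidual j i).integrable one_le_two)
  filter_upwards [R.ae_batchTime j i, H.ae_integral_density_pos,
    H.ae_of_ae H.ae_integrable_density, H.ae_of_ae hi] with b h1 h2 h3 h4
  exact summandGrad_exactVelocity φ R.model_differentiable ρ₀ ρ₁ (z := batchArg φ j i b) h1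
    h2.ne' h3 h4

/-- The sum of weights is almost surely positive because the batch's own end `x₁^i` has positive
density at `x^{j,i}`. -/
lemma ae_exfmSummand (R : FiniteCFM φ ρ₀ ρ₁ model θ) (j : Fin m) (i : Fin n) (K : ℕ) :
    ∀ᵐ ω ∂(extBatchLaw ρ₀ ρ₁ m n K),
      exfmSummand φ ρ₀ model θ j i ω =
        selfNormMean (φ.cutDensity ρ₀) (cutGrad φ model θ) (batchArg φ j i ω.1)
          (Sum.elim (batchEnds ω.1) ω.2) := by
  have := R.isProbabilityMeasure_batch m n
  have H := (R.hasJointDensity_batch j i).sumElim (κ := Fin K) R.measurable_density R.nonneg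
  have ht : ∀ᵐ ω ∂(extBatchLaw ρ₀ ρ₁ m n K), ω.1.1 j ∈ Set.Ioo (0 : ℝ) 1 :=
    Measure.quasiMeasurePreserving_fst.ae (R.ae_batchTime j i)
  filter_upwards [ht, H.ae_density_pos] with ω h1 h2
  refine summandGrad_snisVelocity φ R.model_differentiable ρ₀ (z := batchArg φ j i ω.1) h1
    (y := averagingPoints ω) (ne_of_gt ?_)
  exact Finset.sum_pos' (fun k _ => R.nonneg _ _) ⟨Sum.inl i, Finset.mem_univ _, h2⟩

end FiniteCFM

/-! ### Conditional means and variances of the summands -/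

namespace FiniteCFM

variable {d p : ℕ} {φ : ConditionalFlow d} {ρ₀ : Vec d → ℝ} {ρ₁ : Measure (Vec d)}
  [IsProbabilityMeasure ρ₁] {model : Vec p → Vec d → ℝ → Vec d} {θ : Vec p} {m n : ℕ}

lemma isProbabilityMeasure_extBatch (R : FiniteCFM φ ρ₀ ρ₁ model θ) (m n K : ℕ) :
    IsProbabilityMeasure (extBatchLaw ρ₀ ρ₁ m n K) := by
  have := R.isProbabilityMeasure_batch m n
  unfold extBatchLaw
  infer_instance

lemma measurePreserving_extBatch (R : FiniteCFM φ ρ₀ ρ₁ model θ) (m n K : ℕ) :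
    MeasurePreserving Prod.fst (extBatchLaw ρ₀ ρ₁ m n K) (batchLaw ρ₀ ρ₁ m n) := by
  have := R.isProbabilityMeasure_batch m n
  exact measurePreserving_fst

lemma hasJointDensity_extBatch (R : FiniteCFM φ ρ₀ ρ₁ model θ) (j : Fin m) (i : Fin n) (K : ℕ) :
    HasJointDensity (fun ω : ExtBatch d m n K => batchArg φ j i ω.1)
      (fun ω => Sum.elim (batchEnds ω.1) ω.2)
      (fun z y => φ.cutDensity ρ₀ z (y (Sum.inl i)))
      (extBatchLaw ρ₀ ρ₁ m n K) (volume.prod timeLaw) (Measure.pi fun _ => ρ₁) :=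
  (R.hasJointDensity_batch j i).sumElim (κ := Fin K) R.measurable_density R.nonneg

lemma memLp_extBatchGrad (R : FiniteCFM φ ρ₀ ρ₁ model θ) (j : Fin m) (i : Fin n) (K : ℕ) :
    MemLp (fun ω : ExtBatch d m n K => cutGrad φ model θ (batchArg φ j i ω.1)
      ((Sum.elim (batchEnds ω.1) ω.2 : Fin n ⊕ Fin K → Vec d) (Sum.inl i))) 2
      (extBatchLaw ρ₀ ρ₁ m n K) := by
  have h := (R.memLp_batchGrad j i).comp_measurePreserving (R.measurePreserving_extBatch m n K)
  exact h

lemma cfmSummand_ae_eq (R : FiniteCFM φ ρ₀ ρ₁ model θ) (j : Fin m) (i : Fin n) (K : ℕ) :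
    cfmSummand (K := K) φ model θ j i =ᵐ[extBatchLaw ρ₀ ρ₁ m n K]
      fun ω => cutGrad φ model θ (batchArg φ j i ω.1)
        ((Sum.elim (batchEnds ω.1) ω.2 : Fin n ⊕ Fin K → Vec d) (Sum.inl i)) :=
  (R.measurePreserving_extBatch m n K).quasiMeasurePreserving.ae (R.ae_cfmSummand j i)

lemma exactSummand_ae_eq (R : FiniteCFM φ ρ₀ ρ₁ model θ) (j : Fin m) (i : Fin n) (K : ℕ) :
    exactSummand (K := K) φ ρ₀ ρ₁ model θ j i =ᵐ[extBatchLaw ρ₀ ρ₁ m n K]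
      fun ω => weightedMean (φ.cutDensity ρ₀) ρ₁ (cutGrad φ model θ) (batchArg φ j i ω.1) :=
  (R.measurePreserving_extBatch m n K).quasiMeasurePreserving.ae (R.ae_exactSummand j i)

lemma memLp_cfmSummand (R : FiniteCFM φ ρ₀ ρ₁ model θ) (j : Fin m) (i : Fin n) (K : ℕ) :
    MemLp (cfmSummand (K := K) φ model θ j i) 2 (extBatchLaw ρ₀ ρ₁ m n K) :=
  (R.memLp_extBatchGrad j i K).ae_eq (R.cfmSummand_ae_eq j i K).symm

lemma memLp_exfmSummand (R : FiniteCFM φ ρ₀ ρ₁ model θ) (j : Fin m) (i : Fin n) (K : ℕ) :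
    MemLp (exfmSummand (K := K) φ ρ₀ model θ j i) 2 (extBatchLaw ρ₀ ρ₁ m n K) :=
  ((R.hasJointDensity_extBatch j i K).memLp_selfNormMean (r := φ.cutDensity ρ₀)
    R.measurable_density R.nonneg R.stronglyMeasurable_grad (R.memLp_extBatchGrad j i K)).ae_eq
    (EventuallyEq.symm (R.ae_exfmSummand j i K))

lemma condExp_cfmSummand (R : FiniteCFM φ ρ₀ ρ₁ model θ) (j : Fin m) (i : Fin n) (K : ℕ) :
    (extBatchLaw ρ₀ ρ₁ m n K)[cfmSummand φ model θ j i | argSigma φ j i]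
      =ᵐ[extBatchLaw ρ₀ ρ₁ m n K] exactSummand φ ρ₀ ρ₁ model θ j i := by
  have := R.isProbabilityMeasure_extBatch m n K
  have H := (R.hasJointDensity_extBatch j i K).eval R.measurable_density R.nonneg
  exact (condExp_congr_ae (R.cfmSummand_ae_eq j i K)).trans
    ((H.condExp_eq R.stronglyMeasurable_grad
      ((R.memLp_extBatchGrad j i K).integrable one_le_two)).trans
      (R.exactSummand_ae_eq j i K).symm)

lemma condExp_exfmSummand (R : FiniteCFM φ ρ₀ ρ₁ model θ) (j : Fin m) (i : Fin n) (K : ℕ) :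
    (extBatchLaw ρ₀ ρ₁ m n K)[exfmSummand φ ρ₀ model θ j i | argSigma φ j i]
      =ᵐ[extBatchLaw ρ₀ ρ₁ m n K] exactSummand φ ρ₀ ρ₁ model θ j i := by
  have := R.isProbabilityMeasure_extBatch m n K
  have H := R.hasJointDensity_extBatch j i K
  exact (condExp_congr_ae (R.ae_exfmSummand j i K)).trans
    ((H.condExp_selfNormMean (r := φ.cutDensity ρ₀) R.measurable_density R.nonneg
      R.stronglyMeasurable_grad (R.memLp_extBatchGrad j i K)).trans
      (R.exactSummand_ae_eq j i K).symm)

/-- The component of `cutGrad` in the direction `u`. -/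
noncomputable def directionalGrad (φ : ConditionalFlow d) (model : Vec p → Vec d → ℝ → Vec d)
    (θ u : Vec p) (z : Vec d × ℝ) (y : Vec d) : ℝ :=
  inner ℝ u (cutGrad φ model θ z y)

omit [IsProbabilityMeasure ρ₁] in
lemma measurable_directionalGrad (R : FiniteCFM φ ρ₀ ρ₁ model θ) (u : Vec p) :
    Measurable (uncurry (directionalGrad φ model θ u)) :=
  R.measurable_grad.const_inner

lemma condVar_exfmSummand (R : FiniteCFM φ ρ₀ ρ₁ model θ) (j : Fin m) (i : Fin n) (K : ℕ)
    (u : Vec p) :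
    ∀ᵐ ω ∂(extBatchLaw ρ₀ ρ₁ m n K),
      condVar (argSigma φ j i) (fun ω => inner ℝ u (exfmSummand φ ρ₀ model θ j i ω))
          (extBatchLaw ρ₀ ρ₁ m n K) ω ≤
        condVar (argSigma φ j i) (fun ω => inner ℝ u (cfmSummand φ model θ j i ω))
          (extBatchLaw ρ₀ ρ₁ m n K) ω ∧
      (2 ≤ n + K →
        0 < condVar (argSigma φ j i) (fun ω => inner ℝ u (cfmSummand φ model θ j i ω))
          (extBatchLaw ρ₀ ρ₁ m n K) ω →
        condVar (argSigma φ j i) (fun ω => inner ℝ u (exfmSummand φ ρ₀ model θ j i ω))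
            (extBatchLaw ρ₀ ρ₁ m n K) ω <
          condVar (argSigma φ j i) (fun ω => inner ℝ u (cfmSummand φ model θ j i ω))
            (extBatchLaw ρ₀ ρ₁ m n K) ω) := by
  have := R.isProbabilityMeasure_extBatch m n K
  have H := R.hasJointDensity_extBatch j i K
  have hi : MemLp (fun ω : ExtBatch d m n K => directionalGrad φ model θ u (batchArg φ j i ω.1)
      ((Sum.elim (batchEnds ω.1) ω.2 : Fin n ⊕ Fin K → Vec d) (Sum.inl i))) 2
      (extBatchLaw ρ₀ ρ₁ m n K) := (R.memLp_extBatchGrad j i K).const_inner u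
  have e1 : (fun ω : ExtBatch d m n K => inner ℝ u (exfmSummand φ ρ₀ model θ j i ω))
      =ᵐ[extBatchLaw ρ₀ ρ₁ m n K] fun ω => selfNormMean (φ.cutDensity ρ₀)
        (directionalGrad φ model θ u) (batchArg φ j i ω.1) (Sum.elim (batchEnds ω.1) ω.2) := by
    filter_upwards [R.ae_exfmSummand j i K] with ω hω
    rw [hω]
    -- A fixed direction `u` is a linear functional, so it passes through the self-normalized mean
    -- and the scalar variance comparison applies.
    exact (selfNormMean_clm_comp (fun _ => innerSL ℝ u) _).symm
  have e2 : (fun ω : ExtBatch d m n K => inner ℝ u (cfmSummand φ model θ j i ω))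
      =ᵐ[extBatchLaw ρ₀ ρ₁ m n K] fun ω => directionalGrad φ model θ u (batchArg φ j i ω.1)
      ((Sum.elim (batchEnds ω.1) ω.2 : Fin n ⊕ Fin K → Vec d) (Sum.inl i)) := by
    filter_upwards [R.cfmSummand_ae_eq j i K] with ω hω
    rw [hω]
    rfl
  have hle := H.condVar_selfNormMean_le (r := φ.cutDensity ρ₀) R.measurable_density R.nonneg
    (R.measurable_directionalGrad u) hi
  have hlt := fun hc => H.condVar_selfNormMean_lt (r := φ.cutDensity ρ₀) R.measurable_density
    R.nonneg (R.measurable_directionalGrad u) hi hc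
  have hlt' : ∀ᵐ ω ∂(extBatchLaw ρ₀ ρ₁ m n K), 2 ≤ n + K →
      0 < condVar (argSigma φ j i) (fun ω => directionalGrad φ model θ u (batchArg φ j i ω.1)
        ((Sum.elim (batchEnds ω.1) ω.2 : Fin n ⊕ Fin K → Vec d) (Sum.inl i)))
        (extBatchLaw ρ₀ ρ₁ m n K) ω →
      condVar (argSigma φ j i) (fun ω => selfNormMean (φ.cutDensity ρ₀)
        (directionalGrad φ model θ u) (batchArg φ j i ω.1)
        (Sum.elim (batchEnds ω.1) ω.2 : Fin n ⊕ Fin K → Vec d)) (extBatchLaw ρ₀ ρ₁ m n K) ω <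
      condVar (argSigma φ j i) (fun ω => directionalGrad φ model θ u (batchArg φ j i ω.1)
        ((Sum.elim (batchEnds ω.1) ω.2 : Fin n ⊕ Fin K → Vec d) (Sum.inl i)))
        (extBatchLaw ρ₀ ρ₁ m n K) ω := by
    by_cases hc : 2 ≤ n + K
    · filter_upwards [hlt (by simpa using hc)] with ω hω _ using hω
    · exact ae_of_all _ fun _ h => absurd h hc
  filter_upwards [hle, hlt', condVar_congr_ae (m := argSigma φ j i) e1,
    condVar_congr_ae (m := argSigma φ j i) e2] with ω h1 h2 h3 h4
  rw [h3, h4]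
  exact ⟨h1, h2⟩

/-! ### Errors of the whole gradients -/

/-- The error of the `(j,i)` summand of the CFM gradient. -/
noncomputable def cfmDeviation (φ : ConditionalFlow d) (ρ₀ : Vec d → ℝ) (ρ₁ : Measure (Vec d))
    (model : Vec p → Vec d → ℝ → Vec d) (θ : Vec p) (j : Fin m) (i : Fin n) (b : Batch d m n) :
    Vec p :=
  cutGrad φ model θ (batchArg φ j i b) (batchEnds b i) -
    weightedMean (φ.cutDensity ρ₀) ρ₁ (cutGrad φ model θ) (batchArg φ j i b)

/-- The error of the `(j,i)` summand of the ExFM gradient. -/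
noncomputable def exfmDeviation (φ : ConditionalFlow d) (ρ₀ : Vec d → ℝ) (ρ₁ : Measure (Vec d))
    (model : Vec p → Vec d → ℝ → Vec d) (θ : Vec p) {K : ℕ} (j : Fin m) (i : Fin n)
    (ω : ExtBatch d m n K) : Vec p :=
  selfNormMean (φ.cutDensity ρ₀) (cutGrad φ model θ) (batchArg φ j i ω.1)
      (Sum.elim (batchEnds ω.1) ω.2) -
    weightedMean (φ.cutDensity ρ₀) ρ₁ (cutGrad φ model θ) (batchArg φ j i ω.1)

lemma exactGrad_ae_eq (R : FiniteCFM φ ρ₀ ρ₁ model θ) :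
    exactGrad (m := m) (n := n) φ ρ₀ ρ₁ model θ =ᵐ[batchLaw ρ₀ ρ₁ m n] fun b => ∑ j, ∑ i,
      weightedMean (φ.cutDensity ρ₀) ρ₁ (cutGrad φ model θ) (batchArg φ j i b) := by
  have h : ∀ᵐ b ∂(batchLaw ρ₀ ρ₁ m n), ∀ j i, _ :=
    ae_all_iff.2 fun j => ae_all_iff.2 fun i => R.ae_exactSummand j i
  filter_upwards [h] with b hb
  rw [exactGrad, lossGrad_eq_sum φ R.model_differentiable]
  exact Finset.sum_congr rfl fun j _ => Finset.sum_congr rfl fun i _ => hb j i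

lemma cfmError_ae_eq (R : FiniteCFM φ ρ₀ ρ₁ model θ) :
    cfmError (m := m) (n := n) φ ρ₀ ρ₁ model θ =ᵐ[batchLaw ρ₀ ρ₁ m n]
      fun b => ∑ j, ∑ i, cfmDeviation φ ρ₀ ρ₁ model θ j i b := by
  have h : ∀ᵐ b ∂(batchLaw ρ₀ ρ₁ m n), ∀ j i, _ :=
    ae_all_iff.2 fun j => ae_all_iff.2 fun i => R.ae_cfmSummand j i
  filter_upwards [h, R.exactGrad_ae_eq] with b hb hb2
  rw [cfmError, hb2, cfmGrad, lossGrad_eq_sum φ R.model_differentiable]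
  simp only [cfmDeviation, Finset.sum_sub_distrib, hb]

lemma exfmError_ae_eq (R : FiniteCFM φ ρ₀ ρ₁ model θ) (K : ℕ) :
    exfmError (m := m) (n := n) (K := K) φ ρ₀ ρ₁ model θ =ᵐ[extBatchLaw ρ₀ ρ₁ m n K]
      fun ω => ∑ j, ∑ i, exfmDeviation φ ρ₀ ρ₁ model θ j i ω := by
  have h : ∀ᵐ ω ∂(extBatchLaw ρ₀ ρ₁ m n K), ∀ j i, _ :=
    ae_all_iff.2 fun j => ae_all_iff.2 fun i => R.ae_exfmSummand j i K
  have h2 := (R.measurePreserving_extBatch m n K).quasiMeasurePreserving.ae R.exactGrad_ae_eq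
  filter_upwards [h, h2] with ω hb hb2
  rw [exfmError, hb2, exfmGrad, lossGrad_eq_sum φ R.model_differentiable]
  simp only [exfmDeviation, Finset.sum_sub_distrib]
  congr 1
  exact Finset.sum_congr rfl fun j _ => Finset.sum_congr rfl fun i _ => hb j i

lemma memLp_batchMean (R : FiniteCFM φ ρ₀ ρ₁ model θ) (j : Fin m) (i : Fin n) :
    MemLp (fun b => weightedMean (φ.cutDensity ρ₀) ρ₁ (cutGrad φ model θ) (batchArg φ j i b)) 2
      (batchLaw ρ₀ ρ₁ m n) := by
  have := R.isProbabilityMeasure_batch m n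
  exact ((R.hasJointDensity_batch j i).eval R.measurable_density R.nonneg).memLp_weightedMean
    R.stronglyMeasurable_grad one_le_two (R.memLp_batchGrad j i)

lemma memLp_cfmDeviation (R : FiniteCFM φ ρ₀ ρ₁ model θ) (j : Fin m) (i : Fin n) :
    MemLp (cfmDeviation φ ρ₀ ρ₁ model θ j i) 2 (batchLaw ρ₀ ρ₁ m n) :=
  (R.memLp_batchGrad j i).sub (R.memLp_batchMean j i)

lemma memLp_extBatchMean (R : FiniteCFM φ ρ₀ ρ₁ model θ) (j : Fin m) (i : Fin n) (K : ℕ) :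
    MemLp (fun ω : ExtBatch d m n K =>
      weightedMean (φ.cutDensity ρ₀) ρ₁ (cutGrad φ model θ) (batchArg φ j i ω.1)) 2
      (extBatchLaw ρ₀ ρ₁ m n K) := by
  have h := (R.memLp_batchMean j i).comp_measurePreserving (R.measurePreserving_extBatch m n K)
  exact h

lemma memLp_extBatchSelfNorm (R : FiniteCFM φ ρ₀ ρ₁ model θ) (j : Fin m) (i : Fin n) (K : ℕ) :
    MemLp (fun ω : ExtBatch d m n K =>
      selfNormMean (φ.cutDensity ρ₀) (cutGrad φ model θ) (batchArg φ j i ω.1)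
        (Sum.elim (batchEnds ω.1) ω.2)) 2 (extBatchLaw ρ₀ ρ₁ m n K) :=
  (R.hasJointDensity_extBatch j i K).memLp_selfNormMean (r := φ.cutDensity ρ₀)
    R.measurable_density R.nonneg R.stronglyMeasurable_grad (R.memLp_extBatchGrad j i K)

lemma memLp_exfmDeviation (R : FiniteCFM φ ρ₀ ρ₁ model θ) (j : Fin m) (i : Fin n) (K : ℕ) :
    MemLp (exfmDeviation (K := K) φ ρ₀ ρ₁ model θ j i) 2 (extBatchLaw ρ₀ ρ₁ m n K) :=
  (R.memLp_extBatchSelfNorm j i K).sub (R.memLp_extBatchMean j i K)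

lemma integral_cfmDeviation (R : FiniteCFM φ ρ₀ ρ₁ model θ) (j : Fin m) (i : Fin n) :
    ∫ b, cfmDeviation φ ρ₀ ρ₁ model θ j i b ∂(batchLaw ρ₀ ρ₁ m n) = 0 := by
  have := R.isProbabilityMeasure_batch m n
  have H := (R.hasJointDensity_batch (m := m) j i).eval R.measurable_density R.nonneg
  have hi := (R.memLp_batchGrad (m := m) j i).integrable one_le_two
  unfold cfmDeviation
  rw [integral_sub hi ((R.memLp_batchMean j i).integrable one_le_two),
    ← integral_congr_ae (H.condExp_eq R.stronglyMeasurable_grad hi),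
    integral_condExp H.measurable_left.comap_le, sub_self]

lemma integral_exfmDeviation (R : FiniteCFM φ ρ₀ ρ₁ model θ) (j : Fin m) (i : Fin n) (K : ℕ) :
    ∫ ω, exfmDeviation φ ρ₀ ρ₁ model θ j i ω ∂(extBatchLaw ρ₀ ρ₁ m n K) = 0 := by
  have := R.isProbabilityMeasure_extBatch m n K
  have H := R.hasJointDensity_extBatch (m := m) j i K
  have hi := R.memLp_extBatchGrad (m := m) j i K
  unfold exfmDeviation
  rw [integral_sub ((R.memLp_extBatchSelfNorm j i K).integrable one_le_two)
    ((R.memLp_extBatchMean j i K).integrable one_le_two),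
    ← integral_congr_ae (H.condExp_selfNormMean (r := φ.cutDensity ρ₀) R.measurable_density
      R.nonneg R.stronglyMeasurable_grad hi),
    integral_condExp H.measurable_left.comap_le, sub_self]

lemma memLp_exactGrad (R : FiniteCFM φ ρ₀ ρ₁ model θ) :
    MemLp (exactGrad (m := m) (n := n) φ ρ₀ ρ₁ model θ) 2 (batchLaw ρ₀ ρ₁ m n) :=
  (memLp_finsetSum _ fun j _ => memLp_finsetSum _ fun i _ => R.memLp_batchMean j i).ae_eq
    R.exactGrad_ae_eq.symm

lemma memLp_cfmError (R : FiniteCFM φ ρ₀ ρ₁ model θ) :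
    MemLp (cfmError (m := m) (n := n) φ ρ₀ ρ₁ model θ) 2 (batchLaw ρ₀ ρ₁ m n) :=
  (memLp_finsetSum _ fun j _ => memLp_finsetSum _ fun i _ => R.memLp_cfmDeviation j i).ae_eq
    R.cfmError_ae_eq.symm

lemma memLp_exfmError (R : FiniteCFM φ ρ₀ ρ₁ model θ) (K : ℕ) :
    MemLp (exfmError (m := m) (n := n) (K := K) φ ρ₀ ρ₁ model θ) 2
      (extBatchLaw ρ₀ ρ₁ m n K) :=
  (memLp_finsetSum _ fun j _ => memLp_finsetSum _ fun i _ => R.memLp_exfmDeviation j i K).ae_eq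
    (R.exfmError_ae_eq K).symm

lemma integral_cfmError (R : FiniteCFM φ ρ₀ ρ₁ model θ) (m n : ℕ) :
    ∫ b, cfmError φ ρ₀ ρ₁ model θ b ∂(batchLaw ρ₀ ρ₁ m n) = 0 := by
  have := R.isProbabilityMeasure_batch m n
  have hi : ∀ (j : Fin m) (i : Fin n), Integrable (cfmDeviation φ ρ₀ ρ₁ model θ j i)
      (batchLaw ρ₀ ρ₁ m n) := fun j i => (R.memLp_cfmDeviation j i).integrable one_le_two
  rw [integral_congr_ae R.cfmError_ae_eq,
    integral_finsetSum _ fun j _ => integrable_finsetSum _ fun i _ => hi j i]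
  refine Finset.sum_eq_zero fun j _ => ?_
  rw [integral_finsetSum _ fun i _ => hi j i]
  exact Finset.sum_eq_zero fun i _ => R.integral_cfmDeviation j i

lemma integral_exfmError (R : FiniteCFM φ ρ₀ ρ₁ model θ) (m n K : ℕ) :
    ∫ ω, exfmError φ ρ₀ ρ₁ model θ ω ∂(extBatchLaw ρ₀ ρ₁ m n K) = 0 := by
  have := R.isProbabilityMeasure_extBatch m n K
  have hi : ∀ (j : Fin m) (i : Fin n), Integrable (exfmDeviation φ ρ₀ ρ₁ model θ j i)
      (extBatchLaw ρ₀ ρ₁ m n K) := fun j i => (R.memLp_exfmDeviation j i K).integrable one_le_two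
  rw [integral_congr_ae (R.exfmError_ae_eq K),
    integral_finsetSum _ fun j _ => integrable_finsetSum _ fun i _ => hi j i]
  refine Finset.sum_eq_zero fun j _ => ?_
  rw [integral_finsetSum _ fun i _ => hi j i]
  exact Finset.sum_eq_zero fun i _ => R.integral_exfmDeviation j i K

/-- Minkowski's inequality over the fixed number `m n` of summands, regardless of their dependence.
-/
theorem tendsto_eLpNorm_exfmError (R : FiniteCFM φ ρ₀ ρ₁ model θ) (m n : ℕ) :
    Tendsto (fun K => eLpNorm (exfmError (m := m) (n := n) (K := K) φ ρ₀ ρ₁ model θ) 2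
      (extBatchLaw ρ₀ ρ₁ m n K)) atTop (𝓝 0) := by
  have := R.isProbabilityMeasure_batch m n
  have h1 : ∀ (j : Fin m) (i : Fin n), Tendsto (fun K =>
      eLpNorm (exfmDeviation (K := K) φ ρ₀ ρ₁ model θ j i) 2 (extBatchLaw ρ₀ ρ₁ m n K))
      atTop (𝓝 0) := fun j i =>
    (R.hasJointDensity_batch j i).tendsto_eLpNorm_selfNormMean R.measurable_density R.nonneg
      R.stronglyMeasurable_grad (R.memLp_batchGrad j i)
  have h2 : Tendsto (fun K => ∑ j, ∑ i,
      eLpNorm (exfmDeviation (K := K) φ ρ₀ ρ₁ model θ j i) 2 (extBatchLaw ρ₀ ρ₁ m n K))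
      atTop (𝓝 (∑ _ : Fin m, ∑ _ : Fin n, 0)) :=
    tendsto_finsetSum _ fun j _ => tendsto_finsetSum _ fun i _ => h1 j i
  simp only [Finset.sum_const_zero] at h2
  refine tendsto_of_tendsto_of_tendsto_of_le_of_le tendsto_const_nhds h2 (fun _ => zero_le)
    fun K => ?_
  have hm : ∀ (j : Fin m) (i : Fin n), AEStronglyMeasurable
      (exfmDeviation φ ρ₀ ρ₁ model θ j i) (extBatchLaw ρ₀ ρ₁ m n K) :=
    fun j i => (R.memLp_exfmDeviation j i K).1
  have e : (fun ω : ExtBatch d m n K => ∑ j, ∑ i, exfmDeviation φ ρ₀ ρ₁ model θ j i ω) =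
      ∑ j, ∑ i, exfmDeviation φ ρ₀ ρ₁ model θ j i := by
    ext1 ω
    simp only [Finset.sum_apply]
  rw [eLpNorm_congr_ae (R.exfmError_ae_eq K), e]
  refine (eLpNorm_sum_le (fun j _ => Finset.aestronglyMeasurable_sum _ fun i _ => hm j i)
    one_le_two).trans (Finset.sum_le_sum fun j _ => ?_)
  exact eLpNorm_sum_le (fun i _ => hm j i) one_le_two

end FiniteCFM

/-! ### Comparison of the variances -/

lemma integral_norm_sq_eq_eLpNorm_sq {Ω E : Type*} [MeasurableSpace Ω] {μ : Measure Ω}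
    [NormedAddCommGroup E] {f : Ω → E} (hf : MemLp f 2 μ) :
    ∫ ω, ‖f ω‖ ^ 2 ∂μ = (eLpNorm f 2 μ).toReal ^ 2 := by
  have h0 : 0 ≤ ∫ ω, ‖f ω‖ ^ 2 ∂μ := integral_nonneg fun _ => sq_nonneg _
  rw [hf.eLpNorm_eq_integral_rpow_norm two_ne_zero ENNReal.ofNat_ne_top]
  simp only [ENNReal.toReal_ofNat, Real.rpow_ofNat]
  rw [ENNReal.toReal_ofReal (by positivity), ← Real.rpow_natCast, ← Real.rpow_mul h0]
  norm_num

/-- The covariance is controlled by the nonnegative variance of `s X - F`, divided by `s`. -/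
lemma variance_add_le {Ω : Type*} [MeasurableSpace Ω] {μ : Measure Ω} [IsFiniteMeasure μ]
    {X F : Ω → ℝ} (hX : MemLp X 2 μ) (hF : MemLp F 2 μ) {s : ℝ} (hs : 0 < s) :
    variance (fun ω => X ω + F ω) μ ≤ (1 + s) * variance X μ + (1 + s⁻¹) * variance F μ := by
  have h1 := variance_fun_add hX hF
  have h2 := variance_nonneg (fun ω => s * X ω - F ω) μ
  rw [variance_fun_sub (hX.const_mul s) hF, variance_const_mul, covariance_const_mul_left] at h2
  have h3 : 0 ≤ s⁻¹ * (s ^ 2 * variance X μ - 2 * (s * covariance X F μ) + variance F μ) :=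
    mul_nonneg (inv_nonneg.2 hs.le) h2
  have h4 : s⁻¹ * (s ^ 2 * variance X μ - 2 * (s * covariance X F μ) + variance F μ) =
      s * variance X μ - 2 * covariance X F μ + s⁻¹ * variance F μ := by
    field_simp
  rw [h1]
  nlinarith [h3, h4]

namespace FiniteCFM

variable {d p : ℕ} {φ : ConditionalFlow d} {ρ₀ : Vec d → ℝ} {ρ₁ : Measure (Vec d)}
  [IsProbabilityMeasure ρ₁] {model : Vec p → Vec d → ℝ → Vec d} {θ : Vec p} {m n : ℕ}

theorem tendsto_integral_norm_exfmError_sq (R : FiniteCFM φ ρ₀ ρ₁ model θ) (m n : ℕ) :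
    Tendsto (fun K => ∫ ω, ‖exfmError (m := m) (n := n) (K := K) φ ρ₀ ρ₁ model θ ω‖ ^ 2
      ∂(extBatchLaw ρ₀ ρ₁ m n K)) atTop (𝓝 0) := by
  have h := ((ENNReal.tendsto_toReal ENNReal.zero_ne_top).comp
    (R.tendsto_eLpNorm_exfmError m n)).pow 2
  simp only [ENNReal.toReal_zero, ne_eq, OfNat.ofNat_ne_zero, not_false_eq_true, zero_pow] at h
  exact h.congr fun K => (integral_norm_sq_eq_eLpNorm_sq (R.memLp_exfmError K)).symm

theorem tendsto_variance_exfmError (R : FiniteCFM φ ρ₀ ρ₁ model θ) (m n : ℕ) (u : Vec p) :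
    Tendsto (fun K => variance
      (fun ω => inner ℝ u (exfmError (m := m) (n := n) (K := K) φ ρ₀ ρ₁ model θ ω))
      (extBatchLaw ρ₀ ρ₁ m n K)) atTop (𝓝 0) := by
  have h := (R.tendsto_integral_norm_exfmError_sq m n).const_mul (‖u‖ ^ 2)
  rw [mul_zero] at h
  refine tendsto_of_tendsto_of_tendsto_of_le_of_le tendsto_const_nhds h
    (fun K => variance_nonneg _ _) fun K => ?_
  have := R.isProbabilityMeasure_extBatch m n K
  have hu := (R.memLp_exfmError (m := m) (n := n) K).const_inner (𝕜 := ℝ) u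
  refine (variance_le_expectation_sq hu.1).trans ?_
  rw [← integral_const_mul]
  refine integral_mono hu.integrable_sq
    ((R.memLp_exfmError K).integrable_norm_pow two_ne_zero |>.const_mul _) fun ω => ?_
  simp only [Pi.pow_apply]
  rw [← mul_pow, ← sq_abs]
  exact pow_le_pow_left₀ (abs_nonneg _) (abs_real_inner_le_norm _ _) 2

lemma totalVariance_exfmError (R : FiniteCFM φ ρ₀ ρ₁ model θ) (m n K : ℕ) :
    totalVariance (exfmError φ ρ₀ ρ₁ model θ) (extBatchLaw ρ₀ ρ₁ m n K) =
      ∫ ω, ‖exfmError φ ρ₀ ρ₁ model θ ω‖ ^ 2 ∂(extBatchLaw ρ₀ ρ₁ m n K) := by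
  simp only [totalVariance, R.integral_exfmError, sub_zero]

lemma ae_inner_weightedMean (R : FiniteCFM φ ρ₀ ρ₁ model θ) (u : Vec p) (j : Fin m) (i : Fin n) :
    ∀ᵐ b ∂(batchLaw ρ₀ ρ₁ m n),
      inner ℝ u (weightedMean (φ.cutDensity ρ₀) ρ₁ (cutGrad φ model θ) (batchArg φ j i b)) =
        weightedMean (φ.cutDensity ρ₀) ρ₁ (directionalGrad φ model θ u) (batchArg φ j i b) := by
  have := R.isProbabilityMeasure_batch m n
  have H := (R.hasJointDensity_batch j i).eval R.measurable_density R.nonneg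
  filter_upwards [H.ae_of_ae (H.ae_integrable R.stronglyMeasurable_grad
    ((R.memLp_batchGrad j i).integrable one_le_two))] with b hb
  exact (weightedMean_clm_comp (fun _ => innerSL ℝ u) hb).symm

/-- Isolates the pair `i` as independent of the full sample made of the common time and the pair
`k`. -/
lemma measurePreserving_samplePair (R : FiniteCFM φ ρ₀ ρ₁ model θ) (j : Fin m) {i k : Fin n}
    (hik : i ≠ k) :
    MeasurePreserving (fun b : Batch d m n => (b.2 i, b.1 j, b.2 k)) (batchLaw ρ₀ ρ₁ m n)
      (((noiseLaw ρ₀).prod ρ₁).prod (sampleLaw ρ₀ ρ₁)) := by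
  have := R.isProbabilityMeasure_noise
  have h1 := (measurePreserving_eval (fun _ : Fin m => timeLaw) j).prod
    (measurePreserving_eval_pair ((noiseLaw ρ₀).prod ρ₁) hik)
  have h2 := (measurePreserving_prodAssoc timeLaw ((noiseLaw ρ₀).prod ρ₁)
    ((noiseLaw ρ₀).prod ρ₁)).symm
  have h3 := (Measure.measurePreserving_swap (μ := timeLaw) (ν := (noiseLaw ρ₀).prod ρ₁)).prod
    (MeasurePreserving.id ((noiseLaw ρ₀).prod ρ₁))
  have h4 := measurePreserving_prodAssoc ((noiseLaw ρ₀).prod ρ₁) timeLaw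
    ((noiseLaw ρ₀).prod ρ₁)
  exact h4.comp (h3.comp (h2.comp h1))

/-- At a common time, exact summands are uncorrelated with the errors of the CFM summands. -/
lemma integral_mean_mul_deviation (R : FiniteCFM φ ρ₀ ρ₁ model θ) (u : Vec p) (j : Fin m)
    (i k : Fin n) :
    ∫ b, inner ℝ u (weightedMean (φ.cutDensity ρ₀) ρ₁ (cutGrad φ model θ) (batchArg φ j i b)) *
      inner ℝ u (cfmDeviation φ ρ₀ ρ₁ model θ j k b) ∂(batchLaw ρ₀ ρ₁ m n) = 0 := by
  have := R.isProbabilityMeasure_batch m n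
  have := R.isProbabilityMeasure_noise
  set q := weightedMean (φ.cutDensity ρ₀) ρ₁ (directionalGrad φ model θ u) with hq
  have hD := (R.measurable_directionalGrad u).stronglyMeasurable
  have H := R.hasJointDensity_sample
  have hqm : Measurable q := (H.stronglyMeasurable_weightedMean hD).measurable
  have hae : (fun b => inner ℝ u (weightedMean (φ.cutDensity ρ₀) ρ₁ (cutGrad φ model θ)
      (batchArg φ j i b)) * inner ℝ u (cfmDeviation φ ρ₀ ρ₁ model θ j k b))
      =ᵐ[batchLaw ρ₀ ρ₁ m n] fun b => q (batchArg φ j i b) *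
        (directionalGrad φ model θ u (batchArg φ j k b) (batchEnds b k) - q (batchArg φ j k b)) := by
    filter_upwards [R.ae_inner_weightedMean u j i, R.ae_inner_weightedMean u j k] with b h1 h2
    rw [h1, cfmDeviation, inner_sub_right, h2]
    rfl
  have hint : Integrable (fun b => q (batchArg φ j i b) *
      (directionalGrad φ model θ u (batchArg φ j k b) (batchEnds b k) - q (batchArg φ j k b)))
      (batchLaw ρ₀ ρ₁ m n) :=
    (((R.memLp_batchMean j i).const_inner u).integrable_mul
      ((R.memLp_cfmDeviation j k).const_inner u)).congr hae
  rw [integral_congr_ae hae]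
  -- For `i = k` the mean is a function of the same model arguments as the error, so orthogonality
  -- is direct.
  rcases eq_or_ne i k with rfl | hik
  · exact ((R.hasJointDensity_batch j i).eval R.measurable_density
      R.nonneg).integral_comp_mul_sub_weightedMean hD
      (((R.memLp_batchGrad j i).const_inner u).integrable one_le_two) hqm hint
  · have hp := R.measurePreserving_samplePair (m := m) j hik
    have hA : Measurable fun q : ℝ × Vec d × Vec d => φ.map q.1 q.2.1 q.2.2 := φ.measurable_map
    let g : (Vec d × Vec d) × ℝ × Vec d × Vec d → ℝ := fun w =>
      q (φ.map w.2.1 w.1.2 w.1.1, w.2.1) *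
        (directionalGrad φ model θ u (φ.map w.2.1 w.2.2.2 w.2.2.1, w.2.1) w.2.2.2 -
          q (φ.map w.2.1 w.2.2.2 w.2.2.1, w.2.1))
    have m1 : Measurable fun w : (Vec d × Vec d) × ℝ × Vec d × Vec d =>
        (φ.map w.2.1 w.1.2 w.1.1, w.2.1) :=
      (hA.comp (f := fun w : (Vec d × Vec d) × ℝ × Vec d × Vec d => (w.2.1, w.1.2, w.1.1))
        (by fun_prop)).prodMk (by fun_prop)
    have m2 : Measurable fun w : (Vec d × Vec d) × ℝ × Vec d × Vec d =>
        (φ.map w.2.1 w.2.2.2 w.2.2.1, w.2.1) :=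
      (hA.comp (f := fun w : (Vec d × Vec d) × ℝ × Vec d × Vec d => (w.2.1, w.2.2.2, w.2.2.1))
        (by fun_prop)).prodMk (by fun_prop)
    have m3 : Measurable fun w : (Vec d × Vec d) × ℝ × Vec d × Vec d =>
        directionalGrad φ model θ u (φ.map w.2.1 w.2.2.2 w.2.2.1, w.2.1) w.2.2.2 :=
      (R.measurable_directionalGrad u).comp
        (f := fun w : (Vec d × Vec d) × ℝ × Vec d × Vec d =>
          ((φ.map w.2.1 w.2.2.2 w.2.2.1, w.2.1), w.2.2.2))
        (m2.prodMk (measurable_snd.comp (measurable_snd.comp measurable_snd)))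
    have hg : Measurable g := (hqm.comp m1).mul (m3.sub (hqm.comp m2))
    have hgi : Integrable g (((noiseLaw ρ₀).prod ρ₁).prod (sampleLaw ρ₀ ρ₁)) :=
      (hp.integrable_comp hg.aestronglyMeasurable).1 hint
    have e : ∫ b, q (batchArg φ j i b) *
        (directionalGrad φ model θ u (batchArg φ j k b) (batchEnds b k) - q (batchArg φ j k b))
        ∂(batchLaw ρ₀ ρ₁ m n) = ∫ w, g w ∂(((noiseLaw ρ₀).prod ρ₁).prod (sampleLaw ρ₀ ρ₁)) := by
      rw [← hp.map_eq, integral_map hp.measurable.aemeasurable hg.aestronglyMeasurable]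
      rfl
    rw [e, integral_prod _ hgi]
    refine integral_eq_zero_of_ae ?_
    filter_upwards [hgi.prod_right_ae] with a ha
    -- With the pair `i` frozen as `a`, the first factor depends only on the time, which is one of
    -- the model arguments of the pair `k`.
    exact H.integral_comp_mul_sub_weightedMean hD
      ((R.memLp_sampleGrad.const_inner u).integrable one_le_two)
      (f := fun z => q (φ.map z.2 a.2 a.1, z.2))
      (hqm.comp ((hA.comp (f := fun z : Vec d × ℝ => (z.2, a.2, a.1))
        (by fun_prop)).prodMk measurable_snd)) ha

/-- With a single time every product of a mean and an error is taken at that common time, so each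
term vanishes. With several times, a mean and an error could share `x₁^i` at different times. -/
lemma covariance_exactGrad_cfmError (R : FiniteCFM φ ρ₀ ρ₁ model θ) (n : ℕ) (u : Vec p) :
    covariance (fun b => inner ℝ u (exactGrad (m := 1) (n := n) φ ρ₀ ρ₁ model θ b))
      (fun b => inner ℝ u (cfmError φ ρ₀ ρ₁ model θ b)) (batchLaw ρ₀ ρ₁ 1 n) = 0 := by
  have := R.isProbabilityMeasure_batch 1 n
  have h0 : ∫ b, inner ℝ u (cfmError φ ρ₀ ρ₁ model θ b) ∂(batchLaw ρ₀ ρ₁ 1 n) = (0 : ℝ) := by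
    rw [integral_inner (R.memLp_cfmError.integrable one_le_two), R.integral_cfmError,
      inner_zero_right]
  rw [covariance_eq_sub (R.memLp_exactGrad.const_inner u) (R.memLp_cfmError.const_inner u), h0,
    mul_zero, sub_zero]
  have hae : ((fun b => inner ℝ u (exactGrad (m := 1) (n := n) φ ρ₀ ρ₁ model θ b)) *
      fun b => inner ℝ u (cfmError φ ρ₀ ρ₁ model θ b)) =ᵐ[batchLaw ρ₀ ρ₁ 1 n]
      fun b => ∑ i, ∑ k, inner ℝ u (weightedMean (φ.cutDensity ρ₀) ρ₁ (cutGrad φ model θ)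
        (batchArg φ 0 i b)) * inner ℝ u (cfmDeviation φ ρ₀ ρ₁ model θ 0 k b) := by
    filter_upwards [R.exactGrad_ae_eq, R.cfmError_ae_eq] with b h1 h2
    rw [Pi.mul_apply, h1, h2]
    simp only [Fin.sum_univ_one, Fin.isValue, inner_sum, Finset.sum_mul_sum]
  have hi : ∀ i k, Integrable (fun b => inner ℝ u (weightedMean (φ.cutDensity ρ₀) ρ₁
      (cutGrad φ model θ) (batchArg φ (0 : Fin 1) i b)) *
        (inner ℝ u (cfmDeviation φ ρ₀ ρ₁ model θ 0 k b) : ℝ)) (batchLaw ρ₀ ρ₁ 1 n) := fun i k =>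
    ((R.memLp_batchMean 0 i).const_inner u).integrable_mul
      ((R.memLp_cfmDeviation 0 k).const_inner u)
  rw [integral_congr_ae hae,
    integral_finsetSum _ fun i _ => integrable_finsetSum _ fun k _ => hi i k]
  refine Finset.sum_eq_zero fun i _ => ?_
  rw [integral_finsetSum _ fun k _ => hi i k]
  exact Finset.sum_eq_zero fun k _ => R.integral_mean_mul_deviation u 0 i k

theorem eventually_variance_exfmGrad_lt (R : FiniteCFM φ ρ₀ ρ₁ model θ) (n : ℕ) (u : Vec p)
    (hu : 0 < variance (fun b => inner ℝ u (cfmError φ ρ₀ ρ₁ model θ b))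
      (batchLaw ρ₀ ρ₁ 1 n)) :
    ∀ᶠ K in atTop,
      variance (fun ω => inner ℝ u (exfmGrad (m := 1) φ ρ₀ model θ ω)) (extBatchLaw ρ₀ ρ₁ 1 n K) <
        variance (fun b => inner ℝ u (cfmGrad φ model θ b)) (batchLaw ρ₀ ρ₁ 1 n) := by
  have := R.isProbabilityMeasure_batch 1 n
  set VX := variance (fun b => inner ℝ u (exactGrad (m := 1) (n := n) φ ρ₀ ρ₁ model θ b))
    (batchLaw ρ₀ ρ₁ 1 n) with hVX
  set VE := variance (fun b => inner ℝ u (cfmError φ ρ₀ ρ₁ model θ b)) (batchLaw ρ₀ ρ₁ 1 n)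
    with hVE
  have hVX0 : 0 ≤ VX := variance_nonneg _ _
  have hX : MemLp (fun b => (inner ℝ u (exactGrad (m := 1) (n := n) φ ρ₀ ρ₁ model θ b) : ℝ)) 2
    (batchLaw ρ₀ ρ₁ 1 n) := R.memLp_exactGrad.const_inner u
  have hcfm : variance (fun b => inner ℝ u (cfmGrad φ model θ b)) (batchLaw ρ₀ ρ₁ 1 n) =
      VX + VE := by
    have e : (fun b : Batch d 1 n => (inner ℝ u (cfmGrad φ model θ b) : ℝ)) = fun b =>
        inner ℝ u (exactGrad φ ρ₀ ρ₁ model θ b) + inner ℝ u (cfmError φ ρ₀ ρ₁ model θ b) := by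
      ext b
      rw [cfmError, ← inner_add_right, add_sub_cancel]
    rw [e, variance_fun_add hX (R.memLp_cfmError.const_inner u),
      R.covariance_exactGrad_cfmError]
    ring
  -- Chosen so that `s * VX ≤ VE / 2 < VE`; the added `1` covers `VX = 0`. This leaves room `VE - s
  -- * VX` for the vanishing error term.
  let s : ℝ := VE / (2 * (VX + 1))
  have hs : 0 < s := by positivity
  have hsX : s * VX < VE := by
    have : s * VX ≤ s * (VX + 1) := by gcongr; linarith
    have h2 : s * (VX + 1) = VE / 2 := by
      simp only [s]
      field_simp
    linarith
  have hlim := (R.tendsto_variance_exfmError 1 n u).const_mul (1 + s⁻¹)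
  rw [mul_zero] at hlim
  filter_upwards [hlim.eventually_lt_const (sub_pos.2 hsX)] with K hK
  have := R.isProbabilityMeasure_extBatch 1 n K
  have hfst := R.measurePreserving_extBatch 1 n K
  have e : (fun ω : ExtBatch d 1 n K => (inner ℝ u (exfmGrad φ ρ₀ model θ ω) : ℝ)) = fun ω =>
      inner ℝ u (exactGrad φ ρ₀ ρ₁ model θ ω.1) + inner ℝ u (exfmError φ ρ₀ ρ₁ model θ ω) := by
    ext ω
    rw [exfmError, ← inner_add_right, add_sub_cancel]
  have hXK : MemLp (fun ω : ExtBatch d 1 n K =>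
      (inner ℝ u (exactGrad φ ρ₀ ρ₁ model θ ω.1) : ℝ)) 2 (extBatchLaw ρ₀ ρ₁ 1 n K) :=
    hX.comp_measurePreserving hfst
  have hVXK : variance (fun ω : ExtBatch d 1 n K =>
      (inner ℝ u (exactGrad φ ρ₀ ρ₁ model θ ω.1) : ℝ)) (extBatchLaw ρ₀ ρ₁ 1 n K) = VX := by
    rw [hVX, ← hfst.map_eq, variance_map (by rw [hfst.map_eq]; exact hX.1.aemeasurable)
      hfst.measurable.aemeasurable]
    rfl
  have h := variance_add_le hXK ((R.memLp_exfmError K).const_inner (𝕜 := ℝ) u) hs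
  rw [e, hcfm]
  rw [hVXK] at h
  linarith

end FiniteCFM

theorem theorem2 {d p : ℕ} (φ : ConditionalFlow d)
    (ρ₀ : Vec d → ℝ) (hρ₀_meas : Measurable ρ₀) (hρ₀_nonneg : ∀ x, 0 ≤ ρ₀ x)
    (hρ₀_mass : ∫⁻ x, ENNReal.ofReal (ρ₀ x) = 1)
    (ρ₁ : Measure (Vec d)) [IsProbabilityMeasure ρ₁]
    (model : Vec p → Vec d → ℝ → Vec d)
    (hmodel_meas : ∀ θ, Measurable fun z : Vec d × ℝ => model θ z.1 z.2)
    (θ : Vec p)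
    (hmodel_diff : ∀ x t, DifferentiableAt ℝ (fun θ' => model θ' x t) θ)
    -- the CFM loss is finite at `θ`; the variable is `s = (t, x₀, x₁)`
    (hloss : Integrable
      (fun s : ℝ × Vec d × Vec d =>
        ‖model θ (φ.map s.1 s.2.2 s.2.1) s.1 - φ.timeDeriv s.1 s.2.2 s.2.1‖ ^ 2)
      (timeLaw.prod ((noiseLaw ρ₀).prod ρ₁)))
    -- the one-sample CFM gradient has a finite second moment
    (hgrad : MemLp
      (fun s : ℝ × Vec d × Vec d =>
        summandGrad model θ (φ.map s.1 s.2.2 s.2.1) s.1 (φ.timeDeriv s.1 s.2.2 s.2.1))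
      2 (timeLaw.prod ((noiseLaw ρ₀).prod ρ₁)))
    (m n : ℕ) :
    -- Every summand, with its model arguments fixed, for every `N = n + K`.
    (∀ (K : ℕ) (j : Fin m) (i : Fin n),
      MemLp (cfmSummand (K := K) φ model θ j i) 2 (extBatchLaw ρ₀ ρ₁ m n K) ∧
      MemLp (exfmSummand (K := K) φ ρ₀ model θ j i) 2 (extBatchLaw ρ₀ ρ₁ m n K) ∧
      (extBatchLaw ρ₀ ρ₁ m n K)[cfmSummand φ model θ j i | argSigma φ j i]
        =ᵐ[extBatchLaw ρ₀ ρ₁ m n K] exactSummand φ ρ₀ ρ₁ model θ j i ∧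
      (extBatchLaw ρ₀ ρ₁ m n K)[exfmSummand φ ρ₀ model θ j i | argSigma φ j i]
        =ᵐ[extBatchLaw ρ₀ ρ₁ m n K] exactSummand φ ρ₀ ρ₁ model θ j i ∧
      ∀ u : Vec p,
        ∀ᵐ ω ∂(extBatchLaw ρ₀ ρ₁ m n K),
          condVar (argSigma φ j i) (fun ω => inner ℝ u (exfmSummand φ ρ₀ model θ j i ω))
              (extBatchLaw ρ₀ ρ₁ m n K) ω ≤
            condVar (argSigma φ j i) (fun ω => inner ℝ u (cfmSummand φ model θ j i ω))
              (extBatchLaw ρ₀ ρ₁ m n K) ω ∧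
          (2 ≤ n + K →
            0 < condVar (argSigma φ j i) (fun ω => inner ℝ u (cfmSummand φ model θ j i ω))
              (extBatchLaw ρ₀ ρ₁ m n K) ω →
            condVar (argSigma φ j i) (fun ω => inner ℝ u (exfmSummand φ ρ₀ model θ j i ω))
                (extBatchLaw ρ₀ ρ₁ m n K) ω <
              condVar (argSigma φ j i) (fun ω => inner ℝ u (cfmSummand φ model θ j i ω))
                (extBatchLaw ρ₀ ρ₁ m n K) ω)) ∧
    -- The errors of the whole gradients have mean zero and finite second moments.
    (MemLp (cfmError (m := m) (n := n) φ ρ₀ ρ₁ model θ) 2 (batchLaw ρ₀ ρ₁ m n) ∧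
      (∫ b, cfmError φ ρ₀ ρ₁ model θ b ∂(batchLaw ρ₀ ρ₁ m n)) = 0 ∧
      ∀ K : ℕ,
        MemLp (exfmError (m := m) (n := n) (K := K) φ ρ₀ ρ₁ model θ) 2
          (extBatchLaw ρ₀ ρ₁ m n K) ∧
        (∫ ω, exfmError φ ρ₀ ρ₁ model θ ω ∂(extBatchLaw ρ₀ ρ₁ m n K)) = 0) ∧
    -- The error variance of the whole gradient, in every direction (so for every component).
    (∀ u : Vec p,
      0 < variance (fun b => inner ℝ u (cfmError φ ρ₀ ρ₁ model θ b)) (batchLaw ρ₀ ρ₁ m n) →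
      ∃ N₀ : ℕ, ∀ K : ℕ, N₀ ≤ n + K →
        variance (fun ω => inner ℝ u (exfmError φ ρ₀ ρ₁ model θ ω)) (extBatchLaw ρ₀ ρ₁ m n K) <
          variance (fun b => inner ℝ u (cfmError φ ρ₀ ρ₁ model θ b)) (batchLaw ρ₀ ρ₁ m n)) ∧
    -- The same for the sum of the variances of the components.
    (0 < totalVariance (cfmError φ ρ₀ ρ₁ model θ) (batchLaw ρ₀ ρ₁ m n) →
      ∃ N₀ : ℕ, ∀ K : ℕ, N₀ ≤ n + K →
        totalVariance (exfmError φ ρ₀ ρ₁ model θ) (extBatchLaw ρ₀ ρ₁ m n K) <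
          totalVariance (cfmError φ ρ₀ ρ₁ model θ) (batchLaw ρ₀ ρ₁ m n)) ∧
    -- For one time per step: the variance of the gradient itself, model arguments random as well.
    (m = 1 →
      ∀ u : Vec p,
        0 < variance (fun b => inner ℝ u (cfmError φ ρ₀ ρ₁ model θ b)) (batchLaw ρ₀ ρ₁ m n) →
        ∃ N₀ : ℕ, ∀ K : ℕ, N₀ ≤ n + K →
          variance (fun ω => inner ℝ u (exfmGrad φ ρ₀ model θ ω)) (extBatchLaw ρ₀ ρ₁ m n K) <
            variance (fun b => inner ℝ u (cfmGrad φ model θ b)) (batchLaw ρ₀ ρ₁ m n)) := by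
  have R : FiniteCFM φ ρ₀ ρ₁ model θ :=
    ⟨hρ₀_meas, hρ₀_nonneg, hρ₀_mass, hmodel_meas, hmodel_diff, hloss, hgrad⟩
  -- Thresholds are obtained for the number `K` of further points, while the claim counts `N = n +
  -- K`.
  have hN : ∀ {P : ℕ → Prop}, (∀ᶠ K in atTop, P K) → ∃ N₀ : ℕ, ∀ K : ℕ, N₀ ≤ n + K → P K := by
    intro P hP
    obtain ⟨K₀, hK₀⟩ := eventually_atTop.1 hP
    exact ⟨n + K₀, fun K hK => hK₀ K (Nat.le_of_add_le_add_left hK)⟩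
  refine ⟨fun K j i => ⟨R.memLp_cfmSummand j i K, R.memLp_exfmSummand j i K,
    R.condExp_cfmSummand j i K, R.condExp_exfmSummand j i K, R.condVar_exfmSummand j i K⟩,
    ⟨R.memLp_cfmError, R.integral_cfmError m n,
      fun K => ⟨R.memLp_exfmError K, R.integral_exfmError m n K⟩⟩, fun u hu => ?_, fun h => ?_, ?_⟩
  · exact hN ((R.tendsto_variance_exfmError m n u).eventually_lt_const hu)
  · refine hN (((R.tendsto_integral_norm_exfmError_sq m n).eventually_lt_const h).mono
      fun K hK => ?_)
    rwa [R.totalVariance_exfmError]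
  · rintro rfl u hu
    exact hN (R.eventually_variance_exfmGrad_lt n u hu)
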